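/- Let $K$ be a field (of any characteristic) with a surjective discrete valuation $v : K^\times \to \mathbb{Z}$ and valuation ring $\mathcal{O}_K$. A $(2,2)$-form over $K$ is a polynomial $F(x_1,x_2;y_1,y_2)$ over $K$ that is homogeneous of degree $2$ in $x_1,x_2$ and in $y_1,y_2$. Writing $F = F_1 y_1^2 + F_2 y_1y_2 + F_3y_2^2$, let $I = 12ae-3bd+c^2$ and $J=72ace-27ad^2-27b^2e+9bcd-2c^3$ be the invariants of the binary quartic $F_2^2-4F_1F_3 = ax_1^4+bx_1^3x_2+cx_1^2x_2^2+dx_1x_2^3+ex_2^4$; the discriminant is $\Delta(F) = (c_4^3-c_6^2)/1728$ with $c_4 = I$, $c_6=J/2$. This is a polynomial with integer coefficients in the coefficients of $F$, so it makes sense in every characteristic. A $3\times3\times3$ cube $S=(s_{kij})$ over $K$ has slices $S_k = (s_{kij})_{i,j}$ and bilinear forms $B_k(x;y) = \sum_{i,j} s_{kij}x_iy_j$ for $k=1,2,3$. Its discriminant $\Delta(S)$ is the discriminant $(c_4^3-c_6^2)/1728$ of the ternary cubic $\det(xS_1+yS_2+zS_3)$, where $c_4,c_6$ are the invariants of ternary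 cubics of degrees $4$ and $6$, scaled so that $c_4(xyz)=1$ and $c_6(xyz)=-1$; it is again an integer polynomial in the coefficients. A $(2,2)$-form or cube is integral if all its coefficients lie in $\mathcal{O}_K$. Let $E/K$ be an elliptic curve. Write $\operatorname{Div}_K(E)$ for the group of $K$-rational divisors on $E$, and $\operatorname{sum}:\operatorname{Div}_K(E)\to E(K)$ for the map sending a divisor, written as a formal sum of points over an algebraic closure of $K$, to its sum in the group law of $E$. Let $D,D'\in\operatorname{Div}_K(E)$ have degree $n\in\{2,3\}$. A $(2,2)$-form $F$ (if $n=2$), respectively a cube $S$ (if $n=3$), represents $(E,[D],[D'])$ if, for some choice of $K$-bases of the Riemann-Roch spaces $L(D)$ and $L(D')$, the image of $E$ in $\mathbb{P}^{n-1}\times\mathbb{P}^{n-1}$ under the morphism given by $|D|\times|D'|$ is the closed subscheme defined by $F=0$, respectively by $B_1=B_2=B_3=0$. **Theorem.** Let $E/K$ be an elliptic curve with Weierstrass equation $$y^2+a_1xy+a_3y = x^3+a_2x^2+a_4x, \qquad a_1,a_2,a_3,a_4\in\mathcal{O}_K, \qquad (\ast)$$ and let $P=(0,0)\in E(K)$.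 Let $D,D'\in\operatorname{Div}_K(E)$ be divisors of degree $n\in\{2,3\}$ with $\operatorname{sum}(D'-D)=P$. If $n=2$, then $(E,[D],[D'])$ is represented by an integral $(2,2)$-form whose discriminant equals the discriminant of $(\ast)$. If $n=3$, then $(E,[D],[D'])$ is represented by an integral $3\times3\times3$ cube whose discriminant equals the discriminant of $(\ast)$. -/

import Mathlib

noncomputable section

namespace GenusOne

/-! ### Discriminants of (2,2)-forms and of cubes -/

section Invariants

variable {R : Type*} [CommRing R]

/-- A `(2,2)`-form, given by its matrix `A` of coefficients:
`F(x₁,x₂;y₁,y₂) = (x₁², x₁x₂, x₂²) A (y₁², y₁y₂, y₂²)ᵀ`. -/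
abbrev Form22 (R : Type*) := Matrix (Fin 3) (Fin 3) R

/-- A `3 × 3 × 3` cube `S`, given by its three slices `S 0`, `S 1`, `S 2`. The slice `S k` is the
matrix of the bilinear form `B_k(x;y) = ∑ i j, S k i j * x i * y j`. -/
abbrev Cube (R : Type*) := Fin 3 → Matrix (Fin 3) (Fin 3) R

/-- The invariants `a₁, …, a₆` of a `(2,2)`-form, polynomials with integer coefficients in the
entries of its matrix. The resulting `c₄` and `c₆` are the classical ones, see
`Form22.c₄_eq` and `Form22.two_mul_c₆_eq`. -/
def Form22.weierstrass (A : Form22 R) : WeierstrassCurve R :=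
  let a11 := A 0 0
  let a12 := A 0 1
  let a13 := A 0 2
  let a21 := A 1 0
  let a22 := A 1 1
  let a23 := A 1 2
  let a31 := A 2 0
  let a32 := A 2 1
  let a33 := A 2 2
  { a₁ := -a22
    a₂ := -(a11 * a33 + a12 * a32 + a13 * a31 + a21 * a23)
    a₃ := a12 * a23 * a31 + a13 * a21 * a32 - a11 * a23 * a32 - a12 * a21 * a33
    a₄ := a11 * a12 * a32 * a33 - 4 * a11 * a13 * a31 * a33 + a11 * a13 * a32 ^ 2
      + a11 * a21 * a23 * a33 - a11 * a22 * a23 * a32 + a11 * a23 ^ 2 * a31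
      + a12 ^ 2 * a31 * a33 + a12 * a13 * a31 * a32 - a12 * a21 * a22 * a33
      + a12 * a21 * a23 * a32 + a13 * a21 ^ 2 * a33 + a13 * a21 * a23 * a31
    a₆ := 4 * a11 ^ 2 * a13 * a31 * a33 ^ 2 - a11 ^ 2 * a13 * a32 ^ 2 * a33
      - a11 ^ 2 * a23 ^ 2 * a31 * a33 - a11 * a12 ^ 2 * a31 * a33 ^ 2
      - a11 * a12 * a21 * a23 * a32 * a33 + a11 * a12 * a22 * a23 * a31 * a33
      + 4 * a11 * a13 ^ 2 * a31 ^ 2 * a33 - a11 * a13 ^ 2 * a31 * a32 ^ 2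
      - a11 * a13 * a21 ^ 2 * a33 ^ 2 + a11 * a13 * a21 * a22 * a32 * a33
      - a11 * a13 * a22 ^ 2 * a31 * a33 + a11 * a13 * a22 * a23 * a31 * a32
      - a11 * a13 * a23 ^ 2 * a31 ^ 2 - a12 ^ 2 * a13 * a31 ^ 2 * a33
      + a12 * a13 * a21 * a22 * a31 * a33 - a12 * a13 * a21 * a23 * a31 * a32
      - a13 ^ 2 * a21 ^ 2 * a31 * a33 }

/-- The discriminant of a `(2,2)`-form: the integer polynomial `(c₄³ - c₆²) / 1728`. -/
def Form22.disc (A : Form22 R) : R := A.weierstrass.Δ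

/-- A binary quartic `a x⁴ + b x³ z + c x² z² + d x z³ + e z⁴`. -/
structure BinaryQuartic (R : Type*) where
  (a b c d e : R)

/-- The invariant `I` of a binary quartic. -/
def BinaryQuartic.I (G : BinaryQuartic R) : R := 12 * G.a * G.e - 3 * G.b * G.d + G.c ^ 2

/-- The invariant `J` of a binary quartic. -/
def BinaryQuartic.J (G : BinaryQuartic R) : R :=
  72 * G.a * G.c * G.e - 27 * G.a * G.d ^ 2 - 27 * G.b ^ 2 * G.e + 9 * G.b * G.c * G.d
    - 2 * G.c ^ 3

/-- The binary quartic `F₂² - 4 F₁ F₃` in `x₁, x₂`, where `F = F₁ y₁² + F₂ y₁ y₂ + F₃ y₂²`. -/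
def Form22.quartic (A : Form22 R) : BinaryQuartic R where
  a := A 0 1 ^ 2 - 4 * (A 0 0 * A 0 2)
  b := 2 * A 0 1 * A 1 1 - 4 * (A 0 0 * A 1 2 + A 1 0 * A 0 2)
  c := A 1 1 ^ 2 + 2 * A 0 1 * A 2 1 - 4 * (A 0 0 * A 2 2 + A 1 0 * A 1 2 + A 2 0 * A 0 2)
  d := 2 * A 1 1 * A 2 1 - 4 * (A 1 0 * A 2 2 + A 2 0 * A 1 2)
  e := A 2 1 ^ 2 - 4 * (A 2 0 * A 2 2)

theorem Form22.c₄_eq (A : Form22 R) : A.weierstrass.c₄ = A.quartic.I := by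
  simp only [WeierstrassCurve.c₄, WeierstrassCurve.b₂, WeierstrassCurve.b₄, Form22.weierstrass,
    Form22.quartic, BinaryQuartic.I]
  ring

theorem Form22.two_mul_c₆_eq (A : Form22 R) : 2 * A.weierstrass.c₆ = A.quartic.J := by
  simp only [WeierstrassCurve.c₆, WeierstrassCurve.b₂, WeierstrassCurve.b₄, WeierstrassCurve.b₆,
    Form22.weierstrass, Form22.quartic, BinaryQuartic.J]
  ring

/-- The ternary cubic
`a x³ + b y³ + c z³ + a2 x²y + a3 x²z + b1 xy² + b3 y²z + c1 xz² + c2 yz² + m xyz`. -/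
structure TernaryCubic (R : Type*) where
  (a b c a2 a3 b1 b3 c1 c2 m : R)

/-- The invariants `a₁, …, a₆` of a ternary cubic, polynomials with integer coefficients in the
coefficients of the cubic. The resulting `c₄` and `c₆` are the classical invariants of degrees
`4` and `6`, scaled so that `c₄(xyz) = 1` and `c₆(xyz) = -1`. -/
def TernaryCubic.weierstrass (f : TernaryCubic R) : WeierstrassCurve R :=
  let ⟨a, b, c, a2, a3, b1, b3, c1, c2, m⟩ := f
  { a₁ := m
    a₂ := -(a2 * c2 + a3 * b3 + b1 * c1)
    a₃ := 9 * a * b * c - (a * b3 * c2 + b * a3 * c1 + c * a2 * b1)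
      - (a2 * b3 * c1 + a3 * b1 * c2)
    a₄ := -3 * a * b * c1 * c2 - 3 * a * b1 * b3 * c + a * b1 * c2 ^ 2 + a * b3 ^ 2 * c1
      + a2 ^ 2 * b3 * c - 3 * a2 * a3 * b * c + a2 * a3 * b3 * c2 + a2 * b * c1 ^ 2
      + a2 * b1 * c1 * c2 + a3 ^ 2 * b * c2 + a3 * b1 ^ 2 * c + a3 * b1 * b3 * c1
    a₆ := -27 * a ^ 2 * b ^ 2 * c ^ 2 + 9 * a ^ 2 * b * b3 * c * c2 - a ^ 2 * b * c2 ^ 3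
      - a ^ 2 * b3 ^ 3 * c + 9 * a * a2 * b * b1 * c ^ 2 + 3 * a * a2 * b * b3 * c * c1
      - 3 * a * a2 * b * c * c2 * m + 2 * a * a2 * b * c1 * c2 ^ 2
      - a * a2 * b1 * b3 * c * c2 + a * a2 * b3 ^ 2 * c * m - a * a2 * b3 ^ 2 * c1 * c2
      + 9 * a * a3 * b ^ 2 * c * c1 + 3 * a * a3 * b * b1 * c * c2
      - 3 * a * a3 * b * b3 * c * m - a * a3 * b * b3 * c1 * c2 + a * a3 * b * c2 ^ 2 * m
      + 2 * a * a3 * b1 * b3 ^ 2 * c - a * a3 * b1 * b3 * c2 ^ 2 - a * b ^ 2 * c1 ^ 3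
      - 3 * a * b * b1 * c * c1 * m + 2 * a * b * b1 * c1 ^ 2 * c2 + a * b * b3 * c1 ^ 2 * m
      + a * b * c * m ^ 3 - a * b * c1 * c2 * m ^ 2 - a * b1 ^ 3 * c ^ 2
      + 2 * a * b1 ^ 2 * b3 * c * c1 + a * b1 ^ 2 * c * c2 * m - a * b1 ^ 2 * c1 * c2 ^ 2
      - a * b1 * b3 ^ 2 * c1 ^ 2 - a * b1 * b3 * c * m ^ 2 + a * b1 * b3 * c1 * c2 * m
      - a2 ^ 3 * b * c ^ 2 + 2 * a2 ^ 2 * a3 * b * c * c2 - a2 ^ 2 * a3 * b3 ^ 2 * c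
      + a2 ^ 2 * b * c * c1 * m - a2 ^ 2 * b * c1 ^ 2 * c2 - a2 ^ 2 * b1 * b3 * c * c1
      + 2 * a2 * a3 ^ 2 * b * b3 * c - a2 * a3 ^ 2 * b * c2 ^ 2 - a2 * a3 * b * b1 * c * c1
      - a2 * a3 * b * b3 * c1 ^ 2 - a2 * a3 * b * c * m ^ 2 + a2 * a3 * b * c1 * c2 * m
      - a2 * a3 * b1 ^ 2 * c * c2 + a2 * a3 * b1 * b3 * c * m - a2 * a3 * b1 * b3 * c1 * c2
      - a3 ^ 3 * b ^ 2 * c + a3 ^ 2 * b * b1 * c * m - a3 ^ 2 * b * b1 * c1 * c2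
      - a3 ^ 2 * b1 ^ 2 * b3 * c }

/-- The cubic `y²z + a₁xyz + a₃yz² - x³ - a₂x²z - a₄xz² - a₆z³` has invariants `a₁, …, a₆`. -/
theorem TernaryCubic.weierstrass_of_weierstrass (W : WeierstrassCurve R) :
    (TernaryCubic.mk (-1) 0 (-W.a₆) 0 (-W.a₂) 0 1 (-W.a₄) W.a₃ W.a₁).weierstrass = W := by
  ext <;> simp [TernaryCubic.weierstrass]

theorem TernaryCubic.c₄_c₆_xyz :
    (TernaryCubic.mk (0 : R) 0 0 0 0 0 0 0 0 1).weierstrass.c₄ = 1 ∧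
      (TernaryCubic.mk (0 : R) 0 0 0 0 0 0 0 0 1).weierstrass.c₆ = -1 := by
  simp [TernaryCubic.weierstrass, WeierstrassCurve.c₄, WeierstrassCurve.c₆, WeierstrassCurve.b₂,
    WeierstrassCurve.b₄, WeierstrassCurve.b₆]

/-- The ternary cubic `det (x M + y N + z P)`, where `M, N, P` are the slices of the cube. -/
def Cube.cubic (S : Cube R) : TernaryCubic R where
  a := (S 0).det
  b := (S 1).det
  c := (S 2).det
  a2 := ((S 0).adjugate * S 1).trace
  a3 := ((S 0).adjugate * S 2).trace
  b1 := ((S 1).adjugate * S 0).trace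
  b3 := ((S 1).adjugate * S 2).trace
  c1 := ((S 2).adjugate * S 0).trace
  c2 := ((S 2).adjugate * S 1).trace
  m := ((S 0 + S 1).adjugate * S 2).trace - ((S 0).adjugate * S 2).trace
    - ((S 1).adjugate * S 2).trace

theorem Cube.cubic_eq (S : Cube R) (x y z : R) :
    (x • S 0 + y • S 1 + z • S 2).det =
      S.cubic.a * x ^ 3 + S.cubic.b * y ^ 3 + S.cubic.c * z ^ 3 + S.cubic.a2 * x ^ 2 * y
      + S.cubic.a3 * x ^ 2 * z + S.cubic.b1 * x * y ^ 2 + S.cubic.b3 * y ^ 2 * z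
      + S.cubic.c1 * x * z ^ 2 + S.cubic.c2 * y * z ^ 2 + S.cubic.m * x * y * z := by
  simp only [Cube.cubic, Matrix.det_fin_three, Matrix.adjugate_fin_three, Matrix.trace_fin_three,
    Matrix.mul_apply, Fin.sum_univ_three, Matrix.add_apply, Matrix.smul_apply, smul_eq_mul,
    Matrix.of_apply, Matrix.cons_val]
  ring

/-- The discriminant of a `3 × 3 × 3` cube: the discriminant `(c₄³ - c₆²) / 1728` of its associated
ternary cubic. -/
def Cube.disc (S : Cube R) : R := S.cubic.weierstrass.Δ

end Invariants

/-! ### Subschemes of `ℙⁿ⁻¹ × ℙⁿ⁻¹` -/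

section Image

open MvPolynomial

variable {K : Type*} [Field K] {n : ℕ}

/-- The bihomogeneous coordinate ring `K[x₁,…,xₙ;y₁,…,yₙ]` of `ℙⁿ⁻¹ × ℙⁿ⁻¹`; the variables `xᵢ` are
`X (Sum.inl i)`, and the variables `yⱼ` are `X (Sum.inr j)`. -/
abbrev BiRing (K : Type*) [Field K] (n : ℕ) := MvPolynomial (Fin n ⊕ Fin n) K

/-- `G` is bihomogeneous of bidegree `d`. -/
def IsBihomogeneous (G : BiRing K n) (d : ℕ × ℕ) : Prop :=
  MvPolynomial.IsWeightedHomogeneous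
    (Sum.elim (fun _ => (1, 0)) (fun _ => (0, 1)) : Fin n ⊕ Fin n → ℕ × ℕ) G d

/-- Let `L` be the function field of a projective curve `C` over `K`. The rational functions
`s₁,…,sₙ` and `t₁,…,tₙ` define a morphism `C → ℙⁿ⁻¹ × ℙⁿ⁻¹`. The closed subscheme of
`ℙⁿ⁻¹ × ℙⁿ⁻¹` defined by the bihomogeneous ideal `I` is the image of `C` (with its reduced
structure): a bihomogeneous form `G` vanishes on the image, that is `G(s;t) = 0`, if and only if
it belongs to the saturation of `I` with respect to the irrelevant ideal `(xᵢ yⱼ)`. -/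
def DefinesImage {L : Type*} [Field L] [Algebra K L] (s t : Fin n → L)
    (I : Ideal (BiRing K n)) : Prop :=
  ∀ (d : ℕ × ℕ) (G : BiRing K n), IsBihomogeneous G d →
    (aeval (Sum.elim s t) G = 0 ↔
      ∃ N : ℕ, ∀ i j, (X (Sum.inl i) * X (Sum.inr j)) ^ N * G ∈ I)

/-- The `(2,2)`-form as a polynomial. -/
def Form22.toPoly (A : Form22 K) : BiRing K 2 :=
  ∑ i, ∑ j, C (A i j) *
    (![X (Sum.inl 0) ^ 2, X (Sum.inl 0) * X (Sum.inl 1), X (Sum.inl 1) ^ 2] i *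
      ![X (Sum.inr 0) ^ 2, X (Sum.inr 0) * X (Sum.inr 1), X (Sum.inr 1) ^ 2] j)

/-- The three bilinear forms whose coefficients are the entries of the cube. -/
def Cube.toPoly (S : Cube K) (k : Fin 3) : BiRing K 3 :=
  ∑ i, ∑ j, C (S k i j) * (X (Sum.inl i) * X (Sum.inr j))

end Image

/-! ### Divisors on an elliptic curve -/

section Divisors

open Polynomial

variable {K : Type*} [Field K]

/-- The closed points of the projective curve `W` over `K`: the point at infinity `none`, and the
closed points of the affine curve, i.e. the maximal ideals of its coordinate ring. -/
abbrev ClosedPoint (W : WeierstrassCurve K) := Option (MaximalSpectrum W.toAffine.CoordinateRing)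

/-- The group `Div_K(W)` of `K`-rational divisors on `W`. -/
abbrev Divisor (W : WeierstrassCurve K) := ClosedPoint W →₀ ℤ

/-- The degree over `K` of the residue field at a closed point. -/
def pointDegree (W : WeierstrassCurve K) : ClosedPoint W → ℕ
  | none => 1
  | some M => Module.finrank K (W.toAffine.CoordinateRing ⧸ M.asIdeal)

/-- The degree of a divisor. -/
def degree (W : WeierstrassCurve K) (D : Divisor W) : ℤ :=
  D.sum fun c k => k * pointDegree W c

/-- The base change of `W` to an algebraic closure of `K`. -/
abbrev geom (W : WeierstrassCurve K) : WeierstrassCurve (AlgebraicClosure K) :=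
  W.map (algebraMap K (AlgebraicClosure K))

/-- The multiplicity of the geometric point `Q` in the pull-back to the algebraic closure of the
closed point `c`. For an affine closed point with maximal ideal `M`, this is the largest `k` such
that `M` generates an ideal contained in the `k`-th power of the maximal ideal of `Q`. (It is zero
unless `Q` lies above `c`, in which case it is the inseparable degree of the residue field.) -/
def geomMult (W : WeierstrassCurve K) : ClosedPoint W → (geom W).toAffine.Point → ℕ
  | none, .zero => 1
  | some M, .some x y _ =>
      sSup {k : ℕ | M.asIdeal.map
          (WeierstrassCurve.Affine.CoordinateRing.map W.toAffine
            (algebraMap K (AlgebraicClosure K))) ≤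
        WeierstrassCurve.Affine.CoordinateRing.XYIdeal (geom W).toAffine x (C y) ^ k}
  | none, .some _ _ _ => 0
  | some _, .zero => 0

open Classical in
/-- The sum map `Div_K(E) → E(K) ⊆ E(K̄)`: write a divisor as a formal sum of geometric points, and
add these up using the group law. -/
def divisorSum (W : WeierstrassCurve K) (D : Divisor W) : (geom W).toAffine.Point :=
  D.sum fun c k => k • ∑ᶠ Q : (geom W).toAffine.Point, geomMult W c Q • Q

/-- The order of vanishing at a closed point of a non-zero element `g` of the affine coordinate
ring. At infinity it is minus the degree of the norm of `g` to `K[x]`, so that `x` and `y` have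
orders `-2` and `-3`. -/
def orderAt (W : WeierstrassCurve K) (g : W.toAffine.CoordinateRing) : ClosedPoint W → ℤ
  | none => -((Algebra.norm K[X] g).natDegree : ℤ)
  | some M => (sSup {k : ℕ | g ∈ M.asIdeal ^ k} : ℕ)

/-- The Riemann-Roch space `L(D)` of rational functions `f` with `f = 0` or `div f + D ≥ 0`.
The function `f` is written as a quotient `g / h` of elements of the coordinate ring. -/
def riemannRochSpace (W : WeierstrassCurve K) (D : Divisor W) :
    Set W.toAffine.FunctionField :=
  {f | ∀ g h : W.toAffine.CoordinateRing, g ≠ 0 → h ≠ 0 →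
    algebraMap _ W.toAffine.FunctionField g = f * algebraMap _ W.toAffine.FunctionField h →
    ∀ c : ClosedPoint W, 0 ≤ orderAt W g c - orderAt W h c + D c}

/-- The functions `s₁,…,sₙ` are a `K`-basis of `L(D)`, so that `(s₁ : ⋯ : sₙ)` is the map to
`ℙⁿ⁻¹` given by the complete linear system `|D|`. -/
def IsLinearSystemBasis (W : WeierstrassCurve K) (D : Divisor W) {n : ℕ}
    (s : Fin n → W.toAffine.FunctionField) : Prop :=
  LinearIndependent K s ∧
    (Submodule.span K (Set.range s) : Set W.toAffine.FunctionField) = riemannRochSpace W D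

/-- The triple `(W, [D], [D'])` is represented by the `(2,2)`-form `F`: the image of `W` in
`ℙ¹ × ℙ¹` via `|D| × |D'|`, for some choice of bases, is defined by `F`. -/
def RepresentedByForm22 (W : WeierstrassCurve K) (D D' : Divisor W) (F : Form22 K) : Prop :=
  ∃ s t : Fin 2 → W.toAffine.FunctionField,
    IsLinearSystemBasis W D s ∧ IsLinearSystemBasis W D' t ∧
      DefinesImage (K := K) s t (Ideal.span {F.toPoly})

/-- The triple `(W, [D], [D'])` is represented by the `3 × 3 × 3` cube `S`: the image of `W` in
`ℙ² × ℙ²` via `|D| × |D'|`, for some choice of bases, is defined by the three bilinear forms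
whose coefficients are the entries of `S`. -/
def RepresentedByCube (W : WeierstrassCurve K) (D D' : Divisor W) (S : Cube K) : Prop :=
  ∃ s t : Fin 3 → W.toAffine.FunctionField,
    IsLinearSystemBasis W D s ∧ IsLinearSystemBasis W D' t ∧
      DefinesImage (K := K) s t (Ideal.span (Set.range S.toPoly))

theorem geom_nonsingular_zero (W : WeierstrassCurve K) [W.IsElliptic] (h : W.a₆ = 0) :
    (geom W).toAffine.Nonsingular 0 0 := by
  rw [← WeierstrassCurve.Affine.equation_iff_nonsingular]
  simp [WeierstrassCurve.Affine.equation_iff, h]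

/-- The point `(0,0)` on an elliptic curve with `a₆ = 0`, viewed as a geometric point. -/
def originPoint (W : WeierstrassCurve K) [W.IsElliptic] (h : W.a₆ = 0) :
    (geom W).toAffine.Point :=
  .some 0 0 (geom_nonsingular_zero W h)

end Divisors

end GenusOne

end

/-!
Write `∞` for the point at infinity. The proof gives explicit bases of `L(D)` and `L(D')` and an
explicit form in each case; the problem is to choose the bases so that the coefficients of the form
are integral.

*Reduction to a point `A`.* The coordinate ring of the affine curve is a Dedekind domain; this
descends from the algebraic closure of `K`, where every maximal ideal is the ideal of a point
(`isDedekindDomain_of_map`). Its ideal class group is the group of rational points: Mathlib has the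
injectivity of `Point.toClass`, and surjectivity follows from Riemann's inequality
(`toClass_surjective`). So there is a rational point `A` with `D ∼ (n + 1) ∞ - A`, and the condition
`sum (D' - D) = P` becomes `D' ∼ (n + 2) ∞ - A - (-P)`; here `divisorClass_eq_toClass` compares the
sum of a divisor, which is computed over the algebraic closure, with its ideal class. If
`A = (p, q)` is an affine point, then up to common factors `L(D)` consists of the functions with a
pole of order at most `n + 1` at infinity which vanish at `A`, and `L(D')` of those with a pole of
order at most `n + 2` which vanish at `A` and at `-P` (`exists_riemannRochSpace_eq`,
`exists_basis_of_point`, `exists_basis_of_pair`).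

*Integral points.* Let `p` and `q` be integral. The curve equation says that the matrix
`(p, q; q + a₃, p² + a₂ p + a₄ - a₁ q)` is singular, so over the valuation ring it is the product of
a column `(γ, δ)` and a row `(α, β)` which contains the entry `1` (`exists_isFactorization`). The line
`γ (y - q) = δ (x - p)` passes through `A` and `-P` (`line_mem`), and in the bases
`x - p, y - q, x (x - p)` of `L(D)` and `γ (y - q) - δ (x - p), -x (x - p), -x (y - q)` of `L(D')`,
without the last entries if `n = 2`, the curve is defined by `factorForm` or `factorCube`.

*Points near infinity.* If `p` is not integral, then `q² / p³` is a unit, and `τ = p / q` and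
`σ = q² / p³` are integral (`exists_isSlope`). A change of basis leads to the forms `slopeForm` and
`slopeCube`, whose coefficients are polynomials in `τ`, `σ` and the `aᵢ`. The value `τ = 0`, `σ = 1`
gives the forms for `A = ∞`.

*The ideal of the image.* A form vanishing on the image is reduced by pseudo-division, modulo the
given equations, to one which is linear in a variable. Such a form is zero, because the local
expansion of the curve equation at `A` has terms of degrees one and three, so that `x - p` and
`y - q` satisfy no relation with terms of two consecutive degrees only (`noShortRelation_class`).
The factors introduced by the pseudo-division are removed by a base locus computation, which uses
that the curve is nonsingular at `P` (`Form22.vanishingIdealEq`, `Cube.vanishingIdealEq`).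

The discriminants of the four families are polynomial identities.
-/

/-! ### The coordinate ring of an elliptic curve is a Dedekind domain -/

namespace GenusOne

open Polynomial nonZeroDivisors
open scoped Polynomial.Bivariate

/-- A Noetherian domain in which each maximal ideal divides a nonzero principal ideal is Dedekind:
if `M` contains `I`, then `M⁻¹ I` is an ideal strictly larger than `I`, and Noetherian induction
applies. -/
theorem isDedekindDomain_of_maximal_invertible {A : Type*} [CommRing A] [IsDomain A]
    [IsNoetherianRing A]
    (h : ∀ M : Ideal A, M.IsMaximal → M ≠ ⊥ →
      ∃ (M' : Ideal A) (b : A), b ≠ 0 ∧ M * M' = Ideal.span {b}) :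
    IsDedekindDomain A := by
  have key : ∀ I : Ideal A, I ≠ ⊥ → ∃ (J : Ideal A) (b : A), b ≠ 0 ∧ I * J = Ideal.span {b} := by
    intro I
    induction I using IsNoetherian.induction with
    | hgt I ih =>
      intro hI
      by_cases hIt : I = ⊤
      · exact ⟨⊤, 1, one_ne_zero, by simp [hIt]⟩
      obtain ⟨M, hM, hIM⟩ := Ideal.exists_le_maximal I hIt
      have hMb : M ≠ ⊥ := fun hb => hI (le_bot_iff.mp (hb ▸ hIM))
      obtain ⟨M', b, hb, hMM⟩ := h M hM hMb
      have hle : I * M' ≤ Ideal.span {b} := hMM ▸ Ideal.mul_mono_left hIM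
      -- The ideal `I'` is `M⁻¹ I`.
      obtain ⟨I', hI'⟩ : ∃ I', I * M' = Ideal.span {b} * I' := by
        refine ⟨(I * M').comap (LinearMap.mulLeft A b), le_antisymm (fun x hx => ?_) ?_⟩
        · obtain ⟨y, rfl⟩ := Ideal.mem_span_singleton.mp (hle hx)
          exact Ideal.mul_mem_mul (Ideal.mem_span_singleton_self b) (by simpa using hx)
        · rw [Ideal.span_singleton_mul_le_iff]
          intro z hz
          simpa using hz
      have hMI : I = M * I' := by
        apply Ideal.span_singleton_mul_right_injective hb
        change Ideal.span {b} * I = Ideal.span {b} * (M * I')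
        rw [mul_left_comm, ← hI', ← hMM]
        ring
      -- `I = M I` would contradict Nakayama's lemma.
      have hlt : I < I' := by
        refine lt_of_le_of_ne (hMI.le.trans Ideal.mul_le_right) fun hEq => hI ?_
        rw [← hEq] at hMI
        obtain ⟨r, hr, hr0⟩ := Submodule.exists_sub_one_mem_and_smul_eq_zero_of_fg_of_le_smul M I
          (IsNoetherian.noetherian I) hMI.le
        have hr1 : r ≠ 0 := by
          rintro rfl
          exact hM.ne_top ((Ideal.eq_top_iff_one _).mpr (by simpa using M.neg_mem hr))
        exact (Submodule.eq_bot_iff _).mpr fun x hx =>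
          (mul_eq_zero.mp (hr0 x hx)).resolve_left hr1
      obtain ⟨J, a, ha, hJ⟩ := ih I' hlt (fun hb' => hI (by rw [hMI, hb', Ideal.mul_bot]))
      refine ⟨M' * J, b * a, mul_ne_zero hb ha, ?_⟩
      rw [hMI, ← Ideal.span_singleton_mul_span_singleton, ← hMM, ← hJ]
      ring
  rw [isDedekindDomain_iff_mul_inv_cancel (K := FractionRing A)]
  intro I hI
  rw [FractionalIdeal.mul_inv_cancel_iff]
  obtain ⟨a, J, ha, rfl⟩ := FractionalIdeal.exists_eq_spanSingleton_mul I
  have hJ : J ≠ ⊥ := fun h0 => hI (by simp [h0])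
  obtain ⟨J', b, hb, hJJ⟩ := key J hJ
  have ha' : algebraMap A (FractionRing A) a ≠ 0 := by simpa using ha
  have hb' : algebraMap A (FractionRing A) b ≠ 0 := by simpa using hb
  refine ⟨FractionalIdeal.spanSingleton A⁰ (algebraMap A (FractionRing A) a *
    (algebraMap A (FractionRing A) b)⁻¹) * J', ?_⟩
  rw [mul_mul_mul_comm, ← FractionalIdeal.coeIdeal_mul, hJJ,
    FractionalIdeal.coeIdeal_span_singleton, FractionalIdeal.spanSingleton_mul_spanSingleton,
    FractionalIdeal.spanSingleton_mul_spanSingleton, ← FractionalIdeal.spanSingleton_one]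
  congr 1
  field_simp

/-- An integral fraction `g / h` of `A` becomes an element of any integrally closed extension of
`A`. -/
theorem map_dvd_map_of_isIntegral {A B K L : Type*} [CommRing A] [IsDomain A] [CommRing B]
    [IsDomain B] [IsIntegrallyClosed B] [Field K] [Algebra A K] [IsFractionRing A K]
    [Field L] [Algebra B L] [IsFractionRing B L] {ρ : A →+* B} (hρ : Function.Injective ρ)
    {g h : A} (hh : h ≠ 0) (hz : IsIntegral A (algebraMap A K g / algebraMap A K h)) :
    ρ h ∣ ρ g := by
  have hinj : Function.Injective ((algebraMap B L).comp ρ) := (IsFractionRing.injective B L).comp hρ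
  set φ : K →+* L := IsFractionRing.lift hinj
  have hφa : ∀ a, φ (algebraMap A K a) = algebraMap B L (ρ a) :=
    fun a => IsFractionRing.lift_algebraMap _ _
  have hz' : IsIntegral B (φ (algebraMap A K g / algebraMap A K h)) := by
    obtain ⟨P, hP, hP0⟩ := hz
    refine ⟨P.map ρ, hP.map _, ?_⟩
    rw [eval₂_map, ← map_zero φ, ← hP0, hom_eval₂]
    congr 1
    exact RingHom.ext fun a => (hφa a).symm
  obtain ⟨r, hr⟩ := (isIntegrallyClosed_iff (R := B) L).mp inferInstance hz'
  refine ⟨r, IsFractionRing.injective B L ?_⟩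
  have h0 : algebraMap B L (ρ h) ≠ 0 :=
    (map_ne_zero_iff _ (IsFractionRing.injective B L)).mpr ((map_ne_zero_iff _ hρ).mpr hh)
  rw [map_mul, hr, map_div₀, hφa, hφa, mul_div_cancel₀ _ h0]

section CoordinateRing

open WeierstrassCurve WeierstrassCurve.Affine

variable {F : Type*} [Field F] (W : WeierstrassCurve F)

instance : Module.Finite F[X] W.toAffine.CoordinateRing :=
  Module.Finite.of_basis (CoordinateRing.basis W.toAffine)

instance : IsNoetherianRing W.toAffine.CoordinateRing :=
  IsNoetherianRing.of_finite F[X] _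

instance : Ring.DimensionLEOne W.toAffine.CoordinateRing :=
  Ring.DimensionLEOne.of_isIntegral F[X] _

theorem coordinateRing_maximal_ne_bot (M : Ideal W.toAffine.CoordinateRing) [hM : M.IsMaximal] :
    M ≠ ⊥ := by
  rintro rfl
  have h1 := Ring.isField_iff_maximal_bot (R := W.toAffine.CoordinateRing) |>.mpr hM
  have h2 : Function.Injective (algebraMap F[X] W.toAffine.CoordinateRing) :=
    FaithfulSMul.algebraMap_injective _ _
  exact Polynomial.not_isField F (isField_of_isIntegral_of_isField h2 h1)

variable {W}

theorem finite_quotient {I : Ideal W.toAffine.CoordinateRing} (hI : I ≠ ⊥) :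
    Module.Finite F (W.toAffine.CoordinateRing ⧸ I) :=
  Module.Finite.equiv (Ideal.quotientEquivDirectSum F (CoordinateRing.basis W.toAffine) hI).symm

/-- Modulo an ideal containing `X - x` and `Y - y`, a function is congruent to its value at
`(x, y)`. -/
theorem quotient_mk_eq_evalEval {J : Ideal W.toAffine.CoordinateRing} {x y : F}
    (hx : CoordinateRing.XClass W.toAffine x ∈ J) (hy : CoordinateRing.YClass W.toAffine (C y) ∈ J)
    (p : F[X][Y]) :
    Ideal.Quotient.mk J (CoordinateRing.mk W.toAffine p) =
      algebraMap F (W.toAffine.CoordinateRing ⧸ J) (p.evalEval x y) := by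
  have h : (Ideal.Quotient.mk J).comp (CoordinateRing.mk W.toAffine) =
      (algebraMap F (W.toAffine.CoordinateRing ⧸ J)).comp (evalEvalRingHom x y) := by
    refine Polynomial.ringHom_ext' (Polynomial.ringHom_ext' ?_ ?_) ?_
    · ext a; simp; rfl
    · have := (Ideal.Quotient.mk_eq_mk_iff_sub_mem (I := J) (CoordinateRing.mk W.toAffine (C X))
        (CoordinateRing.mk W.toAffine (C (C x)))).mpr (by rw [← map_sub, ← map_sub]; exact hx)
      exact this.trans (by simp; rfl)
    · have := (Ideal.Quotient.mk_eq_mk_iff_sub_mem (I := J) (CoordinateRing.mk W.toAffine X)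
        (CoordinateRing.mk W.toAffine (C (C y)))).mpr (by rw [← map_sub]; exact hy)
      exact this.trans (by simp; rfl)
  exact RingHom.congr_fun h p

theorem mem_XYIdeal_iff {x y : F} (h : W.toAffine.Equation x y) (p : F[X][Y]) :
    CoordinateRing.mk W.toAffine p ∈ CoordinateRing.XYIdeal W.toAffine x (C y) ↔
      p.evalEval x y = 0 := by
  have e := CoordinateRing.quotientXYIdealEquiv (W' := W.toAffine) (x := x) (y := C y) h
  have : Nontrivial (W.toAffine.CoordinateRing ⧸ CoordinateRing.XYIdeal W.toAffine x (C y)) :=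
    e.toEquiv.nontrivial
  rw [← Ideal.Quotient.eq_zero_iff_mem, quotient_mk_eq_evalEval
    (J := CoordinateRing.XYIdeal W.toAffine x (C y)) (x := x) (y := y)
    (Ideal.subset_span (by simp)) (Ideal.subset_span (by simp))]
  exact map_eq_zero_iff _ (algebraMap F _).injective

theorem XYIdeal_isMaximal {x y : F} (h : W.toAffine.Equation x y) :
    (CoordinateRing.XYIdeal W.toAffine x (C y)).IsMaximal := by
  have e := CoordinateRing.quotientXYIdealEquiv (W' := W.toAffine) (x := x) (y := C y) h
  exact Ideal.Quotient.maximal_of_isField _ (e.toMulEquiv.isField (Field.toIsField F))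

theorem finrank_quotient_XYIdeal {x y : F} (h : W.toAffine.Equation x y) :
    Module.finrank F (W.toAffine.CoordinateRing ⧸ CoordinateRing.XYIdeal W.toAffine x (C y)) =
      1 := by
  rw [(CoordinateRing.quotientXYIdealEquiv (W' := W.toAffine) (x := x) (y := C y)
    h).toLinearEquiv.finrank_eq, Module.finrank_self]

/-- An ideal with residue ring `F` is the ideal of an `F`-rational point. -/
theorem eq_XYIdeal_of_surjective {J : Ideal W.toAffine.CoordinateRing} (hJ : J ≠ ⊤)
    (h : Function.Surjective (algebraMap F (W.toAffine.CoordinateRing ⧸ J))) :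
    ∃ x y, W.toAffine.Equation x y ∧ J = CoordinateRing.XYIdeal W.toAffine x (C y) := by
  obtain ⟨x, hx⟩ := h (Ideal.Quotient.mk J (CoordinateRing.mk W.toAffine (C X)))
  obtain ⟨y, hy⟩ := h (Ideal.Quotient.mk J (CoordinateRing.mk W.toAffine X))
  have : Nontrivial (W.toAffine.CoordinateRing ⧸ J) := Ideal.Quotient.nontrivial_iff.mpr hJ
  have hxJ : CoordinateRing.XClass W.toAffine x ∈ J := by
    rw [CoordinateRing.XClass, C_sub, map_sub]
    exact (Ideal.Quotient.mk_eq_mk_iff_sub_mem _ _).mp hx.symm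
  have hyJ : CoordinateRing.YClass W.toAffine (C y) ∈ J := by
    rw [CoordinateRing.YClass, map_sub]
    exact (Ideal.Quotient.mk_eq_mk_iff_sub_mem _ _).mp hy.symm
  have hE : W.toAffine.Equation x y := by
    have h1 := quotient_mk_eq_evalEval hxJ hyJ W.toAffine.polynomial
    rw [AdjoinRoot.mk_self, map_zero, eq_comm] at h1
    exact (map_eq_zero_iff _ (algebraMap F _).injective).mp h1
  refine ⟨x, y, hE, ((XYIdeal_isMaximal hE).eq_of_le hJ ?_).symm⟩
  rw [CoordinateRing.XYIdeal, Ideal.span_le]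
  rintro _ (rfl | rfl)
  exacts [hxJ, hyJ]

theorem eq_XYIdeal_of_finrank_eq_one {J : Ideal W.toAffine.CoordinateRing}
    (h : Module.finrank F (W.toAffine.CoordinateRing ⧸ J) = 1) :
    ∃ x y, W.toAffine.Equation x y ∧ J = CoordinateRing.XYIdeal W.toAffine x (C y) := by
  have : Nontrivial (W.toAffine.CoordinateRing ⧸ J) := Module.nontrivial_of_finrank_pos (R := F)
    (by omega)
  refine eq_XYIdeal_of_surjective (Ideal.Quotient.nontrivial_iff.mp this) fun z => ?_
  obtain ⟨c, hc⟩ := (finrank_eq_one_iff_of_nonzero' (1 : W.toAffine.CoordinateRing ⧸ J)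
    one_ne_zero).mp h z
  exact ⟨c, by rw [← hc, Algebra.smul_def, mul_one]⟩

theorem exists_eq_XYIdeal_of_isAlgClosed [IsAlgClosed F] (M : Ideal W.toAffine.CoordinateRing)
    [hM : M.IsMaximal] :
    ∃ x y, W.toAffine.Equation x y ∧ M = CoordinateRing.XYIdeal W.toAffine x (C y) := by
  have := finite_quotient (coordinateRing_maximal_ne_bot W M)
  let := Ideal.Quotient.field M
  exact eq_XYIdeal_of_surjective hM.ne_top
    IsAlgClosed.algebraMap_bijective_of_isIntegral.surjective

/-- Over an algebraically closed field each maximal ideal belongs to a point, and its product with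
the ideal of the opposite point is generated by `X - x`. -/
theorem isDedekindDomain_of_isAlgClosed [IsAlgClosed F] [W.IsElliptic] :
    IsDedekindDomain W.toAffine.CoordinateRing := by
  refine isDedekindDomain_of_maximal_invertible fun M hM _ => ?_
  obtain ⟨x, y, h, rfl⟩ := exists_eq_XYIdeal_of_isAlgClosed M
  refine ⟨CoordinateRing.XYIdeal W.toAffine x (C (W.toAffine.negY x y)), _,
    CoordinateRing.XClass_ne_zero x, ?_⟩
  rw [mul_comm]
  exact CoordinateRing.XYIdeal_neg_mul ((equation_iff_nonsingular).mp h)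

/-- Every nonzero function divides a nonzero polynomial in `x`. -/
theorem exists_mul_eq_algebraMap {h : W.toAffine.CoordinateRing} (hh : h ≠ 0) :
    ∃ (h' : W.toAffine.CoordinateRing) (c : F[X]), c ≠ 0 ∧
      algebraMap F[X] W.toAffine.CoordinateRing c = h * h' := by
  obtain ⟨c, hc, h', e⟩ :=
    (Algebra.IsIntegral.isIntegral (R := F[X]) h).isAlgebraic.exists_nonzero_dvd
      (mem_nonZeroDivisors_of_ne_zero hh)
  exact ⟨h', c, hc, e⟩

/-- Integral closedness descends from a field extension. An integral element of the function field
can be written with a denominator `c` in `F[X]`. Over the extension it is regular, so that `c`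
divides both coordinates of its numerator with respect to the basis `1, Y`, and this divisibility
descends. -/
theorem isDedekindDomain_of_map {F' : Type*} [Field F'] (f : F →+* F')
    [hD : IsDedekindDomain (W.map f).toAffine.CoordinateRing] :
    IsDedekindDomain W.toAffine.CoordinateRing := by
  suffices h : IsIntegrallyClosed W.toAffine.CoordinateRing from
    { (inferInstance : IsNoetherianRing W.toAffine.CoordinateRing),
      (inferInstance : Ring.DimensionLEOne W.toAffine.CoordinateRing), h with }
  rw [isIntegrallyClosed_iff W.toAffine.FunctionField]
  intro z hz
  obtain ⟨g, h, hh, rfl⟩ := IsFractionRing.div_surjective (A := W.toAffine.CoordinateRing) z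
  have hh0 : h ≠ 0 := nonZeroDivisors.ne_zero hh
  have h0 : algebraMap W.toAffine.CoordinateRing W.toAffine.FunctionField h ≠ 0 :=
    IsFractionRing.to_map_ne_zero_of_mem_nonZeroDivisors hh
  obtain ⟨h', c, hc, hhc⟩ := exists_mul_eq_algebraMap hh0
  have hc' : algebraMap F[X] W.toAffine.CoordinateRing c ≠ 0 :=
    (map_ne_zero_iff _ (FaithfulSMul.algebraMap_injective _ _)).mpr hc
  have hh' : h' ≠ 0 := fun h0 => hc' (by rw [hhc, h0, mul_zero])
  obtain ⟨r, hr⟩ := map_dvd_map_of_isIntegral (L := (W.map f).toAffine.FunctionField)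
    (CoordinateRing.map_injective (W' := W.toAffine) f.injective) hh0 hz
  obtain ⟨p, q, hpq⟩ := CoordinateRing.exists_smul_basis_eq (g * h')
  obtain ⟨u, v, huv⟩ := CoordinateRing.exists_smul_basis_eq r
  -- Compare coordinates with respect to the basis `1, Y` over the extension.
  have h1 : c.map f • (u • 1 + v • CoordinateRing.mk (W.map f).toAffine Y) =
      p.map f • 1 + q.map f • CoordinateRing.mk (W.map f).toAffine Y := by
    have h2 : CoordinateRing.map W.toAffine f (c • 1) * r =
        CoordinateRing.map W.toAffine f (g * h') := by
      rw [← Algebra.algebraMap_eq_smul_one, hhc, map_mul, map_mul, hr]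
      ring
    rw [CoordinateRing.map_smul, map_one, smul_mul_assoc, one_mul] at h2
    rw [huv]
    refine h2.trans ?_
    rw [← hpq, map_add, CoordinateRing.map_smul, CoordinateRing.map_smul, map_one,
      CoordinateRing.map_mk, map_X]
  rw [smul_add, ← mul_smul, ← mul_smul, ← sub_eq_zero,
    add_sub_add_comm, ← sub_smul, ← sub_smul] at h1
  obtain ⟨h4, h5⟩ := CoordinateRing.smul_basis_eq_zero h1
  obtain ⟨p', rfl⟩ : c ∣ p := (map_dvd_map' f).mp ⟨u, (sub_eq_zero.mp h4).symm⟩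
  obtain ⟨q', rfl⟩ : c ∣ q := (map_dvd_map' f).mp ⟨v, (sub_eq_zero.mp h5).symm⟩
  refine ⟨p' • 1 + q' • CoordinateRing.mk W.toAffine Y, ?_⟩
  rw [eq_div_iff h0, ← map_mul]
  congr 1
  apply mul_right_cancel₀ hh'
  rw [mul_assoc, ← hhc, ← hpq, mul_smul, mul_smul, ← smul_add, mul_comm, Algebra.smul_def c]

instance [W.IsElliptic] : IsDedekindDomain W.toAffine.CoordinateRing := by
  have : IsDedekindDomain (geom W).toAffine.CoordinateRing := isDedekindDomain_of_isAlgClosed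
  exact isDedekindDomain_of_map (algebraMap F (AlgebraicClosure F))

end CoordinateRing
end GenusOne

/-! ### Orders of ideals and dimensions of quotients -/

namespace GenusOne

open Polynomial nonZeroDivisors
open scoped Polynomial.Bivariate

section DedekindOrders

open UniqueFactorizationMonoid

variable {A : Type*} [CommRing A] [IsDedekindDomain A]

open Classical in
/-- The exponent of the prime `M` in the factorization of the ideal `I`. -/
noncomputable def ordIdeal (M I : Ideal A) : ℕ := (normalizedFactors I).count M

theorem ordIdeal_mul {I J : Ideal A} (hI : I ≠ ⊥) (hJ : J ≠ ⊥) (M : Ideal A) :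
    ordIdeal M (I * J) = ordIdeal M I + ordIdeal M J := by
  rw [ordIdeal, normalizedFactors_mul hI hJ, Multiset.count_add]; rfl

theorem ordIdeal_top (M : Ideal A) : ordIdeal M ⊤ = 0 := by
  rw [ordIdeal, ← Ideal.one_eq_top, normalizedFactors_one, Multiset.count_zero]

theorem ordIdeal_self {M : Ideal A} (hM : Prime M) : ordIdeal M M = 1 := by
  rw [ordIdeal, normalizedFactors_irreducible hM.irreducible, normalize_eq]
  simp

theorem ordIdeal_of_ne {M N : Ideal A} (hN : Prime N) (h : M ≠ N) : ordIdeal M N = 0 := by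
  rw [ordIdeal, normalizedFactors_irreducible hN.irreducible, normalize_eq]
  simp [h]

theorem le_pow_iff_le_ordIdeal {M I : Ideal A} (hM : Prime M) (hI : I ≠ ⊥) (k : ℕ) :
    I ≤ M ^ k ↔ k ≤ ordIdeal M I := by
  rw [← Ideal.dvd_iff_le, dvd_iff_normalizedFactors_le_normalizedFactors (pow_ne_zero _ hM.ne_zero)
    hI, normalizedFactors_pow, normalizedFactors_irreducible hM.irreducible, normalize_eq,
    Multiset.nsmul_singleton, ordIdeal, Multiset.le_count_iff_replicate_le]

theorem sSup_le_pow_eq_ordIdeal {M I : Ideal A} (hM : Prime M) (hI : I ≠ ⊥) :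
    sSup {k : ℕ | I ≤ M ^ k} = ordIdeal M I := by
  simp_rw [le_pow_iff_le_ordIdeal hM hI]
  exact csSup_Iic

theorem le_iff_ordIdeal_le {I J : Ideal A} (hI : I ≠ ⊥) (hJ : J ≠ ⊥) :
    I ≤ J ↔ ∀ M : Ideal A, M.IsMaximal → ordIdeal M J ≤ ordIdeal M I := by
  rw [← Ideal.dvd_iff_le, dvd_iff_normalizedFactors_le_normalizedFactors hJ hI,
    Multiset.le_iff_count]
  refine ⟨fun h M _ => h M, fun h M => ?_⟩
  by_cases hM : M ∈ normalizedFactors J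
  · exact h M ((Ideal.isPrime_of_prime (prime_of_normalized_factor _ hM)).isMaximal
      (prime_of_normalized_factor _ hM).ne_zero)
  · rw [Multiset.count_eq_zero_of_notMem hM]
    exact Nat.zero_le _

end DedekindOrders

section Dimensions

variable (k : Type*) {A : Type*} [Field k] [CommRing A] [IsDedekindDomain A] [Algebra k A]

/-- Choose `a` in `I` but not in `I M`. Multiplication by `a` gives an exact sequence
`0 → A / M → A / I M → A / I → 0`. -/
theorem finrank_quotient_mul_maximal {I M : Ideal A} (hI : I ≠ ⊥) (hM : M.IsMaximal)
    (hfin : Module.Finite k (A ⧸ (I * M))) :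
    Module.finrank k (A ⧸ (I * M)) = Module.finrank k (A ⧸ I) + Module.finrank k (A ⧸ M) := by
  have hlt : I * M < I := lt_of_le_of_ne Ideal.mul_le_left fun h => hM.ne_top (by
    have : I * M = I * 1 := by rw [h, mul_one]
    simpa using mul_left_cancel₀ hI this)
  obtain ⟨a, haI, haM⟩ := Set.exists_of_ssubset hlt
  let f₀ : A →ₗ[A] A ⧸ (I * M) := (Submodule.mkQ (I * M)).comp (LinearMap.mulLeft A a)
  have hf₀ : ∀ r, f₀ r = 0 ↔ a * r ∈ I * M := fun r => Submodule.Quotient.mk_eq_zero _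
  have hker : LinearMap.ker f₀ = M := by
    refine (hM.eq_of_le ?_ ?_).symm
    · intro h
      apply haM
      have : (1 : A) ∈ LinearMap.ker f₀ := h ▸ Submodule.mem_top
      simpa using (hf₀ 1).mp this
    · intro r hr
      exact (hf₀ r).mpr (Ideal.mul_mem_mul haI hr)
  -- The maps `f` and `g` of the exact sequence.
  let f : (A ⧸ M) →ₗ[A] A ⧸ (I * M) := M.liftQ f₀ hker.ge
  have hf : Function.Injective f := by
    rw [← LinearMap.ker_eq_bot]
    exact Submodule.ker_liftQ_eq_bot _ _ _ hker.le
  let g : (A ⧸ (I * M)) →ₗ[A] A ⧸ I := Submodule.factor hlt.le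
  have hg : Function.Surjective g := Submodule.factor_surjective hlt.le
  have hsup : Ideal.span {a} ⊔ I * M = I := by
    have h1 : I ∣ Ideal.span {a} ⊔ I * M := Ideal.dvd_iff_le.mpr
      (sup_le ((Ideal.span_singleton_le_iff_mem _).mpr haI) hlt.le)
    obtain ⟨N, hN⟩ := h1
    have h2 : M ≤ N := by
      have : I * M ≤ I * N := hN ▸ le_sup_right
      rw [← Ideal.dvd_iff_le] at this ⊢
      exact (mul_dvd_mul_iff_left hI).mp this
    by_cases hNt : N = ⊤
    · rw [hN, hNt, Ideal.mul_top]
    · rw [← hM.eq_of_le hNt h2] at hN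
      exact absurd (hN.le (Submodule.mem_sup_left (Ideal.mem_span_singleton_self a))) haM
  have hrange : LinearMap.range f = LinearMap.ker g := by
    rw [Submodule.range_liftQ, LinearMap.range_comp]
    apply le_antisymm
    · rintro _ ⟨_, ⟨r, rfl⟩, rfl⟩
      exact (Submodule.Quotient.mk_eq_zero I).mpr (I.mul_mem_right r haI)
    · intro q hq
      obtain ⟨b, rfl⟩ := Submodule.mkQ_surjective _ q
      have hb : b ∈ I := (Submodule.Quotient.mk_eq_zero I).mp hq
      rw [← hsup, Submodule.mem_sup] at hb
      obtain ⟨y, hy, z, hz, rfl⟩ := hb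
      obtain ⟨r, rfl⟩ := Ideal.mem_span_singleton'.mp hy
      refine ⟨r * a, ⟨r, mul_comm _ _⟩, ?_⟩
      have hz0 : (I * M).mkQ z = 0 := (Submodule.Quotient.mk_eq_zero (I * M)).mpr hz
      rw [map_add, hz0, add_zero]
  have h1 := LinearMap.finrank_range_add_finrank_ker (g.restrictScalars k)
  rw [LinearMap.range_eq_top.mpr (show Function.Surjective (g.restrictScalars k) from hg),
    finrank_top] at h1
  have h2 := LinearMap.finrank_range_of_inj (f := f.restrictScalars k) hf
  have h3 : LinearMap.range (f.restrictScalars k) = LinearMap.ker (g.restrictScalars k) := by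
    ext x
    exact SetLike.ext_iff.mp hrange x
  rw [← h1, ← h3, h2]

theorem finrank_quotient_mul (hfin : ∀ I : Ideal A, I ≠ ⊥ → Module.Finite k (A ⧸ I))
    {I J : Ideal A} (hI : I ≠ ⊥) (hJ : J ≠ ⊥) :
    Module.finrank k (A ⧸ (I * J)) = Module.finrank k (A ⧸ I) + Module.finrank k (A ⧸ J) := by
  have htop : Module.finrank k (A ⧸ (1 : Ideal A)) = 0 := by
    have : Subsingleton (A ⧸ (1 : Ideal A)) := Ideal.Quotient.subsingleton_iff.mpr Ideal.one_eq_top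
    exact Module.finrank_zero_of_subsingleton
  revert I
  induction J using UniqueFactorizationMonoid.induction_on_prime with
  | h₁ => exact absurd rfl hJ
  | h₂ J hJu =>
    intro I hI
    rw [Ideal.isUnit_iff.mp hJu, ← Ideal.one_eq_top, mul_one, htop, add_zero]
  | h₃ J M hJ0 hM ih =>
    intro I hI
    have hMm := (Ideal.isPrime_of_prime hM).isMaximal hM.ne_zero
    rw [← mul_assoc, ih hJ0 (mul_ne_zero hI hM.ne_zero), mul_comm M J,
      finrank_quotient_mul_maximal k hJ0 hMm (hfin _ (mul_ne_zero hJ0 hM.ne_zero)),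
      finrank_quotient_mul_maximal k hI hMm (hfin _ (mul_ne_zero hI hM.ne_zero))]
    ring

end Dimensions

end GenusOne

/-! ### Norms, Riemann's inequality and the class group -/

namespace GenusOne

open Polynomial nonZeroDivisors
open scoped Polynomial.Bivariate

open WeierstrassCurve WeierstrassCurve.Affine

variable {F : Type*} [Field F] {W : WeierstrassCurve F}

/-- The degree of the norm is the pole order at infinity, where `x` and `y` have poles of orders
`2` and `3`. The polynomial `q` is treated separately since `natDegree 0 = 0`. -/
theorem natDegree_norm_le_iff (p q : F[X]) (m : ℕ) :
    (Algebra.norm F[X] (p • (1 : W.toAffine.CoordinateRing) +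
      q • CoordinateRing.mk W.toAffine Y)).natDegree ≤ m ↔
      2 * p.natDegree ≤ m ∧ (q = 0 ∨ 2 * q.natDegree + 3 ≤ m) := by
  rw [natDegree_le_iff_degree_le, CoordinateRing.degree_norm_smul_basis, max_le_iff]
  refine and_congr ?_ ?_
  · by_cases hp : p = 0
    · simp [hp]
    · rw [degree_eq_natDegree hp, nsmul_eq_mul]
      exact_mod_cast Iff.rfl
  · by_cases hq : q = 0
    · simp [hq]
    · rw [degree_eq_natDegree hq, nsmul_eq_mul]
      simp only [hq, false_or]
      exact_mod_cast Iff.rfl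

theorem finrank_quotient_span {g : W.toAffine.CoordinateRing} (hg : g ≠ 0) :
    Module.finrank F (W.toAffine.CoordinateRing ⧸ Ideal.span {g}) =
      (Algebra.norm F[X] g).natDegree :=
  finrank_quotient_span_eq_natDegree_norm (CoordinateRing.basis W.toAffine) hg

theorem XYIdeal_ne_bot (x y : F) : CoordinateRing.XYIdeal W.toAffine x (C y) ≠ ⊥ := by
  intro h
  exact CoordinateRing.XClass_ne_zero (W' := W.toAffine) x
    ((Submodule.eq_bot_iff _).mp h _ (Ideal.subset_span (by simp)))

/-- The form of Riemann's inequality used here: a nonzero ideal contains a function whose pole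
order at infinity exceeds the colength of the ideal by at most one. -/
theorem exists_mem_natDegree_norm_le {I : Ideal W.toAffine.CoordinateRing} (hI : I ≠ ⊥) :
    ∃ g ∈ I, g ≠ 0 ∧ (Algebra.norm F[X] g).natDegree ≤
      Module.finrank F (W.toAffine.CoordinateRing ⧸ I) + 1 := by
  have := finite_quotient hI
  set d := Module.finrank F (W.toAffine.CoordinateRing ⧸ I)
  -- The functions `p + q y` with `deg p < a` and `deg q < b` have poles of order at most `d + 1`,
  -- and form a space of dimension `a + b = d + 1`.
  let a := (d + 1) / 2 + 1
  let b := d / 2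
  let V := (degreeLT F a) × (degreeLT F b)
  let e : V →ₗ[F] W.toAffine.CoordinateRing :=
    { toFun := fun v => (v.1 : F[X]) • 1 + (v.2 : F[X]) • CoordinateRing.mk W.toAffine Y
      map_add' := fun v w => by
        change ((v.1 : F[X]) + w.1) • 1 + ((v.2 : F[X]) + w.2) • CoordinateRing.mk W.toAffine Y = _
        rw [add_smul, add_smul, add_add_add_comm]
      map_smul' := fun c v => by
        change (c • (v.1 : F[X])) • 1 + (c • (v.2 : F[X])) • CoordinateRing.mk W.toAffine Y = _
        rw [smul_assoc, smul_assoc, ← smul_add, RingHom.id_apply] }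
  let f : V →ₗ[F] W.toAffine.CoordinateRing ⧸ I := ((Submodule.mkQ I).restrictScalars F).comp e
  have hV : Module.finrank F V = a + b := by
    rw [Module.finrank_prod, (degreeLTEquiv F a).finrank_eq, (degreeLTEquiv F b).finrank_eq]
    simp
  have : Module.Finite F (degreeLT F a) := Module.Finite.equiv (degreeLTEquiv F a).symm
  have : Module.Finite F (degreeLT F b) := Module.Finite.equiv (degreeLTEquiv F b).symm
  have hker : LinearMap.ker f ≠ ⊥ := LinearMap.ker_ne_bot_of_finrank_lt (by rw [hV]; omega)
  obtain ⟨v, hv, hv0⟩ := Submodule.exists_mem_ne_zero_of_ne_bot hker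
  obtain ⟨⟨p, hp⟩, ⟨q, hq⟩⟩ := v
  refine ⟨e (⟨p, hp⟩, ⟨q, hq⟩), ?_, ?_, ?_⟩
  · exact (Submodule.Quotient.mk_eq_zero I).mp hv
  · intro h0
    obtain ⟨rfl, rfl⟩ := CoordinateRing.smul_basis_eq_zero h0
    exact hv0 rfl
  · refine (natDegree_norm_le_iff p q _).mpr ⟨?_, ?_⟩
    · rcases eq_or_ne p 0 with rfl | hp0
      · simp
      · have := (natDegree_lt_iff_degree_lt hp0).mpr (mem_degreeLT.mp hp)
        omega
    · rcases eq_or_ne q 0 with rfl | hq0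
      · simp
      · have := (natDegree_lt_iff_degree_lt hq0).mpr (mem_degreeLT.mp hq)
        omega

variable [W.IsElliptic]

/-- The colength of ideals of the coordinate ring is additive. -/
theorem finrank_quotient_mul_coordinateRing {I J : Ideal W.toAffine.CoordinateRing} (hI : I ≠ ⊥)
    (hJ : J ≠ ⊥) :
    Module.finrank F (W.toAffine.CoordinateRing ⧸ (I * J)) =
      Module.finrank F (W.toAffine.CoordinateRing ⧸ I) +
        Module.finrank F (W.toAffine.CoordinateRing ⧸ J) :=
  finrank_quotient_mul F (fun _ h => finite_quotient h) hI hJ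

variable [DecidableEq F]

theorem toClass_some_eq_mk0 {x y : F} (h : W.toAffine.Nonsingular x y) :
    Point.toClass (Point.some x y h) = Additive.ofMul (ClassGroup.mk0
      ⟨CoordinateRing.XYIdeal W.toAffine x (C y),
        mem_nonZeroDivisors_of_ne_zero (XYIdeal_ne_bot x y)⟩) := by
  rw [Point.toClass_some, ← ClassGroup.mk_mk0 W.toAffine.FunctionField]
  exact congrArg (fun u => Additive.ofMul (ClassGroup.mk W.toAffine.FunctionField u))
    (Units.ext rfl)

/-- By Riemann's inequality each ideal class contains an ideal of colength at most one, which is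
the unit ideal or the ideal of a rational point. -/
theorem toClass_surjective : Function.Surjective (Point.toClass (W := W.toAffine)) := by
  intro c
  obtain ⟨⟨I, hI⟩, hIc⟩ := ClassGroup.mk0_surjective (Additive.toMul (-c))
  have hI0 : I ≠ ⊥ := nonZeroDivisors.ne_zero hI
  obtain ⟨g, hgI, hg0, hg⟩ := exists_mem_natDegree_norm_le hI0
  obtain ⟨J, hJ⟩ : I ∣ Ideal.span {g} :=
    Ideal.dvd_iff_le.mpr ((Ideal.span_singleton_le_iff_mem _).mpr hgI)
  have hJ0 : J ≠ ⊥ := by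
    rintro rfl
    rw [Ideal.mul_bot, Ideal.span_singleton_eq_bot] at hJ
    exact hg0 hJ
  rw [← finrank_quotient_span hg0, hJ, finrank_quotient_mul_coordinateRing hI0 hJ0] at hg
  have hcJ : c = Additive.ofMul (ClassGroup.mk0 ⟨J, mem_nonZeroDivisors_of_ne_zero hJ0⟩) := by
    have h1 : ClassGroup.mk0 ⟨I, hI⟩ *
        ClassGroup.mk0 ⟨J, mem_nonZeroDivisors_of_ne_zero hJ0⟩ = 1 := by
      rw [← map_mul]
      exact (ClassGroup.mk0_eq_one_iff _).mpr ⟨g, hJ.symm⟩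
    rw [hIc, toMul_neg, inv_mul_eq_one] at h1
    exact h1
  have := finite_quotient hJ0
  rcases (show Module.finrank F (W.toAffine.CoordinateRing ⧸ J) = 0 ∨
      Module.finrank F (W.toAffine.CoordinateRing ⧸ J) = 1 by omega) with h | h
  · have hJt : J = ⊤ := Ideal.Quotient.subsingleton_iff.mp (Module.finrank_zero_iff.mp h)
    refine ⟨0, ?_⟩
    rw [map_zero, hcJ]
    subst hJt
    exact congrArg Additive.ofMul ((map_one ClassGroup.mk0).symm.trans
      (congrArg ClassGroup.mk0 (Subtype.ext Ideal.one_eq_top)))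
  · obtain ⟨x, y, hE, rfl⟩ := eq_XYIdeal_of_finrank_eq_one h
    exact ⟨Point.some x y (equation_iff_nonsingular.mp hE), by rw [hcJ, toClass_some_eq_mk0]⟩

end GenusOne

/-! ### The class of a divisor and its geometric sum -/

namespace GenusOne

open Polynomial nonZeroDivisors
open scoped Polynomial.Bivariate

open WeierstrassCurve WeierstrassCurve.Affine

section ClassMap

variable {A B : Type*} [CommRing A] [IsDedekindDomain A] [CommRing B] [IsDedekindDomain B]

theorem map_mem_nonZeroDivisors {ρ : A →+* B} (hρ : Function.Injective ρ) (I : (Ideal A)⁰) :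
    (I : Ideal A).map ρ ∈ (Ideal B)⁰ :=
  mem_nonZeroDivisors_of_ne_zero fun h =>
    nonZeroDivisors.coe_ne_zero I ((Ideal.map_eq_bot_iff_of_injective hρ).mp h)

theorem mk0_map_eq {ρ : A →+* B} (hρ : Function.Injective ρ) {I J : (Ideal A)⁰}
    (h : ClassGroup.mk0 I = ClassGroup.mk0 J) :
    ClassGroup.mk0 ⟨_, map_mem_nonZeroDivisors hρ I⟩ =
      ClassGroup.mk0 ⟨_, map_mem_nonZeroDivisors hρ J⟩ := by
  obtain ⟨x, y, hx, hy, hxy⟩ := ClassGroup.mk0_eq_mk0_iff.mp h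
  refine ClassGroup.mk0_eq_mk0_iff.mpr ⟨ρ x, ρ y, (map_ne_zero_iff _ hρ).mpr hx,
    (map_ne_zero_iff _ hρ).mpr hy, ?_⟩
  have := congrArg (Ideal.map ρ) hxy
  simpa only [Ideal.map_mul, Ideal.map_span, Set.image_singleton] using this

/-- The homomorphism of ideal class groups induced by extension of ideals. -/
noncomputable def classMap (ρ : A →+* B) (hρ : Function.Injective ρ) :
    ClassGroup A →* ClassGroup B where
  toFun c := ClassGroup.mk0 ⟨_, map_mem_nonZeroDivisors hρ (ClassGroup.mk0_surjective c).choose⟩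
  map_one' := by
    have h := mk0_map_eq hρ ((ClassGroup.mk0_surjective (1 : ClassGroup A)).choose_spec.trans
      (map_one ClassGroup.mk0).symm)
    rw [h, ← map_one ClassGroup.mk0]
    exact congrArg ClassGroup.mk0 (Subtype.ext (by simp [Ideal.one_eq_top, Ideal.map_top]))
  map_mul' c d := by
    have h := mk0_map_eq hρ (I := (ClassGroup.mk0_surjective (c * d)).choose)
      (J := (ClassGroup.mk0_surjective c).choose * (ClassGroup.mk0_surjective d).choose) <| by
        rw [map_mul, (ClassGroup.mk0_surjective c).choose_spec,
          (ClassGroup.mk0_surjective d).choose_spec,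
          (ClassGroup.mk0_surjective (c * d)).choose_spec]
    exact h.trans ((congrArg ClassGroup.mk0 (Subtype.ext (Ideal.map_mul _ _ _))).trans
      (map_mul ClassGroup.mk0 _ _))

theorem classMap_mk0 (ρ : A →+* B) (hρ : Function.Injective ρ) (I : (Ideal A)⁰) :
    classMap ρ hρ (ClassGroup.mk0 I) = ClassGroup.mk0 ⟨_, map_mem_nonZeroDivisors hρ I⟩ :=
  mk0_map_eq hρ (ClassGroup.mk0_surjective _).choose_spec

end ClassMap

section PointMult

variable {F : Type*} [Field F] {W : WeierstrassCurve F}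

/-- A point is determined by its ideal. -/
theorem XYIdeal_injective {x y x' y' : F} (h : W.toAffine.Equation x y)
    (hE : CoordinateRing.XYIdeal W.toAffine x (C y) = CoordinateRing.XYIdeal W.toAffine x' (C y')) :
    x = x' ∧ y = y' := by
  have h1 : CoordinateRing.XClass W.toAffine x' ∈ CoordinateRing.XYIdeal W.toAffine x (C y) :=
    hE ▸ Ideal.subset_span (by simp)
  have h2 : CoordinateRing.YClass W.toAffine (C y') ∈ CoordinateRing.XYIdeal W.toAffine x (C y) :=
    hE ▸ Ideal.subset_span (by simp)
  rw [CoordinateRing.XClass, mem_XYIdeal_iff h] at h1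
  rw [CoordinateRing.YClass, mem_XYIdeal_iff h] at h2
  simp only [evalEval_C, eval_sub, eval_X, eval_C, evalEval_sub, evalEval_X] at h1 h2
  exact ⟨sub_eq_zero.mp h1, sub_eq_zero.mp h2⟩

variable [W.IsElliptic]

/-- The multiplicity of the point `Q` in the zero scheme of the ideal `I`; it is zero at infinity,
as `I` only sees the affine curve. -/
noncomputable def pointMult (I : Ideal W.toAffine.CoordinateRing) : W.toAffine.Point → ℕ
  | .zero => 0
  | .some x y _ => ordIdeal (CoordinateRing.XYIdeal W.toAffine x (C y)) I

theorem XYIdeal_prime {x y : F} (h : W.toAffine.Equation x y) :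
    Prime (CoordinateRing.XYIdeal W.toAffine x (C y)) :=
  Ideal.prime_of_isPrime (XYIdeal_ne_bot x y) (XYIdeal_isMaximal h).isPrime

theorem pointMult_mul {I J : Ideal W.toAffine.CoordinateRing} (hI : I ≠ ⊥) (hJ : J ≠ ⊥) :
    pointMult (I * J) = pointMult I + pointMult J := by
  ext Q
  cases Q with
  | zero => rfl
  | some x y h => exact ordIdeal_mul hI hJ _

/-- Over an algebraically closed field, the sum of the zeros of an ideal corresponds to the class
of the ideal. -/
theorem toClass_finsum_pointMult [IsAlgClosed F] [DecidableEq F]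
    {I : Ideal W.toAffine.CoordinateRing} (hI : I ≠ ⊥) :
    (Function.support (pointMult I)).Finite ∧
    Point.toClass (∑ᶠ Q : W.toAffine.Point, pointMult I Q • Q) =
      Additive.ofMul (ClassGroup.mk0 ⟨I, mem_nonZeroDivisors_of_ne_zero hI⟩) := by
  induction I using UniqueFactorizationMonoid.induction_on_prime with
  | h₁ => exact absurd rfl hI
  | h₂ I hIu =>
    obtain rfl := Ideal.isUnit_iff.mp hIu
    have h0 : pointMult (⊤ : Ideal W.toAffine.CoordinateRing) = 0 := by
      ext Q
      cases Q with
      | zero => rfl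
      | some x y h => exact ordIdeal_top _
    rw [h0]
    refine ⟨by simp, ?_⟩
    simp only [Pi.zero_apply, zero_smul, finsum_zero, map_zero]
    exact congrArg Additive.ofMul ((map_one ClassGroup.mk0).symm.trans
      (congrArg ClassGroup.mk0 (Subtype.ext Ideal.one_eq_top)))
  | h₃ I P hI0 hP ih =>
    obtain ⟨hfin, hsum⟩ := ih hI0
    have hPm := (Ideal.isPrime_of_prime hP).isMaximal hP.ne_zero
    obtain ⟨x, y, hE, rfl⟩ := exists_eq_XYIdeal_of_isAlgClosed P
    have hns := equation_iff_nonsingular.mp hE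
    have hP1 : pointMult (CoordinateRing.XYIdeal W.toAffine x (C y)) =
        Pi.single (Point.some x y hns) 1 := by
      ext Q
      cases Q with
      | zero => rw [Pi.single_eq_of_ne (by simp)]; rfl
      | some x' y' h =>
        by_cases hQ : x' = x ∧ y' = y
        · obtain ⟨rfl, rfl⟩ := hQ
          rw [Pi.single_eq_same]
          exact ordIdeal_self hP
        · rw [Pi.single_eq_of_ne (by simpa using hQ)]
          exact ordIdeal_of_ne hP fun h' => hQ (XYIdeal_injective h.1 h')
    have hs1 : (Function.support
        (pointMult (CoordinateRing.XYIdeal W.toAffine x (C y)))).Finite := by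
      rw [hP1]
      exact (Set.finite_singleton (Point.some x y hns)).subset Pi.support_single_subset
    rw [pointMult_mul hP.ne_zero hI0]
    refine ⟨(hs1.union hfin).subset (Function.support_add _ _), ?_⟩
    simp only [Pi.add_apply, add_smul]
    rw [finsum_add_distrib
      (f := fun Q => pointMult (CoordinateRing.XYIdeal W.toAffine x (C y)) Q • Q)
      (g := fun Q => pointMult I Q • Q)
      (hs1.subset fun Q hQ h0 => hQ (by simp [h0]))
      (hfin.subset fun Q hQ h0 => hQ (by simp [h0])), map_add, hsum,
      finsum_eq_single _ (Point.some x y hns) (fun Q hQ => by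
        rw [hP1, Pi.single_eq_of_ne hQ, zero_smul]), hP1, Pi.single_eq_same, one_smul,
      toClass_some_eq_mk0, ← ofMul_mul, ← map_mul]
    rfl

end PointMult

section DivisorClass

variable {K : Type*} [Field K] {W : WeierstrassCurve K}

theorem geom_map_injective : Function.Injective
    (CoordinateRing.map W.toAffine (algebraMap K (AlgebraicClosure K))) :=
  CoordinateRing.map_injective (algebraMap K (AlgebraicClosure K)).injective

/-- A rational point viewed as a geometric point. -/
noncomputable def geomPoint : W.toAffine.Point → (geom W).toAffine.Point
  | .zero => .zero
  | .some x y h => .some (algebraMap K (AlgebraicClosure K) x) (algebraMap K (AlgebraicClosure K) y)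
      ((map_nonsingular _ (algebraMap K (AlgebraicClosure K)).injective x y).mpr h)

theorem geomPoint_injective : Function.Injective (geomPoint (W := W)) := by
  rintro (_ | ⟨x, y, h⟩) (_ | ⟨x', y', h'⟩) hE
  · rfl
  · cases hE
  · cases hE
  · rw [geomPoint, geomPoint] at hE
    obtain ⟨h1, h2⟩ := (Point.some.injEq ..).mp hE
    simp [(algebraMap K (AlgebraicClosure K)).injective h1,
      (algebraMap K (AlgebraicClosure K)).injective h2]

variable [W.IsElliptic]

theorem maximalSpectrum_prime (M : MaximalSpectrum W.toAffine.CoordinateRing) : Prime M.asIdeal :=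
  have := M.isMaximal
  Ideal.prime_of_isPrime (coordinateRing_maximal_ne_bot W M.asIdeal) M.isMaximal.isPrime

/-- The ideal class of a closed point; the point at infinity has trivial class. -/
noncomputable def closedPointClass : ClosedPoint W → Additive (ClassGroup W.toAffine.CoordinateRing)
  | none => 0
  | some M => Additive.ofMul (ClassGroup.mk0
      ⟨M.asIdeal, mem_nonZeroDivisors_of_ne_zero (maximalSpectrum_prime M).ne_zero⟩)

/-- The ideal class of the affine part of a divisor. -/
noncomputable def divisorClass (D : Divisor W) : Additive (ClassGroup W.toAffine.CoordinateRing) :=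
  D.sum fun c k => k • closedPointClass c

open Classical in
/-- The class of the geometric sum of a divisor is the base change of the ideal class of the
divisor. -/
theorem toClass_divisorSum (D : Divisor W) :
    Point.toClass (divisorSum W D) =
      (classMap _ (geom_map_injective (W := W))).toAdditive (divisorClass D) := by
  rw [divisorSum, divisorClass, Finsupp.sum, Finsupp.sum, map_sum, map_sum]
  refine Finset.sum_congr rfl fun c _ => ?_
  rw [map_zsmul, map_zsmul]
  congr 1
  cases c with
  | none =>
    have h0 : ∀ Q : (geom W).toAffine.Point, geomMult W none Q • Q = 0 := by
      rintro (_ | _)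
      · exact one_smul ℕ (0 : (geom W).toAffine.Point)
      · exact zero_smul ℕ (_ : (geom W).toAffine.Point)
    simp only [h0, finsum_zero, map_zero, closedPointClass]
  | some M =>
    have hM0 := (Ideal.map_eq_bot_iff_of_injective (geom_map_injective (W := W))).not.mpr
      (maximalSpectrum_prime M).ne_zero
    have hmult : geomMult W (some M) = pointMult (M.asIdeal.map
        (CoordinateRing.map W.toAffine (algebraMap K (AlgebraicClosure K)))) := by
      ext Q
      cases Q with
      | zero => rfl
      | some x y h => exact sSup_le_pow_eq_ordIdeal (XYIdeal_prime h.1) hM0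
    rw [hmult, (toClass_finsum_pointMult hM0).2, closedPointClass,
      MonoidHom.toAdditive_apply_apply, toMul_ofMul, classMap_mk0]

open Classical in
theorem toClass_geomPoint (T : W.toAffine.Point) :
    Point.toClass (geomPoint T) =
      (classMap _ (geom_map_injective (W := W))).toAdditive (Point.toClass T) := by
  cases T with
  | zero =>
    have h0 : Point.toClass (.zero : W.toAffine.Point) = 0 := Point.toClass_zero
    rw [h0, map_zero]
    exact Point.toClass_zero (W := (geom W).toAffine)
  | some x y h =>
    rw [geomPoint, toClass_some_eq_mk0, toClass_some_eq_mk0]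
    rw [MonoidHom.toAdditive_apply_apply, toMul_ofMul, classMap_mk0]
    refine congrArg Additive.ofMul (congrArg ClassGroup.mk0 (Subtype.ext ?_))
    simp only [CoordinateRing.XYIdeal, Ideal.map_span, Set.image_pair, CoordinateRing.XClass,
      CoordinateRing.YClass, CoordinateRing.map_mk]
    simp

open Classical in
/-- If a divisor sums to the geometric point defined by `T`, its class is that of `T`. The class
of the divisor is the class of some rational point `T'`, and `T'` and `T` agree as geometric
points. -/
theorem divisorClass_eq_toClass {D : Divisor W} {T : W.toAffine.Point}
    (h : divisorSum W D = geomPoint T) : divisorClass D = Point.toClass T := by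
  obtain ⟨T', hT'⟩ := toClass_surjective (divisorClass D)
  have h1 := toClass_divisorSum D
  rw [← hT', ← toClass_geomPoint] at h1
  rw [← hT', geomPoint_injective ((Point.toClass_injective h1).symm.trans h)]

end DivisorClass

end GenusOne

/-! ### Riemann-Roch spaces in terms of ideals -/

namespace GenusOne

open Polynomial nonZeroDivisors
open scoped Polynomial.Bivariate

open WeierstrassCurve WeierstrassCurve.Affine

variable {K : Type*} [Field K] {W : WeierstrassCurve K}

theorem finrank_quotient_top :
    Module.finrank K (W.toAffine.CoordinateRing ⧸ (⊤ : Ideal W.toAffine.CoordinateRing)) = 0 :=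
  have : Subsingleton (W.toAffine.CoordinateRing ⧸ (⊤ : Ideal W.toAffine.CoordinateRing)) :=
    Ideal.Quotient.subsingleton_iff.mpr rfl
  Module.finrank_zero_of_subsingleton

variable [W.IsElliptic]

/-- The product of powers of the maximal ideals in a finite set. -/
noncomputable def primeProd (S : Finset (MaximalSpectrum W.toAffine.CoordinateRing))
    (e : MaximalSpectrum W.toAffine.CoordinateRing → ℕ) : Ideal W.toAffine.CoordinateRing :=
  ∏ M ∈ S, M.asIdeal ^ e M

theorem primeProd_ne_bot (S : Finset (MaximalSpectrum W.toAffine.CoordinateRing))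
    (e : MaximalSpectrum W.toAffine.CoordinateRing → ℕ) : primeProd S e ≠ ⊥ :=
  Finset.prod_ne_zero_iff.mpr fun M _ => pow_ne_zero _ (maximalSpectrum_prime M).ne_zero

/-- Evaluation of an additive invariant of ideals, such as the colength or the class, on a product
of prime powers. -/
theorem map_primeProd {G : Type*} [AddCommMonoid G] (Φ : Ideal W.toAffine.CoordinateRing → G)
    (h1 : Φ ⊤ = 0) (hmul : ∀ I J, I ≠ ⊥ → J ≠ ⊥ → Φ (I * J) = Φ I + Φ J)
    (S : Finset (MaximalSpectrum W.toAffine.CoordinateRing))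
    (e : MaximalSpectrum W.toAffine.CoordinateRing → ℕ) :
    Φ (primeProd S e) = ∑ M ∈ S, e M • Φ M.asIdeal := by
  classical
  have hpow : ∀ (M : MaximalSpectrum W.toAffine.CoordinateRing) (k : ℕ),
      Φ (M.asIdeal ^ k) = k • Φ M.asIdeal := by
    intro M k
    induction k with
    | zero => rw [pow_zero, Ideal.one_eq_top, h1, zero_smul]
    | succ k ih =>
      rw [pow_succ, hmul _ _ (pow_ne_zero _ (maximalSpectrum_prime M).ne_zero)
        (maximalSpectrum_prime M).ne_zero, ih, succ_nsmul]
  induction S using Finset.induction_on with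
  | empty => rw [primeProd, Finset.prod_empty, Finset.sum_empty, Ideal.one_eq_top, h1]
  | insert M S hM ih =>
    rw [primeProd, Finset.prod_insert hM, Finset.sum_insert hM,
      hmul _ _ (pow_ne_zero _ (maximalSpectrum_prime M).ne_zero)
        (show (∏ x ∈ S, x.asIdeal ^ e x) ≠ ⊥ from primeProd_ne_bot S e), hpow]
    exact congrArg _ ih

theorem ordIdeal_primeProd (S : Finset (MaximalSpectrum W.toAffine.CoordinateRing))
    (e : MaximalSpectrum W.toAffine.CoordinateRing → ℕ)
    (M : MaximalSpectrum W.toAffine.CoordinateRing) (hM : M ∉ S → e M = 0) :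
    ordIdeal M.asIdeal (primeProd S e) = e M := by
  classical
  rw [map_primeProd _ (ordIdeal_top _) (fun I J hI hJ => ordIdeal_mul hI hJ _),
    Finset.sum_eq_single M]
  · rw [ordIdeal_self (maximalSpectrum_prime M), smul_eq_mul, mul_one]
  · intro N _ hN
    rw [ordIdeal_of_ne (maximalSpectrum_prime N) (fun h => hN (MaximalSpectrum.ext h).symm),
      smul_zero]
  · intro h
    rw [hM h, zero_smul]

theorem finrank_quotient_primeProd (S : Finset (MaximalSpectrum W.toAffine.CoordinateRing))
    (e : MaximalSpectrum W.toAffine.CoordinateRing → ℕ) :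
    Module.finrank K (W.toAffine.CoordinateRing ⧸ primeProd S e) =
      ∑ M ∈ S, e M * pointDegree W (some M) := by
  rw [map_primeProd (fun I => Module.finrank K (W.toAffine.CoordinateRing ⧸ I))
    finrank_quotient_top (fun I J hI hJ => finrank_quotient_mul_coordinateRing hI hJ)]
  rfl

/-- The ideal class of a nonzero ideal, in additive notation. -/
noncomputable def idealClass {I : Ideal W.toAffine.CoordinateRing} (hI : I ≠ ⊥) :
    Additive (ClassGroup W.toAffine.CoordinateRing) :=
  Additive.ofMul (ClassGroup.mk0 ⟨I, mem_nonZeroDivisors_of_ne_zero hI⟩)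

theorem idealClass_mul {I J : Ideal W.toAffine.CoordinateRing} (hI : I ≠ ⊥) (hJ : J ≠ ⊥) :
    idealClass (mul_ne_zero hI hJ) = idealClass hI + idealClass hJ := by
  rw [idealClass, idealClass, idealClass, ← ofMul_mul, ← map_mul]
  rfl

theorem idealClass_top : idealClass (W := W) top_ne_bot = 0 :=
  congrArg Additive.ofMul ((congrArg ClassGroup.mk0 (Subtype.ext Ideal.one_eq_top.symm)).trans
      (map_one ClassGroup.mk0))

theorem idealClass_primeProd (S : Finset (MaximalSpectrum W.toAffine.CoordinateRing))
    (e : MaximalSpectrum W.toAffine.CoordinateRing → ℕ) :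
    idealClass (primeProd_ne_bot S e) = ∑ M ∈ S, e M • closedPointClass (some M) := by
  classical
  have h := map_primeProd (fun I => if hI : I ≠ ⊥ then idealClass hI else 0)
    (by rw [dif_pos top_ne_bot, idealClass_top])
    (fun I J hI hJ => by
      rw [dif_pos hI, dif_pos hJ, dif_pos (show I * J ≠ ⊥ from mul_ne_zero hI hJ),
        idealClass_mul hI hJ]) S e
  rw [dif_pos (primeProd_ne_bot S e)] at h
  rw [h]
  refine Finset.sum_congr rfl fun M _ => ?_
  rw [dif_pos (show M.asIdeal ≠ ⊥ from (maximalSpectrum_prime M).ne_zero)]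
  rfl

theorem orderAt_some {g : W.toAffine.CoordinateRing} (hg : g ≠ 0)
    (M : MaximalSpectrum W.toAffine.CoordinateRing) :
    orderAt W g (some M) = ordIdeal M.asIdeal (Ideal.span {g}) := by
  rw [orderAt, ← sSup_le_pow_eq_ordIdeal (maximalSpectrum_prime M)
    (Ideal.span_singleton_eq_bot.not.mpr hg)]
  simp_rw [Ideal.span_singleton_le_iff_mem]

/-- The Riemann-Roch space of a divisor `D` of degree `n`: if `J` is an ideal whose class is
inverse to the class of `D`, then up to a common factor `L(D)` consists of the elements of `J`
whose pole at infinity has order at most `n` plus the colength of `J`. -/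
theorem exists_riemannRochSpace_eq {D : Divisor W} {n : ℕ} (hn : degree W D = n)
    {J : Ideal W.toAffine.CoordinateRing} (hJ : J ≠ ⊥) (hJD : idealClass hJ = -divisorClass D) :
    ∃ w : W.toAffine.FunctionField, w ≠ 0 ∧ riemannRochSpace W D =
      {f | ∃ g ∈ J, f = w * algebraMap _ _ g ∧ (g = 0 ∨ (Algebra.norm K[X] g).natDegree ≤
        n + Module.finrank K (W.toAffine.CoordinateRing ⧸ J))} := by
  set S := D.some.support with hS
  -- The affine part of `D` is the difference of the effective divisors defined by `A` and `B`.
  set A := primeProd S (fun M => (D (some M)).toNat) with hA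
  set B := primeProd S (fun M => (-D (some M)).toNat) with hB
  have hA0 : A ≠ ⊥ := primeProd_ne_bot _ _
  have hB0 : B ≠ ⊥ := primeProd_ne_bot _ _
  have hns : ∀ M, M ∉ S → D (some M) = 0 := fun M hM => by
    rw [hS, Finsupp.notMem_support_iff] at hM
    simpa using hM
  have hord : ∀ M : MaximalSpectrum W.toAffine.CoordinateRing,
      D (some M) = (ordIdeal M.asIdeal A : ℤ) - ordIdeal M.asIdeal B := fun M => by
    rw [hA, hB, ordIdeal_primeProd _ _ _ (fun h => by simp [hns M h]),
      ordIdeal_primeProd _ _ _ (fun h => by simp [hns M h])]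
    exact (Int.toNat_sub_toNat_neg _).symm
  have hdeg : (n : ℤ) = D none + Module.finrank K (W.toAffine.CoordinateRing ⧸ A) -
      Module.finrank K (W.toAffine.CoordinateRing ⧸ B) := by
    rw [← hn, degree, Finsupp.sum_option_index _ _ (by simp) (fun _ _ _ => add_mul _ _ _), hA, hB,
      finrank_quotient_primeProd, finrank_quotient_primeProd, add_sub_assoc]
    push_cast
    rw [← Finset.sum_sub_distrib, Finsupp.sum]
    congr 1
    · simp [pointDegree]
    · refine Finset.sum_congr rfl fun M _ => ?_
      rw [← sub_mul, Int.toNat_sub_toNat_neg]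
      simp
  have hcl : divisorClass D = idealClass hA0 - idealClass hB0 := by
    rw [divisorClass, Finsupp.sum_option_index _ _ (by simp) (fun _ _ _ => add_smul _ _ _),
      idealClass_primeProd, idealClass_primeProd, ← Finset.sum_sub_distrib, Finsupp.sum]
    rw [show closedPointClass (W := W) none = 0 from rfl, smul_zero, zero_add]
    refine Finset.sum_congr rfl fun M _ => ?_
    rw [← natCast_zsmul, ← natCast_zsmul, ← sub_smul, Int.toNat_sub_toNat_neg]
    simp
  have hJA : idealClass (mul_ne_zero hJ hA0) = idealClass hB0 := by
    rw [idealClass_mul hJ hA0, hJD, hcl]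
    abel
  -- The hypothesis on the classes gives `x J A = y B`, and `L(D)` is the part of `(x / y) J` with
  -- bounded poles at infinity.
  obtain ⟨x, y, hx, hy, hxy⟩ := ClassGroup.mk0_eq_mk0_iff.mp (Additive.ofMul.injective hJA)
  change Ideal.span {x} * (J * A) = Ideal.span {y} * B at hxy
  have hx' := (Ideal.span_singleton_eq_bot (α := W.toAffine.CoordinateRing)).not.mpr hx
  have hy' := (Ideal.span_singleton_eq_bot (α := W.toAffine.CoordinateRing)).not.mpr hy
  have hordxy : ∀ M : Ideal W.toAffine.CoordinateRing,
      ordIdeal M (Ideal.span {x}) + (ordIdeal M J + ordIdeal M A) =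
        ordIdeal M (Ideal.span {y}) + ordIdeal M B := fun M => by
    rw [← ordIdeal_mul hJ hA0, ← ordIdeal_mul hx' (mul_ne_zero hJ hA0), hxy, ordIdeal_mul hy' hB0]
  have hdegxy : (Algebra.norm K[X] x).natDegree +
      (Module.finrank K (W.toAffine.CoordinateRing ⧸ J) +
        Module.finrank K (W.toAffine.CoordinateRing ⧸ A)) =
      (Algebra.norm K[X] y).natDegree + Module.finrank K (W.toAffine.CoordinateRing ⧸ B) := by
    rw [← finrank_quotient_mul_coordinateRing hJ hA0, ← finrank_quotient_span hx,
      ← finrank_quotient_mul_coordinateRing hx' (mul_ne_zero hJ hA0), hxy,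
      finrank_quotient_mul_coordinateRing hy' hB0,
      finrank_quotient_span hy]
  have hinj := IsFractionRing.injective W.toAffine.CoordinateRing W.toAffine.FunctionField
  have hxF : algebraMap _ W.toAffine.FunctionField x ≠ 0 := (map_ne_zero_iff _ hinj).mpr hx
  have hyF : algebraMap _ W.toAffine.FunctionField y ≠ 0 := (map_ne_zero_iff _ hinj).mpr hy
  -- The condition at infinity on a quotient `g / h` with `g y = h x j`.
  have key : ∀ g h j : W.toAffine.CoordinateRing, g ≠ 0 → h ≠ 0 → j ≠ 0 → g * y = h * x * j →
      ((Algebra.norm K[X] j).natDegree ≤ n + Module.finrank K (W.toAffine.CoordinateRing ⧸ J) ↔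
        0 ≤ orderAt W g none - orderAt W h none + D none) := by
    intro g h j hg hh hj hE
    have h1 := congrArg (fun a => (Algebra.norm K[X] a).natDegree) hE
    simp only [map_mul] at h1
    have hN : ∀ a : W.toAffine.CoordinateRing, a ≠ 0 → Algebra.norm K[X] a ≠ 0 := fun a ha =>
      Algebra.norm_ne_zero_iff.mpr ha
    rw [natDegree_mul (hN g hg) (hN y hy), natDegree_mul (mul_ne_zero (hN h hh) (hN x hx))
      (hN j hj),
      natDegree_mul (hN h hh) (hN x hx)] at h1
    simp only [orderAt]
    omega
  refine ⟨algebraMap _ _ x / algebraMap _ _ y, div_ne_zero hxF hyF, Set.ext fun f => ⟨?_, ?_⟩⟩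
  · intro hf
    by_cases hf0 : f = 0
    · exact ⟨0, J.zero_mem, by simp [hf0], Or.inl rfl⟩
    obtain ⟨g, h, hh, rfl⟩ := IsFractionRing.div_surjective (A := W.toAffine.CoordinateRing) f
    have hh0 : h ≠ 0 := nonZeroDivisors.ne_zero hh
    have hhF : algebraMap _ W.toAffine.FunctionField h ≠ 0 := (map_ne_zero_iff _ hinj).mpr hh0
    have hg0 : g ≠ 0 := by
      rintro rfl
      simp at hf0
    have hcond := hf g h hg0 hh0 (by field_simp)
    have hle : Ideal.span {g * y} ≤ Ideal.span {h * x} * J := by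
      have h1 := (Ideal.span_singleton_eq_bot (α := W.toAffine.CoordinateRing)).not.mpr
        (mul_ne_zero hg0 hy)
      have h2 := (Ideal.span_singleton_eq_bot (α := W.toAffine.CoordinateRing)).not.mpr
        (mul_ne_zero hh0 hx)
      refine (le_iff_ordIdeal_le h1 (mul_ne_zero h2 hJ)).mpr fun M hM => ?_
      have hc := hcond (some ⟨M, hM⟩)
      have hg' := (Ideal.span_singleton_eq_bot (α := W.toAffine.CoordinateRing)).not.mpr hg0
      have hh' := (Ideal.span_singleton_eq_bot (α := W.toAffine.CoordinateRing)).not.mpr hh0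
      rw [orderAt_some hg0, orderAt_some hh0, hord] at hc
      rw [ordIdeal_mul h2 hJ, ← Ideal.span_singleton_mul_span_singleton,
        ← Ideal.span_singleton_mul_span_singleton, ordIdeal_mul hh' hx', ordIdeal_mul hg' hy']
      have := hordxy M
      simp only at hc
      omega
    obtain ⟨j, hj, hjE⟩ := Ideal.mem_span_singleton_mul.mp (hle (Ideal.mem_span_singleton_self _))
    have hj0 : j ≠ 0 := by
      rintro rfl
      exact mul_ne_zero hg0 hy (by rw [← hjE, mul_zero])
    refine ⟨j, hj, ?_, Or.inr ((key g h j hg0 hh0 hj0 hjE.symm).mpr (hcond none))⟩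
    have := congrArg (algebraMap _ W.toAffine.FunctionField) hjE
    simp only [map_mul] at this
    field_simp
    linear_combination -this
  · rintro ⟨j, hj, rfl, hdegj⟩ g h hg0 hh0 hE c
    have hE' : g * y = h * x * j := by
      apply hinj
      simp only [map_mul]
      rw [hE]
      field_simp
    have hj0 : j ≠ 0 := by
      rintro rfl
      exact mul_ne_zero hg0 hy (by rw [hE', mul_zero])
    cases c with
    | none => exact (key g h j hg0 hh0 hj0 hE').mp (hdegj.resolve_left hj0)
    | some M =>
      have hg' := (Ideal.span_singleton_eq_bot (α := W.toAffine.CoordinateRing)).not.mpr hg0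
      have hh' := (Ideal.span_singleton_eq_bot (α := W.toAffine.CoordinateRing)).not.mpr hh0
      have hj' := (Ideal.span_singleton_eq_bot (α := W.toAffine.CoordinateRing)).not.mpr hj0
      have h1 : ordIdeal M.asIdeal (Ideal.span {g}) + ordIdeal M.asIdeal (Ideal.span {y}) =
          ordIdeal M.asIdeal (Ideal.span {h}) + ordIdeal M.asIdeal (Ideal.span {x}) +
            ordIdeal M.asIdeal (Ideal.span {j}) := by
        rw [← ordIdeal_mul hg' hy', ← ordIdeal_mul hh' hx',
          ← ordIdeal_mul (mul_ne_zero hh' hx') hj', Ideal.span_singleton_mul_span_singleton,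
          Ideal.span_singleton_mul_span_singleton, Ideal.span_singleton_mul_span_singleton, hE']
      have h2 := (le_iff_ordIdeal_le hj' hJ).mp ((Ideal.span_singleton_le_iff_mem _).mpr hj)
        M.asIdeal M.isMaximal
      have h3 := hordxy M.asIdeal
      rw [orderAt_some hg0, orderAt_some hh0, hord]
      omega

end GenusOne

/-! ### Functions with poles of order at most five at infinity -/

namespace GenusOne

open Polynomial nonZeroDivisors
open scoped Polynomial.Bivariate

open WeierstrassCurve WeierstrassCurve.Affine

section PoleOrder

variable {K : Type*} [Field K] (W : WeierstrassCurve K)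

/-- The coordinate function `x`. -/
noncomputable def coordX : W.toAffine.CoordinateRing := CoordinateRing.mk W.toAffine (C X)

/-- The coordinate function `y`. -/
noncomputable def coordY : W.toAffine.CoordinateRing := CoordinateRing.mk W.toAffine Y

theorem algebraMap_eq_mk (a : K) :
    algebraMap K W.toAffine.CoordinateRing a = CoordinateRing.mk W.toAffine (C (C a)) := rfl

theorem coord_equation :
    coordY W ^ 2 + algebraMap K _ W.a₁ * coordX W * coordY W + algebraMap K _ W.a₃ * coordY W =
      coordX W ^ 3 + algebraMap K _ W.a₂ * coordX W ^ 2 + algebraMap K _ W.a₄ * coordX W +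
        algebraMap K _ W.a₆ := by
  simp only [coordX, coordY, algebraMap_eq_mk, ← map_mul, ← map_pow, ← map_add]
  refine AdjoinRoot.mk_eq_mk.mpr ⟨1, ?_⟩
  rw [WeierstrassCurve.Affine.polynomial]
  simp only [map_add, map_mul, map_pow]
  ring1

theorem smul_basis_eq (p q : K[X]) :
    p • (1 : W.toAffine.CoordinateRing) + q • CoordinateRing.mk W.toAffine Y =
      aeval (coordX W) p + aeval (coordX W) q * coordY W := by
  have h : ∀ p : K[X], aeval (coordX W) p = CoordinateRing.mk W.toAffine (C p) := fun p => by
    induction p using Polynomial.induction_on' with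
    | add p q hp hq => simp [hp, hq]
    | monomial n a =>
      rw [aeval_monomial, ← C_mul_X_pow_eq_monomial, algebraMap_eq_mk, coordX, C_mul, C_pow,
        map_mul, map_pow]
  rw [CoordinateRing.smul, CoordinateRing.smul, mul_one, h, h, coordY]

/-- The functions `a + b x + c y + d x² + e x y`, that is, those with a pole of order at most `5`
at infinity. -/
noncomputable def lowDegree (a b c d e : K) : W.toAffine.CoordinateRing :=
  algebraMap K _ a + algebraMap K _ b * coordX W + algebraMap K _ c * coordY W +
    algebraMap K _ d * coordX W ^ 2 + algebraMap K _ e * (coordX W * coordY W)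

theorem lowDegree_eq (a b c d e : K) : lowDegree W a b c d e =
    (C a + C b * X + C d * X ^ 2) • (1 : W.toAffine.CoordinateRing) +
      (C c + C e * X) • CoordinateRing.mk W.toAffine Y := by
  rw [smul_basis_eq, lowDegree]
  simp
  ring

variable {W}

theorem lowDegree_eq_zero {a b c d e : K} (h : lowDegree W a b c d e = 0) :
    a = 0 ∧ b = 0 ∧ c = 0 ∧ d = 0 ∧ e = 0 := by
  rw [lowDegree_eq] at h
  obtain ⟨h1, h2⟩ := CoordinateRing.smul_basis_eq_zero h
  have ha := congrArg (fun p => coeff p 0) h1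
  have hb := congrArg (fun p => coeff p 1) h1
  have hd := congrArg (fun p => coeff p 2) h1
  have hc := congrArg (fun p => coeff p 0) h2
  have he := congrArg (fun p => coeff p 1) h2
  simp [coeff_X, coeff_C] at ha hb hc hd he
  exact ⟨ha, hb, hc, hd, he⟩

theorem lowDegree_mem_XYIdeal {x y : K} (h : W.toAffine.Equation x y) (a b c d e : K) :
    lowDegree W a b c d e ∈ CoordinateRing.XYIdeal W.toAffine x (C y) ↔
      a + b * x + c * y + d * x ^ 2 + e * (x * y) = 0 := by
  rw [show lowDegree W a b c d e = CoordinateRing.mk W.toAffine (C (C a) + C (C b) * C X +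
    C (C c) * Y + C (C d) * C X ^ 2 + C (C e) * (C X * Y)) by
      simp only [lowDegree, coordX, coordY, algebraMap_eq_mk, map_add, map_mul, map_pow],
    mem_XYIdeal_iff h]
  simp [evalEval, mul_comm y x]

variable (W) in
/-- The functions in an ideal `J` with a pole of order at most `m` at infinity, as measured by the
degree of the norm. -/
noncomputable def boundedPole (J : Ideal W.toAffine.CoordinateRing) (m : ℕ) :
    Submodule K W.toAffine.CoordinateRing where
  carrier := {g | g ∈ J ∧ (g = 0 ∨ (Algebra.norm K[X] g).natDegree ≤ m)}
  zero_mem' := ⟨J.zero_mem, Or.inl rfl⟩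
  add_mem' := by
    rintro g h ⟨hg, hg'⟩ ⟨hh, hh'⟩
    refine ⟨J.add_mem hg hh, ?_⟩
    rcases hg' with rfl | hg'
    · simpa using hh'
    rcases hh' with rfl | hh'
    · simpa using Or.inr hg'
    obtain ⟨p, q, rfl⟩ := CoordinateRing.exists_smul_basis_eq g
    obtain ⟨p', q', rfl⟩ := CoordinateRing.exists_smul_basis_eq h
    right
    rw [natDegree_norm_le_iff] at hg' hh'
    rw [show p • (1 : W.toAffine.CoordinateRing) + q • CoordinateRing.mk W.toAffine Y +
      (p' • 1 + q' • CoordinateRing.mk W.toAffine Y) =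
      (p + p') • 1 + (q + q') • CoordinateRing.mk W.toAffine Y by
        rw [add_smul, add_smul]; abel, natDegree_norm_le_iff]
    have h1 := natDegree_add_le p p'
    have h2 := natDegree_add_le q q'
    refine ⟨by omega, ?_⟩
    rcases hg'.2 with hq | hq
    · simpa [hq] using hh'.2
    rcases hh'.2 with hq' | hq'
    · simpa [hq'] using Or.inr hq
    right
    omega
  smul_mem' := by
    rintro c g ⟨hg, hg'⟩
    refine ⟨Submodule.smul_of_tower_mem J c hg, ?_⟩
    rcases hg' with rfl | hg'
    · exact Or.inl (smul_zero c)
    obtain ⟨p, q, rfl⟩ := CoordinateRing.exists_smul_basis_eq g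
    right
    rw [natDegree_norm_le_iff] at hg'
    rw [smul_add, ← smul_assoc, ← smul_assoc, natDegree_norm_le_iff]
    have h1 := natDegree_smul_le c p
    have h2 := natDegree_smul_le c q
    refine ⟨by omega, ?_⟩
    rcases hg'.2 with hq | hq
    · exact Or.inl (by rw [hq, smul_zero])
    · right
      omega

theorem mem_boundedPole {J : Ideal W.toAffine.CoordinateRing} {m : ℕ}
    {g : W.toAffine.CoordinateRing} :
    g ∈ boundedPole W J m ↔ g ∈ J ∧ (g = 0 ∨ (Algebra.norm K[X] g).natDegree ≤ m) := Iff.rfl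

theorem lowDegree_mem_boundedPole {J : Ideal W.toAffine.CoordinateRing} {m : ℕ} {a b c d e : K}
    (hJ : lowDegree W a b c d e ∈ J) (hb : b = 0 ∨ 2 ≤ m) (hc : c = 0 ∨ 3 ≤ m) (hd : d = 0 ∨ 4 ≤ m)
    (he : e = 0 ∨ 5 ≤ m) : lowDegree W a b c d e ∈ boundedPole W J m := by
  refine ⟨hJ, Or.inr ?_⟩
  rw [lowDegree_eq, natDegree_norm_le_iff]
  constructor
  · rcases hd with rfl | hd
    · rcases hb with rfl | hb
      · simp
      · have : (C a + C b * X + C 0 * X ^ 2 : K[X]).natDegree ≤ 1 := by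
          rw [C_0, zero_mul, add_zero]; compute_degree
        omega
    · have : (C a + C b * X + C d * X ^ 2 : K[X]).natDegree ≤ 2 := by compute_degree
      omega
  · rcases he with rfl | he
    · rcases hc with rfl | hc
      · simp
      · have : (C c + C 0 * X : K[X]).natDegree ≤ 0 := by simp
        omega
    · have : (C c + C e * X : K[X]).natDegree ≤ 1 := by compute_degree
      omega

theorem boundedPole_mono {I J : Ideal W.toAffine.CoordinateRing} (hIJ : I ≤ J) (m : ℕ) :
    boundedPole W I m ≤ boundedPole W J m := fun _ hg => ⟨hIJ hg.1, hg.2⟩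

/-- A function with a pole of order at most `m` is `p + q y` with `deg p ≤ m / 2` and
`deg q ≤ (m - 3) / 2`. -/
theorem finrank_boundedPole_top {m : ℕ} (hm : 1 ≤ m) :
    Module.Finite K (boundedPole W ⊤ m) ∧ Module.finrank K (boundedPole W ⊤ m) ≤ m := by
  let V := (degreeLT K (m / 2 + 1)) × (degreeLT K ((m - 1) / 2))
  let e : V →ₗ[K] W.toAffine.CoordinateRing :=
    { toFun := fun v => (v.1 : K[X]) • 1 + (v.2 : K[X]) • CoordinateRing.mk W.toAffine Y
      map_add' := fun v w => by
        change ((v.1 : K[X]) + w.1) • 1 + ((v.2 : K[X]) + w.2) • CoordinateRing.mk W.toAffine Y = _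
        rw [add_smul, add_smul, add_add_add_comm]
      map_smul' := fun c v => by
        change (c • (v.1 : K[X])) • 1 + (c • (v.2 : K[X])) • CoordinateRing.mk W.toAffine Y = _
        rw [smul_assoc, smul_assoc, ← smul_add, RingHom.id_apply] }
  have hfin : ∀ k, Module.Finite K (degreeLT K k) := fun k =>
    Module.Finite.equiv (degreeLTEquiv K k).symm
  have := hfin (m / 2 + 1)
  have := hfin ((m - 1) / 2)
  have hV : Module.finrank K V = m := by
    rw [Module.finrank_prod, (degreeLTEquiv K _).finrank_eq, (degreeLTEquiv K _).finrank_eq]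
    simp
    omega
  have hle : boundedPole W ⊤ m ≤ LinearMap.range e := by
    rintro g ⟨-, hg⟩
    rcases hg with rfl | hg
    · exact zero_mem _
    obtain ⟨p, q, rfl⟩ := CoordinateRing.exists_smul_basis_eq g
    rw [natDegree_norm_le_iff] at hg
    refine ⟨(⟨p, mem_degreeLT.mpr ?_⟩, ⟨q, mem_degreeLT.mpr ?_⟩), rfl⟩
    · exact (degree_le_natDegree).trans_lt (by exact_mod_cast (by omega))
    · rcases hg.2 with rfl | hq
      · simp
      · exact (degree_le_natDegree).trans_lt (by exact_mod_cast (by omega))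
  exact ⟨Submodule.finiteDimensional_of_le hle,
    (Submodule.finrank_mono hle).trans ((LinearMap.finrank_range_le e).trans hV.le)⟩

/-- Passing to an ideal that misses one of the functions lowers the dimension. -/
theorem finrank_boundedPole_of_notMem {I J : Ideal W.toAffine.CoordinateRing} (hIJ : I ≤ J)
    {m k : ℕ} (hJ : Module.Finite K (boundedPole W J m) ∧
      Module.finrank K (boundedPole W J m) ≤ k + 1)
    {g : W.toAffine.CoordinateRing} (hg : g ∈ boundedPole W J m) (hgI : g ∉ I) :
    Module.Finite K (boundedPole W I m) ∧ Module.finrank K (boundedPole W I m) ≤ k := by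
  have := hJ.1
  have hlt : boundedPole W I m < boundedPole W J m :=
    lt_of_le_of_ne (boundedPole_mono hIJ m) fun h => hgI (h.symm ▸ hg : g ∈ boundedPole W I m).1
  exact ⟨Submodule.finiteDimensional_of_le hlt.le, by
    have := Submodule.finrank_lt_finrank_of_lt hlt
    omega⟩

theorem finrank_boundedPole_XYIdeal {x y : K} (h : W.toAffine.Equation x y) (m : ℕ) :
    Module.Finite K (boundedPole W (CoordinateRing.XYIdeal W.toAffine x (C y)) (m + 1)) ∧
      Module.finrank K (boundedPole W (CoordinateRing.XYIdeal W.toAffine x (C y)) (m + 1)) ≤ m := by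
  refine finrank_boundedPole_of_notMem le_top (finrank_boundedPole_top (by omega))
    (g := lowDegree W 1 0 0 0 0)
    (lowDegree_mem_boundedPole trivial (Or.inl rfl) (Or.inl rfl) (Or.inl rfl) (Or.inl rfl)) ?_
  rw [lowDegree_mem_XYIdeal h]
  simp

theorem XClass_eq_lowDegree (x : K) :
    CoordinateRing.XClass W.toAffine x = lowDegree W (-x) 1 0 0 0 := by
  rw [CoordinateRing.XClass, lowDegree, coordX]
  simp only [map_sub, map_neg, map_one, map_zero, algebraMap_eq_mk]
  ring

theorem YClass_eq_lowDegree (y : K) :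
    CoordinateRing.YClass W.toAffine (C y) = lowDegree W (-y) 0 1 0 0 := by
  rw [CoordinateRing.YClass, lowDegree, coordY]
  simp only [map_sub, map_neg, map_one, map_zero, algebraMap_eq_mk]
  ring

variable [W.IsElliptic]

/-- One of the two generators of the ideal of the first point is not in the product, so the
dimension drops at each of the two points. -/
theorem finrank_boundedPole_XYIdeal_mul {x y x' y' : K} (h : W.toAffine.Equation x y)
    (h' : W.toAffine.Equation x' y') {m : ℕ} (hm : 1 ≤ m) :
    Module.Finite K (boundedPole W (CoordinateRing.XYIdeal W.toAffine x (C y) *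
      CoordinateRing.XYIdeal W.toAffine x' (C y')) (m + 2)) ∧
    Module.finrank K (boundedPole W (CoordinateRing.XYIdeal W.toAffine x (C y) *
      CoordinateRing.XYIdeal W.toAffine x' (C y')) (m + 2)) ≤ m := by
  have key : ∃ g ∈ boundedPole W (CoordinateRing.XYIdeal W.toAffine x (C y)) (m + 2),
      g ∉ CoordinateRing.XYIdeal W.toAffine x (C y) *
        CoordinateRing.XYIdeal W.toAffine x' (C y') := by
    by_contra! hcon
    have h1 := hcon (CoordinateRing.XClass W.toAffine x) (by
      rw [XClass_eq_lowDegree]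
      refine lowDegree_mem_boundedPole ?_ (Or.inr (by omega)) (Or.inl rfl) (Or.inl rfl) (Or.inl rfl)
      rw [lowDegree_mem_XYIdeal h]
      ring)
    have h2 := hcon (CoordinateRing.YClass W.toAffine (C y)) (by
      rw [YClass_eq_lowDegree]
      refine lowDegree_mem_boundedPole ?_ (Or.inl rfl) (Or.inr (by omega)) (Or.inl rfl) (Or.inl rfl)
      rw [lowDegree_mem_XYIdeal h]
      ring)
    have hle : CoordinateRing.XYIdeal W.toAffine x (C y) ≤
        CoordinateRing.XYIdeal W.toAffine x (C y) * CoordinateRing.XYIdeal W.toAffine x' (C y') :=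
      Ideal.span_le.mpr (by
        rintro g (rfl | rfl)
        · exact h1
        · exact h2)
    have heq := congrArg
      (fun I : Ideal W.toAffine.CoordinateRing => Module.finrank K (W.toAffine.CoordinateRing ⧸ I))
      (le_antisymm hle Ideal.mul_le_left)
    simp only [finrank_quotient_mul_coordinateRing (XYIdeal_ne_bot x y) (XYIdeal_ne_bot x' y'),
      finrank_quotient_XYIdeal h, finrank_quotient_XYIdeal h'] at heq
    omega
  obtain ⟨g, hg, hgI⟩ := key
  exact finrank_boundedPole_of_notMem Ideal.mul_le_left (finrank_boundedPole_XYIdeal h (m + 1))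
    hg hgI

/-- A basis of the Riemann-Roch space of a divisor, given by functions in an ideal `J` of the
inverse class. The inequality in `hV` bounds the dimension of the space, so that `n` independent
functions span it. -/
theorem exists_isLinearSystemBasis {D : Divisor W} {n : ℕ} (hn : degree W D = n)
    {J : Ideal W.toAffine.CoordinateRing} (hJ : J ≠ ⊥) (hJD : idealClass hJ = -divisorClass D)
    {k : ℕ} (hk : Module.finrank K (W.toAffine.CoordinateRing ⧸ J) = k)
    (hV : Module.Finite K (boundedPole W J (n + k)) ∧
      Module.finrank K (boundedPole W J (n + k)) ≤ n)
    {b : Fin n → W.toAffine.CoordinateRing} (hb : LinearIndependent K b)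
    (hbV : ∀ i, b i ∈ boundedPole W J (n + k)) :
    ∃ w : W.toAffine.FunctionField, w ≠ 0 ∧
      IsLinearSystemBasis W D (fun i => w * algebraMap _ W.toAffine.FunctionField (b i)) := by
  obtain ⟨w, hw, hwD⟩ := exists_riemannRochSpace_eq hn hJ hJD
  rw [hk] at hwD
  have hspan : Submodule.span K (Set.range b) = boundedPole W J (n + k) := by
    have := hV.1
    refine Submodule.eq_of_le_of_finrank_le (Submodule.span_le.mpr (by
      rintro _ ⟨i, rfl⟩
      exact hbV i)) ?_
    rw [finrank_span_eq_card hb, Fintype.card_fin]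
    exact hV.2
  let φ : W.toAffine.CoordinateRing →ₗ[K] W.toAffine.FunctionField :=
    (LinearMap.mulLeft K w).comp (Algebra.linearMap W.toAffine.CoordinateRing
      W.toAffine.FunctionField |>.restrictScalars K)
  have hφ : ∀ g, φ g = w * algebraMap _ _ g := fun g => rfl
  have hφi : Function.Injective φ := fun g h hgh =>
    IsFractionRing.injective W.toAffine.CoordinateRing W.toAffine.FunctionField
      (mul_left_cancel₀ hw hgh)
  refine ⟨w, hw, hb.map' φ (LinearMap.ker_eq_bot.mpr hφi), ?_⟩
  rw [show (fun i => w * algebraMap _ W.toAffine.FunctionField (b i)) = φ ∘ b from rfl,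
    Set.range_comp, ← Submodule.map_span, hspan, hwD]
  ext f
  simp only [Submodule.map_coe, Set.mem_image, SetLike.mem_coe, Set.mem_ofPred_eq, mem_boundedPole,
    hφ]
  constructor
  · rintro ⟨g, ⟨h1, h2⟩, rfl⟩
    exact ⟨g, h1, rfl, h2⟩
  · rintro ⟨g, h1, rfl, h2⟩
    exact ⟨g, ⟨h1, h2⟩, rfl⟩

end PoleOrder

end GenusOne

/-! ### The vanishing ideal of a curve in a product of projective lines -/

namespace GenusOne

open MvPolynomial

section Homogeneous

/-- An induction principle for homogeneous polynomials that keeps track of the degree. -/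
theorem isWeightedHomogeneous_induction {σ M A : Type*} [CommSemiring A] [AddCommMonoid M]
    {w : σ → M} {P : M → MvPolynomial σ A → Prop} (zero : ∀ m, P m 0)
    (add : ∀ m G H, P m G → P m H → P m (G + H)) (const : ∀ c, P 0 (C c))
    (mul_X : ∀ m G i, P m G → P (m + w i) (G * X i)) {m : M} {G : MvPolynomial σ A}
    (hG : IsWeightedHomogeneous w G m) : P m G := by
  have hmon : ∀ (s : σ →₀ ℕ) (c : A), P (Finsupp.weight w s) (monomial s c) := by
    intro s c
    induction s using Finsupp.induction with
    | zero => simpa using const c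
    | single_add i k s hi hk ih =>
      clear hk hi
      induction k with
      | zero => simpa using ih
      | succ k ihk =>
        have := mul_X _ _ i ihk
        rw [X, monomial_mul, mul_one] at this
        convert this using 1
        · simp only [map_add, Finsupp.single_add, Finsupp.weight_single, one_smul]
          exact add_right_comm _ _ _
        · rw [Finsupp.single_add, add_right_comm]
  induction hG using IsWeightedHomogeneous.induction_on with
  | zero => exact zero m
  | add p q hp hq ihp ihq => exact add m p q ihp ihq
  | monomial d r h => exact h ▸ hmon d r

theorem aeval_smul_of_isHomogeneous {σ K R : Type*} [CommSemiring K] [CommSemiring R] [Algebra K R]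
    {G : MvPolynomial σ K} {e : ℕ} (hG : G.IsHomogeneous e) (a : R) (x : σ → R) :
    aeval (fun i => a * x i) G = a ^ e * aeval x G := by
  refine isWeightedHomogeneous_induction (w := (1 : σ → ℕ))
    (P := fun e G => aeval (fun i => a * x i) G = a ^ e * aeval x G) ?_ ?_ ?_ ?_ hG
  · simp
  · intro m G H hG hH
    rw [map_add, map_add, hG, hH, mul_add]
  · simp
  · intro m G i h
    rw [map_mul, map_mul, h, aeval_X, aeval_X, Pi.one_apply, pow_succ]
    ring

variable {K : Type*} [Field K] {n : ℕ}

theorem isBihomogeneous_induction {P : ℕ → ℕ → BiRing K n → Prop} (zero : ∀ d e, P d e 0)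
    (add : ∀ d e G H, P d e G → P d e H → P d e (G + H)) (const : ∀ c, P 0 0 (C c))
    (mul_x : ∀ d e G i, P d e G → P (d + 1) e (G * X (Sum.inl i)))
    (mul_y : ∀ d e G i, P d e G → P d (e + 1) (G * X (Sum.inr i))) {d : ℕ × ℕ} {G : BiRing K n}
    (hG : IsBihomogeneous G d) : P d.1 d.2 G := by
  refine isWeightedHomogeneous_induction (P := fun (d : ℕ × ℕ) G => P d.1 d.2 G)
    (fun _ => zero _ _) (fun _ => add _ _) const (fun d G i h => ?_) hG
  cases i with
  | inl i => exact mul_x _ _ _ _ h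
  | inr i => exact mul_y _ _ _ _ h

theorem aeval_smul_of_isBihomogeneous {R : Type*} [CommRing R] [Algebra K R] {G : BiRing K n}
    {d : ℕ × ℕ} (hG : IsBihomogeneous G d) (a b : R) (x y : Fin n → R) :
    aeval (Sum.elim (fun i => a * x i) (fun i => b * y i)) G =
      a ^ d.1 * b ^ d.2 * aeval (Sum.elim x y) G := by
  refine isBihomogeneous_induction (P := fun d e G =>
    aeval (Sum.elim (fun i => a * x i) (fun i => b * y i)) G =
      a ^ d * b ^ e * aeval (Sum.elim x y) G) ?_ ?_ ?_ ?_ ?_ hG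
  · simp
  · intro d e G H hG hH
    rw [map_add, map_add, hG, hH, mul_add]
  · simp
  · intro d e G i h
    rw [map_mul, map_mul, h, aeval_X, aeval_X, Sum.elim_inl, Sum.elim_inl]
    ring
  · intro d e G i h
    rw [map_mul, map_mul, h, aeval_X, aeval_X, Sum.elim_inr, Sum.elim_inr]
    ring

/-- The condition of `DefinesImage` for functions with values in a domain. -/
def VanishingIdealEq {R : Type*} [CommRing R] [Algebra K R] (b b' : Fin n → R)
    (I : Ideal (BiRing K n)) : Prop :=
  ∀ (d : ℕ × ℕ) (G : BiRing K n), IsBihomogeneous G d →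
    (aeval (Sum.elim b b') G = 0 ↔ ∃ N : ℕ, ∀ i j, (X (Sum.inl i) * X (Sum.inr j)) ^ N * G ∈ I)

/-- The condition is unaffected by scaling the two tuples of functions. -/
theorem VanishingIdealEq.definesImage {R L : Type*} [CommRing R] [Algebra K R] [Field L]
    [Algebra K L] [Algebra R L] [IsScalarTower K R L]
    (hinj : Function.Injective (algebraMap R L)) {b b' : Fin n → R} {I : Ideal (BiRing K n)}
    (h : VanishingIdealEq b b' I) {w w' : L} (hw : w ≠ 0) (hw' : w' ≠ 0) :
    DefinesImage (K := K) (fun i => w * algebraMap R L (b i)) (fun i => w' * algebraMap R L (b' i))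
      I := by
  intro d G hG
  rw [← h d G hG, aeval_smul_of_isBihomogeneous hG]
  have : Sum.elim (fun i => algebraMap R L (b i)) (fun i => algebraMap R L (b' i)) =
      algebraMap R L ∘ Sum.elim b b' := by
    ext (i | i) <;> rfl
  rw [this, aeval_algebraMap_apply, mul_eq_zero, map_eq_zero_iff _ hinj]
  simp [hw, hw']

/-- One of the two implications in `VanishingIdealEq` holds as soon as the ideal vanishes at
`(b, b')`. -/
theorem VanishingIdealEq.of_imp {R : Type*} [CommRing R] [IsDomain R] [Algebra K R]
    {b b' : Fin (n + 1) → R} {I : Ideal (BiRing K (n + 1))} (hb : b 0 ≠ 0) (hb' : b' 0 ≠ 0)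
    (hI : I ≤ RingHom.ker (aeval (R := K) (Sum.elim b b')))
    (h : ∀ (d : ℕ × ℕ) (G : BiRing K (n + 1)), IsBihomogeneous G d →
      aeval (Sum.elim b b') G = 0 →
      ∃ N : ℕ, ∀ i j, (X (Sum.inl i) * X (Sum.inr j)) ^ N * G ∈ I) :
    VanishingIdealEq b b' I := by
  refine fun d G hG => ⟨h d G hG, fun ⟨N, hN⟩ => ?_⟩
  have := hI (hN 0 0)
  rw [RingHom.mem_ker] at this
  simpa [hb, hb'] using this

end Homogeneous

section Form22

variable {K : Type*} [Field K] {R : Type*} [CommRing R] [Algebra K R]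

/-- A polynomial in the first set of variables, viewed as a bihomogeneous form. -/
noncomputable abbrev liftX {n : ℕ} : MvPolynomial (Fin n) K →ₐ[K] BiRing K n := rename Sum.inl

theorem aeval_liftX {n : ℕ} (b b' : Fin n → R) (H : MvPolynomial (Fin n) K) :
    aeval (Sum.elim b b') (liftX H) = aeval b H := by
  rw [liftX, aeval_rename, Sum.elim_comp_inl]

/-- Pseudo-division by a `(2,2)`-form, viewed as a binary quadratic form in `y` with coefficients
`f₀, f₁, f₂`: after multiplication by powers of the leading coefficient and of a variable, each
form is congruent to one that is linear in `y`. The indices `a` and `a'` allow for both orderings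
of the variables. -/
theorem exists_dvd_pseudoRemainder {f₀ f₁ f₂ : MvPolynomial (Fin 2) K} (h₀ : f₀.IsHomogeneous 2)
    (h₁ : f₁.IsHomogeneous 2) (h₂ : f₂.IsHomogeneous 2) {a a' : Fin 2}
    (ha : ∀ j, j = a ∨ j = a') {d : ℕ × ℕ} {G : BiRing K 2} (hG : IsBihomogeneous G d) :
    ∃ R₀ R₁ : MvPolynomial (Fin 2) K, R₀.IsHomogeneous (d.1 + 2 * d.2) ∧
      R₁.IsHomogeneous (d.1 + 2 * d.2) ∧
      liftX f₀ * X (Sum.inr a) ^ 2 + liftX f₁ * (X (Sum.inr a) * X (Sum.inr a')) +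
        liftX f₂ * X (Sum.inr a') ^ 2 ∣
      liftX f₂ ^ d.2 * X (Sum.inr a) * G -
        (liftX R₁ * X (Sum.inr a') + liftX R₀ * X (Sum.inr a)) * X (Sum.inr a) ^ d.2 := by
  refine isBihomogeneous_induction (P := fun d e G =>
    ∃ R₀ R₁ : MvPolynomial (Fin 2) K, R₀.IsHomogeneous (d + 2 * e) ∧
      R₁.IsHomogeneous (d + 2 * e) ∧
      liftX f₀ * X (Sum.inr a) ^ 2 + liftX f₁ * (X (Sum.inr a) * X (Sum.inr a')) +
        liftX f₂ * X (Sum.inr a') ^ 2 ∣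
      liftX f₂ ^ e * X (Sum.inr a) * G -
        (liftX R₁ * X (Sum.inr a') + liftX R₀ * X (Sum.inr a)) * X (Sum.inr a) ^ e)
    ?_ ?_ ?_ ?_ ?_ hG
  · exact fun d e => ⟨0, 0, isHomogeneous_zero _ _ _, isHomogeneous_zero _ _ _, by simp⟩
  · rintro d e G H ⟨R₀, R₁, hR₀, hR₁, Q, hQ⟩ ⟨S₀, S₁, hS₀, hS₁, Q', hQ'⟩
    refine ⟨R₀ + S₀, R₁ + S₁, hR₀.add hS₀, hR₁.add hS₁, Q + Q', ?_⟩
    rw [map_add, map_add]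
    linear_combination hQ + hQ'
  · exact fun c => ⟨C c, 0, isHomogeneous_C _ _, isHomogeneous_zero _ _ _, 0, by
      simp [liftX]; ring⟩
  · rintro d e G i ⟨R₀, R₁, hR₀, hR₁, Q, hQ⟩
    refine ⟨R₀ * X i, R₁ * X i, ?_, ?_, Q * X (Sum.inl i), ?_⟩
    · convert hR₀.mul (isHomogeneous_X K i) using 1; omega
    · convert hR₁.mul (isHomogeneous_X K i) using 1; omega
    · rw [map_mul, map_mul, rename_X]
      linear_combination hQ * X (Sum.inl i)
  · rintro d e G i ⟨R₀, R₁, hR₀, hR₁, Q, hQ⟩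
    rcases ha i with rfl | rfl
    · refine ⟨f₂ * R₀, f₂ * R₁, ?_, ?_, liftX f₂ * X (Sum.inr i) * Q, ?_⟩
      · convert h₂.mul hR₀ using 1; omega
      · convert h₂.mul hR₁ using 1; omega
      · rw [map_mul, map_mul, pow_succ, pow_succ]
        linear_combination liftX f₂ * X (Sum.inr i) * hQ
    · refine ⟨-(f₀ * R₁), f₂ * R₀ - f₁ * R₁, ?_, ?_,
        liftX f₂ * X (Sum.inr i) * Q + liftX R₁ * X (Sum.inr a) ^ e, ?_⟩
      · have := (h₀.mul hR₁).neg
        rwa [show 2 + (d + 2 * e) = d + 2 * (e + 1) by omega] at this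
      · have := (h₂.mul hR₀).sub (h₁.mul hR₁)
        rwa [show 2 + (d + 2 * e) = d + 2 * (e + 1) by omega] at this
      · rw [map_sub, map_neg, map_mul, map_mul, map_mul, pow_succ, pow_succ]
        linear_combination liftX f₂ * X (Sum.inr i) * hQ

theorem dvd_of_dvd_prime_pow_mul {A : Type*} [CommRing A] [IsDomain A] {p F G : A} (hp : Prime p)
    (hF : ¬ p ∣ F) {k : ℕ} (h : F ∣ p ^ k * G) : F ∣ G := by
  induction k with
  | zero => simpa using h
  | succ k ih =>
    obtain ⟨Q, hQ⟩ := h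
    have hpQ : p ∣ F * Q := ⟨p ^ k * G, by rw [← hQ]; ring⟩
    obtain ⟨Q', rfl⟩ := (hp.dvd_or_dvd hpQ).resolve_left hF
    refine ih ⟨Q', mul_left_cancel₀ hp.ne_zero ?_⟩
    linear_combination hQ

/-- The coefficients of a `(2,2)`-form viewed as a quadratic form in `y`; they are the quadratic
forms in `x` given by the columns of the matrix. -/
noncomputable def Form22.col (F : Form22 K) (j : Fin 3) : MvPolynomial (Fin 2) K :=
  C (F 0 j) * X 0 ^ 2 + C (F 1 j) * (X 0 * X 1) + C (F 2 j) * X 1 ^ 2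

theorem Form22.col_isHomogeneous (F : Form22 K) (j : Fin 3) : (F.col j).IsHomogeneous 2 :=
  (((isHomogeneous_C_mul_X_pow _ _ _).add
    (((isHomogeneous_X K 0).mul (isHomogeneous_X K 1)).C_mul _)).add
      (isHomogeneous_C_mul_X_pow _ _ _))

theorem Form22.toPoly_eq (F : Form22 K) : F.toPoly =
    liftX (F.col 0) * X (Sum.inr 0) ^ 2 + liftX (F.col 1) * (X (Sum.inr 0) * X (Sum.inr 1)) +
      liftX (F.col 2) * X (Sum.inr 1) ^ 2 := by
  simp only [Form22.toPoly, Form22.col, Fin.sum_univ_three, map_add, map_mul, map_pow, rename_C,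
    rename_X, Matrix.cons_val]
  ring

/-- A form divisible by a variable vanishes where this variable does. -/
theorem Form22.not_X_dvd (F : Form22 K) (v : Fin 2 ⊕ Fin 2 → Polynomial K)
    (i : Fin 2 ⊕ Fin 2) (hi : v i = 0) (h : aeval v F.toPoly ≠ 0) : ¬ X i ∣ F.toPoly := by
  rintro ⟨Q, hQ⟩
  rw [hQ, map_mul, aeval_X, hi, zero_mul] at h
  exact h rfl

variable [IsDomain R]

/-- A criterion for a `(2,2)`-form `F` to generate the ideal of a curve: `F` vanishes on the
curve, the curve satisfies no equation of bidegree `(e, 1)`, the coefficients of `F` as a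
quadratic form in `y` have no common zero with `x₀ ≠ 0`, and certain variables do not divide
`F`. -/
theorem Form22.vanishingIdealEq {F : Form22 K} {b b' : Fin 2 → R} (hb : b 0 ≠ 0)
    (hb' : ∀ j, b' j ≠ 0) (hF : aeval (Sum.elim b b') F.toPoly = 0)
    (hkey : ∀ (e : ℕ) (R₀ R₁ : MvPolynomial (Fin 2) K), R₀.IsHomogeneous e → R₁.IsHomogeneous e →
      aeval b R₁ * b' 1 + aeval b R₀ * b' 0 = 0 → R₀ = 0 ∧ R₁ = 0)
    (hrad : (X 0 : MvPolynomial (Fin 2) K) ∈ (Ideal.span {F.col 0, F.col 1, F.col 2}).radical)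
    (hx : ¬ X (Sum.inl 0) ∣ F.toPoly) (hy₀ : ¬ X (Sum.inr 0) ∣ F.toPoly)
    (hy₁ : ¬ X (Sum.inr 1) ∣ F.toPoly) :
    VanishingIdealEq b b' (Ideal.span {F.toPoly}) := by
  refine .of_imp hb (hb' 0) ?_ fun d G hG hG0 => ⟨0, fun i j => ?_⟩
  · rw [Ideal.span_singleton_le_iff_mem, RingHom.mem_ker]
    exact hF
  rw [pow_zero, one_mul, Ideal.mem_span_singleton]
  -- The ideal of multipliers taking `y₀ y₁ G` into `(F)`. Division by `F` as a polynomial in `y₁`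
  -- shows that a power of the coefficient of `y₁²` is in this ideal, and similarly for `y₀²`.
  set Q : Ideal (BiRing K 2) := (Ideal.span {F.toPoly}).colon
    {X (Sum.inr 0) * X (Sum.inr 1) * G} with hQ
  have hmem : ∀ H, H ∈ Q ↔ F.toPoly ∣ H * (X (Sum.inr 0) * X (Sum.inr 1) * G) := fun H => by
    rw [hQ, Submodule.mem_colon_singleton, smul_eq_mul, Ideal.mem_span_singleton]
  have h2 : liftX (F.col 2) ∈ Q.radical := by
    obtain ⟨R₀, R₁, hR₀, hR₁, hd⟩ := exists_dvd_pseudoRemainder (F.col_isHomogeneous 0)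
      (F.col_isHomogeneous 1) (F.col_isHomogeneous 2) (a := 0) (a' := 1) (by decide) hG
    rw [← F.toPoly_eq] at hd
    have h := (map_dvd (aeval (Sum.elim b b')) hd)
    rw [hF, zero_dvd_iff] at h
    simp only [map_sub, map_mul, map_add, map_pow, aeval_liftX, hG0, aeval_X, Sum.elim_inr,
      mul_zero, zero_sub, neg_eq_zero, mul_eq_zero, pow_eq_zero_iff', hb' 0, false_and,
      or_false] at h
    obtain ⟨rfl, rfl⟩ := hkey _ _ _ hR₀ hR₁ h
    refine ⟨d.2, (hmem _).mpr ?_⟩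
    rw [map_zero, zero_mul, zero_mul, add_zero, zero_mul, sub_zero] at hd
    exact (hd.mul_left (X (Sum.inr 1))).trans (dvd_of_eq (by ring))
  have h0 : liftX (F.col 0) ∈ Q.radical := by
    obtain ⟨R₀, R₁, hR₀, hR₁, hd⟩ := exists_dvd_pseudoRemainder (F.col_isHomogeneous 2)
      (F.col_isHomogeneous 1) (F.col_isHomogeneous 0) (a := 1) (a' := 0) (by decide) hG
    rw [show liftX (F.col 2) * X (Sum.inr 1) ^ 2 + liftX (F.col 1) *
      (X (Sum.inr 1) * X (Sum.inr 0)) + liftX (F.col 0) * X (Sum.inr 0) ^ 2 = F.toPoly by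
        rw [F.toPoly_eq]; ring] at hd
    have h := (map_dvd (aeval (Sum.elim b b')) hd)
    rw [hF, zero_dvd_iff] at h
    simp only [map_sub, map_mul, map_add, map_pow, aeval_liftX, hG0, aeval_X, Sum.elim_inr,
      mul_zero, zero_sub, neg_eq_zero, mul_eq_zero, pow_eq_zero_iff', hb' 1, false_and,
      or_false] at h
    obtain ⟨rfl, rfl⟩ := hkey _ _ _ hR₁ hR₀ (by rw [add_comm]; exact h)
    refine ⟨d.2, (hmem _).mpr ?_⟩
    rw [map_zero, zero_mul, zero_mul, add_zero, zero_mul, sub_zero] at hd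
    exact (hd.mul_left (X (Sum.inr 0))).trans (dvd_of_eq (by ring))
  have hFQ : F.toPoly ∈ Q.radical :=
    Ideal.le_radical ((hmem _).mpr (dvd_mul_right _ _))
  have h1 : liftX (F.col 1) * (X (Sum.inr 0) * X (Sum.inr 1)) ∈ Q.radical := by
    have := Q.radical.sub_mem (Q.radical.sub_mem hFQ (Q.radical.mul_mem_right
      (X (Sum.inr 0) ^ 2) h0)) (Q.radical.mul_mem_right (X (Sum.inr 1) ^ 2) h2)
    rw [F.toPoly_eq] at this
    convert this using 1
    ring
  have hall : Ideal.span {F.col 0, F.col 1, F.col 2} ≤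
      (Q.radical.colon {X (Sum.inr 0) * X (Sum.inr 1)}).comap liftX.toRingHom := by
    rw [Ideal.span_le]
    rintro _ (rfl | rfl | rfl)
    · exact Submodule.mem_colon_singleton.mpr (Q.radical.mul_mem_right _ h0)
    · exact Submodule.mem_colon_singleton.mpr h1
    · exact Submodule.mem_colon_singleton.mpr (Q.radical.mul_mem_right _ h2)
  -- Since the coefficients have no common zero with `x₀ ≠ 0`, a power of `x₀ y₀ y₁` multiplies `G`
  -- into `(F)`, and the variables do not divide `F`.
  obtain ⟨k, hk⟩ := hrad
  have hk' := Submodule.mem_colon_singleton.mp (Ideal.mem_comap.mp (hall hk))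
  have hx0 : X (Sum.inl 0) * (X (Sum.inr 0) * X (Sum.inr 1)) ∈ Q.radical := by
    rw [← Ideal.radical_idem]
    refine ⟨k + 1, ?_⟩
    rw [smul_eq_mul, AlgHom.toRingHom_eq_coe, RingHom.coe_coe, map_pow, rename_X] at hk'
    rw [mul_pow, pow_succ, pow_succ (X (Sum.inr 0) * X (Sum.inr 1) : BiRing K 2)]
    convert Q.radical.mul_mem_left
      (X (Sum.inl 0) * (X (Sum.inr 0) * X (Sum.inr 1)) ^ k) hk' using 1
    ring
  obtain ⟨m, hm⟩ := hx0
  have hfin := (hmem _).mp hm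
  refine dvd_of_dvd_prime_pow_mul (X_prime (σ := Fin 2 ⊕ Fin 2)) hx (k := m)
    (dvd_of_dvd_prime_pow_mul (X_prime (σ := Fin 2 ⊕ Fin 2)) hy₀ (k := m + 1)
      (dvd_of_dvd_prime_pow_mul (X_prime (σ := Fin 2 ⊕ Fin 2)) hy₁ (k := m + 1) ?_))
  convert hfin using 1
  ring

end Form22

end GenusOne

/-! ### The vanishing ideal of a curve in a product of projective planes -/

namespace GenusOne

open MvPolynomial

section Cube

variable {K : Type*} [Field K]

/-- The coefficient of `y_j` in the bilinear form `B_k`, a linear form in `x`. For fixed `k` these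
form a row of the `3 × 3` matrix of linear forms attached to the cube. -/
noncomputable def Cube.row (S : Cube K) (k j : Fin 3) : MvPolynomial (Fin 3) K :=
  ∑ i, C (S k i j) * X i

/-- The entry with index `j` of the cross product of the rows `k` and `l` of the matrix of linear
forms `S.row`; the indices `j + 1` and `j + 2` are taken modulo `3`. -/
noncomputable def Cube.minor (S : Cube K) (k l j : Fin 3) : MvPolynomial (Fin 3) K :=
  S.row k (j + 1) * S.row l (j + 2) - S.row k (j + 2) * S.row l (j + 1)

/-- The ternary cubic form in `x` that cuts out the image of the first projection. -/
noncomputable def Cube.detX (S : Cube K) : MvPolynomial (Fin 3) K :=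
  (Matrix.of fun k j => S.row k j).det

theorem Cube.toPoly_eq (S : Cube K) (k : Fin 3) :
    S.toPoly k = ∑ j, liftX (S.row k j) * X (Sum.inr j) := by
  simp only [Cube.toPoly, Cube.row, map_sum, map_mul, rename_C, rename_X, Finset.sum_mul]
  rw [Finset.sum_comm]
  exact Finset.sum_congr rfl fun j _ => Finset.sum_congr rfl fun i _ => by ring

theorem Cube.row_isHomogeneous (S : Cube K) (k j : Fin 3) : (S.row k j).IsHomogeneous 1 :=
  IsHomogeneous.sum _ _ _ fun _ _ => isHomogeneous_C_mul_X _ _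

theorem Cube.minor_isHomogeneous (S : Cube K) (k l j : Fin 3) : (S.minor k l j).IsHomogeneous 2 :=
  ((S.row_isHomogeneous _ _).mul (S.row_isHomogeneous _ _)).sub
    ((S.row_isHomogeneous _ _).mul (S.row_isHomogeneous _ _))

/-- On the zero set of the bilinear forms `y` is proportional to the cross product of two rows. -/
theorem Cube.minor_mul_sub_mem (S : Cube K) (k l i j : Fin 3) :
    liftX (S.minor k l i) * X (Sum.inr j) - liftX (S.minor k l j) * X (Sum.inr i) ∈
      Ideal.span (Set.range S.toPoly) := by
  have key : ∀ m : Fin 3, liftX (S.minor k l (m + 1)) * X (Sum.inr (m + 2)) -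
      liftX (S.minor k l (m + 2)) * X (Sum.inr (m + 1)) ∈ Ideal.span (Set.range S.toPoly) := by
    intro m
    have h : liftX (S.minor k l (m + 1)) * X (Sum.inr (m + 2)) -
        liftX (S.minor k l (m + 2)) * X (Sum.inr (m + 1)) =
        liftX (S.row l m) * S.toPoly k - liftX (S.row k m) * S.toPoly l := by
      rw [S.toPoly_eq, S.toPoly_eq]
      simp only [Cube.minor, map_sub, map_mul, Fin.sum_univ_three]
      fin_cases m <;> simp [show (1 : Fin 3) + 1 = 2 from rfl,
      show (1 : Fin 3) + 2 = 0 from rfl,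
        show (2 : Fin 3) + 1 = 0 from rfl,
      show (2 : Fin 3) + 2 = 1 from rfl] <;> ring
    rw [h]
    exact Ideal.sub_mem _ (Ideal.mul_mem_left _ _ (Ideal.subset_span ⟨k, rfl⟩))
      (Ideal.mul_mem_left _ _ (Ideal.subset_span ⟨l, rfl⟩))
  have hij : i = j ∨ ∃ m : Fin 3, i = m + 1 ∧ j = m + 2 ∨ i = m + 2 ∧ j = m + 1 := by
    revert i j
    decide
  rcases hij with rfl | ⟨m, ⟨rfl, rfl⟩ | ⟨rfl, rfl⟩⟩
  · rw [sub_self]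
    exact zero_mem _
  · exact key m
  · rw [← neg_sub]
    exact neg_mem (key m)

/-- Cramer's rule. -/
theorem Cube.detX_mul_mem (S : Cube K) (j : Fin 3) :
    liftX S.detX * X (Sum.inr j) ∈ Ideal.span (Set.range S.toPoly) := by
  have h : liftX S.detX * X (Sum.inr j) = liftX (S.minor 0 1 j) * S.toPoly 2 +
      liftX (S.minor 1 2 j) * S.toPoly 0 + liftX (S.minor 2 0 j) * S.toPoly 1 := by
    rw [S.toPoly_eq, S.toPoly_eq, S.toPoly_eq, Cube.detX, Matrix.det_fin_three]
    simp only [Cube.minor, map_sub, map_mul, map_add, Fin.sum_univ_three, Matrix.of_apply]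
    fin_cases j <;> simp [show (1 : Fin 3) + 1 = 2 from rfl,
      show (1 : Fin 3) + 2 = 0 from rfl,
        show (2 : Fin 3) + 1 = 0 from rfl,
      show (2 : Fin 3) + 2 = 1 from rfl] <;> ring
  rw [h]
  exact add_mem (add_mem (Ideal.mul_mem_left _ _ (Ideal.subset_span ⟨2, rfl⟩))
    (Ideal.mul_mem_left _ _ (Ideal.subset_span ⟨0, rfl⟩)))
    (Ideal.mul_mem_left _ _ (Ideal.subset_span ⟨1, rfl⟩))

/-- Modulo the bilinear forms, the variables `y` can be replaced by the cross product of two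
rows. -/
theorem Cube.minor_pow_mul_sub_mem (S : Cube K) (k l j : Fin 3) {d : ℕ × ℕ} {G : BiRing K 3}
    (hG : IsBihomogeneous G d) :
    (aeval (Sum.elim X (S.minor k l)) G).IsHomogeneous (d.1 + 2 * d.2) ∧
    liftX (S.minor k l j) ^ d.2 * G -
      X (Sum.inr j) ^ d.2 * liftX (aeval (Sum.elim X (S.minor k l)) G) ∈
        Ideal.span (Set.range S.toPoly) := by
  refine isBihomogeneous_induction (P := fun d e G =>
    (aeval (Sum.elim X (S.minor k l)) G).IsHomogeneous (d + 2 * e) ∧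
    liftX (S.minor k l j) ^ e * G -
      X (Sum.inr j) ^ e * liftX (aeval (Sum.elim X (S.minor k l)) G) ∈
        Ideal.span (Set.range S.toPoly)) ?_ ?_ ?_ ?_ ?_ hG
  · intro d e
    simp [isHomogeneous_zero]
  · rintro d e G H ⟨h1, h2⟩ ⟨h1', h2'⟩
    rw [map_add, map_add]
    refine ⟨h1.add h1', ?_⟩
    convert add_mem h2 h2' using 1
    ring
  · intro c
    simpa [liftX] using isHomogeneous_C _ _
  · rintro d e G i ⟨h1, h2⟩
    rw [map_mul, map_mul, aeval_X, Sum.elim_inl, rename_X]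
    constructor
    · have := h1.mul (isHomogeneous_X K i)
      rwa [show d + 2 * e + 1 = d + 1 + 2 * e by omega] at this
    · convert Ideal.mul_mem_right (X (Sum.inl i)) _ h2 using 1
      ring
  · rintro d e G i ⟨h1, h2⟩
    rw [map_mul, map_mul, aeval_X, Sum.elim_inr]
    constructor
    · have := h1.mul (S.minor_isHomogeneous k l i)
      rwa [show d + 2 * e + 2 = d + 2 * (e + 1) by omega] at this
    · convert add_mem (Ideal.mul_mem_right (liftX (S.minor k l j) * X (Sum.inr i)) _ h2)
        (Ideal.mul_mem_left _ (X (Sum.inr j) ^ e *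
          liftX (aeval (Sum.elim X (S.minor k l)) G)) (S.minor_mul_sub_mem k l j i)) using 1
      ring

variable {R : Type*} [CommRing R] [Algebra K R]

/-- A criterion for three bilinear forms to define a curve: the forms vanish on the curve, the
equation of the first projection of the curve is the determinant of the matrix of linear forms,
and this matrix has rank at least two at each point of the plane. -/
theorem Cube.vanishingIdealEq [IsDomain R] {S : Cube K} {b b' : Fin 3 → R} (hb : b 0 ≠ 0)
    (hb' : b' 0 ≠ 0)
    (hS : ∀ k, aeval (Sum.elim b b') (S.toPoly k) = 0)
    (hker : ∀ (e : ℕ) (H : MvPolynomial (Fin 3) K), H.IsHomogeneous e → aeval b H = 0 →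
      S.detX ∣ H)
    (hrad : ∀ i, (X i : MvPolynomial (Fin 3) K) ∈
      (Ideal.span (Set.range fun p : Fin 3 × Fin 3 × Fin 3 => S.minor p.1 p.2.1 p.2.2)).radical) :
    VanishingIdealEq b b' (Ideal.span (Set.range S.toPoly)) := by
  have hI : Ideal.span (Set.range S.toPoly) ≤ RingHom.ker (aeval (R := K) (Sum.elim b b')) := by
    rw [Ideal.span_le]
    rintro _ ⟨k, rfl⟩
    exact hS k
  refine .of_imp hb hb' hI fun d G hG hG0 => ?_
  set I := Ideal.span (Set.range S.toPoly) with hIdef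
  -- Substituting the cross product of two rows for `y` in `G` gives an equation of the plane curve.
  have hdvd : ∀ k l, S.detX ∣ aeval (Sum.elim X (S.minor k l)) G := by
    intro k l
    refine hker _ _ (S.minor_pow_mul_sub_mem k l 0 hG).1 ?_
    have := hI (S.minor_pow_mul_sub_mem k l 0 hG).2
    rw [RingHom.mem_ker, map_sub, map_mul, hG0, mul_zero, zero_sub, neg_eq_zero, map_mul, map_pow,
      aeval_X, Sum.elim_inr, aeval_liftX] at this
    exact (mul_eq_zero.mp this).resolve_left (pow_ne_zero _ hb')
  -- Hence minors times variables `y` multiply `G` into the ideal, up to powers.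
  have hmem : ∀ k l i j, liftX (S.minor k l i) * X (Sum.inr j) ∈
      ((I.colon {G}).radical : Ideal (BiRing K 3)) := by
    intro k l i j
    obtain ⟨Q, hQ⟩ := hdvd k l
    have h1 := (S.minor_pow_mul_sub_mem k l i hG).2
    rw [hQ, map_mul] at h1
    have h2 : liftX (S.minor k l i) ^ d.2 * X (Sum.inr j) * G ∈ I := by
      have := add_mem (Ideal.mul_mem_right (X (Sum.inr j)) _ h1) (Ideal.mul_mem_left _
        (X (Sum.inr i) ^ d.2 * liftX Q) (S.detX_mul_mem j))
      convert this using 1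
      ring
    refine ⟨d.2 + 1, Submodule.mem_colon_singleton.mpr ?_⟩
    rw [smul_eq_mul]
    convert Ideal.mul_mem_left _ (liftX (S.minor k l i) * X (Sum.inr j) ^ d.2) h2 using 1
    ring
  have hxy : ∀ i j, X (Sum.inl i) * X (Sum.inr j) ∈
      ((I.colon {G}).radical : Ideal (BiRing K 3)) := by
    intro i j
    have hall : Ideal.span (Set.range fun p : Fin 3 × Fin 3 × Fin 3 =>
        S.minor p.1 p.2.1 p.2.2) ≤
        ((I.colon {G}).radical.colon {X (Sum.inr j)}).comap liftX.toRingHom := by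
      rw [Ideal.span_le]
      rintro _ ⟨p, rfl⟩
      exact Submodule.mem_colon_singleton.mpr (hmem _ _ _ _)
    obtain ⟨k, hk⟩ := hrad i
    have hk' := Submodule.mem_colon_singleton.mp (Ideal.mem_comap.mp (hall hk))
    rw [smul_eq_mul, AlgHom.toRingHom_eq_coe, RingHom.coe_coe, map_pow, rename_X] at hk'
    rw [← Ideal.radical_idem]
    refine ⟨k + 1, ?_⟩
    convert Ideal.mul_mem_left _ (X (Sum.inl i) * X (Sum.inr j) ^ k) hk' using 1
    ring
  choose N hN using hxy
  refine ⟨∑ i, ∑ j, N i j, fun i j => ?_⟩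
  have hle : N i j ≤ ∑ i, ∑ j, N i j :=
    (Finset.single_le_sum (f := fun j => N i j) (fun _ _ => Nat.zero_le _)
      (Finset.mem_univ j)).trans (Finset.single_le_sum (f := fun i => ∑ j, N i j)
        (fun _ _ => Nat.zero_le _) (Finset.mem_univ i))
  exact Submodule.mem_colon_singleton.mp (Ideal.pow_mem_of_pow_mem _ (hN i j) hle)

/-- A polynomial in two variables, viewed as one in the first two of three variables. -/
noncomputable abbrev liftTwo : MvPolynomial (Fin 2) K →ₐ[K] MvPolynomial (Fin 3) K :=
  rename Fin.castSucc

/-- Pseudo-division by a ternary cubic with leading coefficient `u x₀` as a polynomial in `x₂`. -/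
theorem exists_dvd_pseudoRemainder_cubic {u : K} (hu : u ≠ 0) {A B : MvPolynomial (Fin 2) K}
    (hA : A.IsHomogeneous 2) (hB : B.IsHomogeneous 3) {e : ℕ} {H : MvPolynomial (Fin 3) K}
    (hH : H.IsHomogeneous e) : ∃ R₀ R₁ : MvPolynomial (Fin 2) K, R₀.IsHomogeneous (2 * e + 1) ∧
      R₁.IsHomogeneous (2 * e) ∧
      C u * X 0 * X 2 ^ 2 + liftTwo A * X 2 + liftTwo B ∣
        X 0 ^ (e + 1) * H - (liftTwo R₁ * X 2 + liftTwo R₀) := by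
  refine isWeightedHomogeneous_induction (w := (1 : Fin 3 → ℕ)) (P := fun e H =>
    ∃ R₀ R₁ : MvPolynomial (Fin 2) K, R₀.IsHomogeneous (2 * e + 1) ∧
      R₁.IsHomogeneous (2 * e) ∧
      C u * X 0 * X 2 ^ 2 + liftTwo A * X 2 + liftTwo B ∣
        X 0 ^ (e + 1) * H - (liftTwo R₁ * X 2 + liftTwo R₀)) ?_ ?_ ?_ ?_ hH
  · exact fun e => ⟨0, 0, isHomogeneous_zero _ _ _, isHomogeneous_zero _ _ _, by simp⟩
  · rintro e G H ⟨R₀, R₁, hR₀, hR₁, Q, hQ⟩ ⟨S₀, S₁, hS₀, hS₁, Q', hQ'⟩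
    refine ⟨R₀ + S₀, R₁ + S₁, hR₀.add hS₀, hR₁.add hS₁, Q + Q', ?_⟩
    rw [map_add, map_add]
    linear_combination hQ + hQ'
  · exact fun c => ⟨C c * X 0, 0, isHomogeneous_C_mul_X _ _, isHomogeneous_zero _ _ _, 0, by
      simp [liftTwo]; ring⟩
  · rintro e G i ⟨R₀, R₁, hR₀, hR₁, Q, hQ⟩
    rw [Pi.one_apply]
    have hlow : ∀ j : Fin 2, i = j.castSucc → ∃ R₀ R₁ : MvPolynomial (Fin 2) K,
        R₀.IsHomogeneous (2 * (e + 1) + 1) ∧ R₁.IsHomogeneous (2 * (e + 1)) ∧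
        C u * X 0 * X 2 ^ 2 + liftTwo A * X 2 + liftTwo B ∣
          X 0 ^ (e + 1 + 1) * (G * X i) - (liftTwo R₁ * X 2 + liftTwo R₀) := by
      rintro j rfl
      refine ⟨R₀ * (X 0 * X j), R₁ * (X 0 * X j),
        hR₀.mul ((isHomogeneous_X K 0).mul (isHomogeneous_X K j)),
        hR₁.mul ((isHomogeneous_X K 0).mul (isHomogeneous_X K j)), Q * (X 0 * X j.castSucc), ?_⟩
      simp only [map_mul, rename_X, Fin.castSucc_zero]
      linear_combination hQ * (X 0 * X j.castSucc)
    have hi : ∀ i : Fin 3, i = Fin.castSucc 0 ∨ i = Fin.castSucc 1 ∨ i = 2 := by decide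
    rcases hi i with rfl | rfl | rfl
    · exact hlow 0 rfl
    · exact hlow 1 rfl
    · refine ⟨C (-u⁻¹) * (R₁ * B), C (-u⁻¹) * (R₁ * A) + X 0 * R₀, ?_, ?_,
        Q * (X 0 * X 2) + C u⁻¹ * liftTwo R₁, ?_⟩
      · have := (hR₁.mul hB).C_mul (-u⁻¹)
        rwa [show 2 * e + 3 = 2 * (e + 1) + 1 by omega] at this
      · have h1 := (isHomogeneous_X K 0).mul hR₀
        rw [show 1 + (2 * e + 1) = 2 * e + 2 by omega] at h1
        exact ((hR₁.mul hA).C_mul (-u⁻¹)).add h1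
      · have hC : C u⁻¹ * C u = (1 : MvPolynomial (Fin 3) K) := by
          rw [← C_mul, inv_mul_cancel₀ hu, C_1]
        simp only [map_add, map_mul, map_neg, rename_X, rename_C, Fin.castSucc_zero]
        linear_combination hQ * (X 0 * X 2) - hC * (X 0 * X 2 ^ 2 * liftTwo R₁)

/-- If a cubic form vanishes at the functions `b₀, b₁, b₂`, is not divisible by the first
variable, and has leading coefficient `u x₀` with respect to `x₂`, then it divides each form
vanishing at `b`, provided that `b₀, b₁, b₂` satisfy no relation linear in `b₂`. -/
theorem cubic_dvd_of_aeval_eq_zero {u : K} (hu : u ≠ 0) {A B : MvPolynomial (Fin 2) K}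
    (hA : A.IsHomogeneous 2) (hB : B.IsHomogeneous 3) {T : MvPolynomial (Fin 3) K}
    (hT : T = C u * X 0 * X 2 ^ 2 + liftTwo A * X 2 + liftTwo B) {b : Fin 3 → R}
    (hT0 : aeval b T = 0) (hX : ¬ X 0 ∣ T)
    (hkey : ∀ (e : ℕ) (R₀ R₁ : MvPolynomial (Fin 2) K), R₀.IsHomogeneous (e + 1) →
      R₁.IsHomogeneous e →
      aeval (b ∘ Fin.castSucc) R₁ * b 2 + aeval (b ∘ Fin.castSucc) R₀ = 0 → R₀ = 0 ∧ R₁ = 0)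
    (e : ℕ) (H : MvPolynomial (Fin 3) K) (hH : H.IsHomogeneous e) (hH0 : aeval b H = 0) :
    T ∣ H := by
  obtain ⟨R₀, R₁, hR₀, hR₁, hd⟩ := exists_dvd_pseudoRemainder_cubic hu hA hB hH
  rw [← hT] at hd
  have h := map_dvd (aeval b) hd
  rw [hT0, zero_dvd_iff] at h
  simp only [map_sub, map_mul, map_add, hH0, mul_zero, zero_sub, neg_eq_zero, liftTwo,
    aeval_rename, aeval_X] at h
  obtain ⟨rfl, rfl⟩ := hkey _ _ _ hR₀ hR₁ h
  rw [map_zero, zero_mul, zero_add, sub_zero] at hd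
  exact dvd_of_dvd_prime_pow_mul (X_prime (σ := Fin 3)) hX hd

end Cube

end GenusOne

/-! ### Relations between the coordinate functions -/

namespace GenusOne

open MvPolynomial
open WeierstrassCurve WeierstrassCurve.Affine
open scoped Polynomial.Bivariate

section Relations

variable {K : Type*} [Field K] {R : Type*} [CommRing R] [Algebra K R]

/-- Two functions satisfy no relation whose terms have two consecutive degrees. -/
def NoShortRelation (u : Fin 2 → R) : Prop :=
  ∀ (e : ℕ) (A B : MvPolynomial (Fin 2) K), A.IsHomogeneous e → B.IsHomogeneous (e + 1) →
    aeval u A + aeval u B = 0 → A = 0 ∧ B = 0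

/-- The absence of short relations is invariant under linear substitutions. -/
theorem NoShortRelation.linear_change {u : Fin 2 → R} (hu : NoShortRelation (K := K) u)
    {a b c d : K} (h : a * d - b * c ≠ 0) : NoShortRelation (K := K)
      ![algebraMap K R a * u 0 + algebraMap K R b * u 1,
        algebraMap K R c * u 0 + algebraMap K R d * u 1] := by
  intro e A B hA hB hAB
  let L : Fin 2 → MvPolynomial (Fin 2) K := ![C a * X 0 + C b * X 1, C c * X 0 + C d * X 1]
  let L' : Fin 2 → MvPolynomial (Fin 2) K := ![C (a * d - b * c)⁻¹ * (C d * X 0 - C b * X 1),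
    C (a * d - b * c)⁻¹ * (C a * X 1 - C c * X 0)]
  have hL : ∀ i, (L i).IsHomogeneous 1 := by
    intro i
    fin_cases i
    · exact (isHomogeneous_C_mul_X _ _).add (isHomogeneous_C_mul_X _ _)
    · exact (isHomogeneous_C_mul_X _ _).add (isHomogeneous_C_mul_X _ _)
  have hLu : ∀ G : MvPolynomial (Fin 2) K, aeval ![algebraMap K R a * u 0 + algebraMap K R b * u 1,
        algebraMap K R c * u 0 + algebraMap K R d * u 1] G = aeval u (aeval L G) := by
    intro G
    rw [comp_aeval_apply]
    congr 2
    ext i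
    fin_cases i <;> simp [L]
  have hC : C (a * d - b * c)⁻¹ * (C a * C d - C b * C c) = (1 : MvPolynomial (Fin 2) K) := by
    rw [← C_mul, ← C_mul, ← C_sub, ← C_mul, inv_mul_cancel₀ h, C_1]
  have hinj : ∀ G : MvPolynomial (Fin 2) K, aeval L' (aeval L G) = G := by
    intro G
    rw [comp_aeval_apply]
    convert aeval_X_left_apply G using 3
    ext1 i
    fin_cases i
    · simp only [L, L', map_add, map_mul, aeval_X, aeval_C, algebraMap_eq, Matrix.cons_val,
        Fin.zero_eta, Fin.isValue]
      linear_combination X 0 * hC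
    · simp only [L, L', map_add, map_mul, aeval_X, aeval_C, algebraMap_eq, Matrix.cons_val,
        Fin.isValue, Fin.mk_one]
      linear_combination X 1 * hC
  rw [hLu, hLu] at hAB
  have hA' := hA.aeval L hL
  have hB' := hB.aeval L hL
  rw [one_mul] at hA' hB'
  obtain ⟨h1, h2⟩ := hu e _ _ hA' hB' hAB
  exact ⟨by rw [← hinj A, h1, map_zero], by rw [← hinj B, h2, map_zero]⟩

/-- Substitution of the expressions for `b'` gives a relation with terms of two consecutive
degrees, and hence a linear system for `R₀` and `R₁` whose determinant is nonzero by `hlq`. -/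
theorem NoShortRelation.eq_zero_of_bilinear {u : Fin 2 → R} (hu : NoShortRelation (K := K) u)
    {l q : Fin 2 → MvPolynomial (Fin 2) K} (hl : ∀ i, (l i).IsHomogeneous 1)
    (hq : ∀ i, (q i).IsHomogeneous 2) (hlq : l 0 * q 1 - l 1 * q 0 ≠ 0) {b' : Fin 2 → R}
    (hb' : ∀ i, b' i = aeval u (l i) + aeval u (q i)) {e : ℕ} {R₀ R₁ : MvPolynomial (Fin 2) K}
    (hR₀ : R₀.IsHomogeneous e) (hR₁ : R₁.IsHomogeneous e)
    (h : aeval u R₁ * b' 1 + aeval u R₀ * b' 0 = 0) : R₀ = 0 ∧ R₁ = 0 := by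
  obtain ⟨h1, h2⟩ := hu (e + 1) (R₁ * l 1 + R₀ * l 0) (R₁ * q 1 + R₀ * q 0)
    ((hR₁.mul (hl 1)).add (hR₀.mul (hl 0))) ((hR₁.mul (hq 1)).add (hR₀.mul (hq 0))) (by
      rw [← h, hb', hb']
      simp only [map_add, map_mul]
      ring)
  constructor
  · refine (mul_eq_zero.mp (?_ : R₀ * (l 0 * q 1 - l 1 * q 0) = 0)).resolve_right hlq
    linear_combination q 1 * h1 - l 1 * h2
  · refine (mul_eq_zero.mp (?_ : R₁ * (l 0 * q 1 - l 1 * q 0) = 0)).resolve_right hlq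
    linear_combination l 0 * h2 - q 0 * h1

/-- The analogue of `NoShortRelation.eq_zero_of_bilinear` for relations linear in one further
function. -/
theorem NoShortRelation.eq_zero_of_linear {u : Fin 2 → R} (hu : NoShortRelation (K := K) u)
    {l q : MvPolynomial (Fin 2) K} (hl : l.IsHomogeneous 1) (hq : q.IsHomogeneous 2) (hq0 : q ≠ 0)
    {t : R} (ht : t = aeval u l + aeval u q) {e : ℕ} {R₀ R₁ : MvPolynomial (Fin 2) K}
    (hR₀ : R₀.IsHomogeneous (e + 1)) (hR₁ : R₁.IsHomogeneous e)
    (h : aeval u R₁ * t + aeval u R₀ = 0) : R₀ = 0 ∧ R₁ = 0 := by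
  obtain ⟨h1, h2⟩ := hu (e + 1) (R₁ * l + R₀) (R₁ * q) ((hR₁.mul hl).add hR₀) (hR₁.mul hq) (by
      rw [← h, ht]
      simp only [map_add, map_mul]
      ring)
  have h3 := (mul_eq_zero.mp h2).resolve_right hq0
  refine ⟨?_, h3⟩
  rwa [h3, zero_mul, zero_add] at h1

/-- A homogeneous form in two variables is determined by its dehomogenisation. -/
theorem eq_zero_of_aeval_one_X {e : ℕ} {G : MvPolynomial (Fin 2) K} (hG : G.IsHomogeneous e)
    (h : aeval ![1, (Polynomial.X : Polynomial K)] G = 0) : G = 0 := by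
  let L := FractionRing (MvPolynomial (Fin 2) K)
  have hinj : Function.Injective (algebraMap (MvPolynomial (Fin 2) K) L) :=
    IsFractionRing.injective _ _
  let a : L := algebraMap (MvPolynomial (Fin 2) K) L (X 0)
  let b : L := algebraMap (MvPolynomial (Fin 2) K) L (X 1)
  have ha : a ≠ 0 := (map_ne_zero_iff _ hinj).mpr (X_ne_zero 0)
  have h1 := aeval_smul_of_isHomogeneous hG a ![1, b / a]
  have h2 : aeval ![1, b / a] G = 0 := by
    have := congrArg (Polynomial.aeval (b / a)) h
    rw [map_zero, comp_aeval_apply] at this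
    rw [← this]
    congr 2
    ext i
    fin_cases i <;> simp
  have h3 : (fun i => a * ![1, b / a] i) = algebraMap (MvPolynomial (Fin 2) K) L ∘ X := by
    ext i
    fin_cases i
    · simp [a]
    · change a * (b / a) = b
      rw [mul_div_assoc', mul_div_cancel_left₀ _ ha]
  rw [h2, mul_zero, h3] at h1
  have h4 := aeval_algebraMap_apply L (X : Fin 2 → MvPolynomial (Fin 2) K) G
  rw [aeval_X_left_apply] at h4
  exact hinj (by rw [map_zero, ← h1, ← h4])

end Relations

section Curve

variable {K : Type*} [Field K] {W : WeierstrassCurve K}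

/-- Let `z` and `w` be the translates of the coordinate functions that vanish at a nonsingular
point of the curve. As a polynomial in `z` and `w`, the equation of the curve has no constant
term, a nonzero linear part and a nonzero cubic part. So the lowest and the highest degree of a
term of a nonzero multiple of the equation differ by at least two. -/
theorem noShortRelation_class {p q : K} (h : W.toAffine.Nonsingular p q) :
    NoShortRelation (K := K)
      ![CoordinateRing.XClass W.toAffine p, CoordinateRing.YClass W.toAffine (Polynomial.C q)] := by
  intro e A B hA hB hAB
  -- The degree in `z` and `w` is tracked by a variable `T`: put `x = p + T z` and `y = q + T w`.
  let S := MvPolynomial (Fin 2) K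
  let T : Polynomial S := Polynomial.X
  let ψ₀ : Polynomial K →ₐ[K] Polynomial S :=
    Polynomial.aeval (algebraMap K (Polynomial S) p + T * Polynomial.C (X 0))
  let ψ : K[X][Y] →ₐ[K] Polynomial S :=
    { Polynomial.eval₂RingHom ψ₀.toRingHom (algebraMap K (Polynomial S) q +
        T * Polynomial.C (X 1)) with
      commutes' := fun r => by
        change Polynomial.eval₂ ψ₀.toRingHom _ (Polynomial.C (Polynomial.C r)) = _
        simp [ψ₀] }
  let μ : K[X][Y] →ₐ[K] W.toAffine.CoordinateRing :=
    { CoordinateRing.mk W.toAffine with commutes' := fun r => rfl }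
  have hψC : ∀ r, ψ (Polynomial.C r) = ψ₀ r := fun r => Polynomial.eval₂_C _ _
  have hψY : ψ Y = algebraMap K (Polynomial S) q + T * Polynomial.C (X 1) := Polynomial.eval₂_X _ _
  have hψ₀C : ∀ r, ψ₀ (Polynomial.C r) = algebraMap K (Polynomial S) r := Polynomial.aeval_C _
  have hψ₀X : ψ₀ Polynomial.X = algebraMap K (Polynomial S) p + T * Polynomial.C (X 0) :=
    Polynomial.aeval_X _
  let g : Fin 2 → K[X][Y] := ![Polynomial.C (Polynomial.X - Polynomial.C p),
    Y - Polynomial.C (Polynomial.C q)]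
  have hμ : ∀ G : MvPolynomial (Fin 2) K, μ (aeval g G) =
      aeval ![CoordinateRing.XClass W.toAffine p,
        CoordinateRing.YClass W.toAffine (Polynomial.C q)] G := by
    intro G
    rw [comp_aeval_apply]
    congr 2
    ext i
    fin_cases i <;> rfl
  have hψ : ∀ (k : ℕ) (G : MvPolynomial (Fin 2) K), G.IsHomogeneous k →
      ψ (aeval g G) = T ^ k * Polynomial.C G := by
    intro k G hG
    have hTC : aeval (fun i => (Polynomial.C (X i) : Polynomial S)) G = Polynomial.C G := by
      have := aeval_algebraMap_apply (Polynomial S) (X : Fin 2 → S) G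
      rw [aeval_X_left_apply] at this
      exact this
    rw [comp_aeval_apply, ← hTC, ← aeval_smul_of_isHomogeneous hG]
    congr 2
    ext1 i
    fin_cases i
    · change ψ (Polynomial.C (Polynomial.X - Polynomial.C p)) = T * Polynomial.C (X 0)
      rw [hψC, map_sub, hψ₀X, hψ₀C, add_sub_cancel_left]
    · change ψ (Y - Polynomial.C (Polynomial.C q)) = T * Polynomial.C (X 1)
      rw [map_sub, hψY, hψC, hψ₀C, add_sub_cancel_left]
  have hdvd : W.toAffine.polynomial ∣ aeval g A + aeval g B := by
    rw [← AdjoinRoot.mk_eq_zero]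
    have h1 : μ (aeval g A + aeval g B) = 0 := by rw [map_add, hμ, hμ, hAB]
    exact h1
  have hdvd' := map_dvd ψ hdvd
  rw [map_add, hψ e A hA, hψ (e + 1) B hB] at hdvd'
  -- The expansion of the Weierstrass equation at the point.
  set w₁ : S := C (W.a₁ * q - (3 * p ^ 2 + 2 * W.a₂ * p + W.a₄)) * X 0 +
    C (2 * q + W.a₁ * p + W.a₃) * X 1 with hw₁
  set w₂ : S := X 1 ^ 2 + C W.a₁ * X 0 * X 1 - C (3 * p + W.a₂) * X 0 ^ 2 with hw₂
  set w₃ : S := -X 0 ^ 3 with hw₃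
  have hE := (equation_iff' ..).mp h.1
  have hW : ψ W.toAffine.polynomial = Polynomial.X * (Polynomial.C w₁ +
      Polynomial.X * Polynomial.C w₂ + Polynomial.X ^ 2 * Polynomial.C w₃) := by
    rw [WeierstrassCurve.Affine.polynomial]
    simp only [map_add, map_sub, map_mul, map_pow, map_neg, hψC, hψY, hψ₀C, hψ₀X, hw₁, hw₂, hw₃, T,
      map_ofNat]
    have hc : ∀ r : K, (algebraMap K (Polynomial S) r) = Polynomial.C (C r) := fun r => rfl
    have hE' := congrArg (algebraMap K (Polynomial S)) hE
    simp only [map_add, map_sub, map_mul, map_pow, map_zero, hc] at hE' ⊢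
    linear_combination hE'
  have hw₁0 : w₁ ≠ 0 := by
    intro h0
    have h1 := congrArg (eval ![1, 0]) h0
    have h2 := congrArg (eval ![0, 1]) h0
    simp [hw₁] at h1 h2
    rcases ((nonsingular_iff' ..).mp h).2 with h3 | h3
    · exact h3 h1
    · exact h3 h2
  set V : Polynomial S := Polynomial.C w₁ + Polynomial.X * Polynomial.C w₂ +
    Polynomial.X ^ 2 * Polynomial.C w₃ with hV
  rw [hW] at hdvd'
  have hw₃0 : w₃ ≠ 0 := neg_ne_zero.mpr (pow_ne_zero _ (X_ne_zero 0))
  have hV2 : V.coeff 2 ≠ 0 := by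
    rw [hV]
    simpa [Polynomial.coeff_X, Polynomial.coeff_C] using hw₃0
  have hV0 : V.coeff 0 ≠ 0 := by
    rw [hV]
    simpa using hw₁0
  have hVne : V ≠ 0 := fun h0 => hV0 (by rw [h0, Polynomial.coeff_zero])
  have hVdeg : 2 ≤ V.natDegree := Polynomial.le_natDegree_of_ne_zero hV2
  have hVtr : V.natTrailingDegree = 0 :=
    Polynomial.natTrailingDegree_eq_zero.mpr (Or.inr hV0)
  obtain ⟨Q, hQ⟩ := hdvd'
  have hP : T ^ e * Polynomial.C A + T ^ (e + 1) * Polynomial.C B =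
      Polynomial.X ^ e * (Polynomial.C A + Polynomial.X * Polynomial.C B) := by
    simp only [T]
    ring
  rw [hP] at hQ
  have hzero : Polynomial.C A + Polynomial.X * Polynomial.C B = 0 := by
    by_contra hne
    have hQ0 : Q ≠ 0 := by
      rintro rfl
      rw [mul_zero] at hQ
      exact mul_ne_zero (pow_ne_zero _ Polynomial.X_ne_zero) hne hQ
    have hd := congrArg Polynomial.natDegree hQ
    have ht := congrArg Polynomial.natTrailingDegree hQ
    have hle : (Polynomial.C A + Polynomial.X * Polynomial.C B).natDegree ≤ 1 := by
      compute_degree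
    rw [Polynomial.natDegree_mul (pow_ne_zero _ Polynomial.X_ne_zero) hne,
      Polynomial.natDegree_mul (mul_ne_zero Polynomial.X_ne_zero hVne) hQ0,
      Polynomial.natDegree_mul Polynomial.X_ne_zero hVne, Polynomial.natDegree_X_pow,
      Polynomial.natDegree_X] at hd
    rw [Polynomial.natTrailingDegree_mul (pow_ne_zero _ Polynomial.X_ne_zero) hne,
      Polynomial.natTrailingDegree_mul (mul_ne_zero Polynomial.X_ne_zero hVne) hQ0,
      Polynomial.natTrailingDegree_mul Polynomial.X_ne_zero hVne,
      Polynomial.natTrailingDegree_X_pow, Polynomial.natTrailingDegree_X, hVtr] at ht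
    have := Polynomial.natTrailingDegree_le_natDegree Q
    omega
  have h0 := congrArg (Polynomial.coeff · 0) hzero
  have h1 := congrArg (Polynomial.coeff · 1) hzero
  simp only [Polynomial.coeff_add, Polynomial.coeff_C_zero, Polynomial.coeff_zero,
    Polynomial.mul_coeff_zero, Polynomial.coeff_X_zero, zero_mul, add_zero] at h0
  simp only [Polynomial.coeff_add, Polynomial.coeff_C_succ, Polynomial.coeff_zero,
    Polynomial.coeff_X_mul, Polynomial.coeff_C_zero, zero_add] at h1
  exact ⟨h0, h1⟩

theorem aeval_one_coordX (G : MvPolynomial (Fin 2) K) : aeval ![1, coordX W] G =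
    Polynomial.aeval (coordX W) (aeval ![1, (Polynomial.X : Polynomial K)] G) := by
  rw [comp_aeval_apply]
  congr 2
  ext i
  fin_cases i <;> simp

/-- There are no relations linear in `y` whose coefficients are forms in `1, x`; this is the
analogue of the absence of short relations for the point at infinity. -/
theorem eq_zero_of_aeval_one_coordX {e e' : ℕ} {R₀ R₁ : MvPolynomial (Fin 2) K}
    (hR₀ : R₀.IsHomogeneous e) (hR₁ : R₁.IsHomogeneous e')
    (h : aeval ![1, coordX W] R₁ * coordY W + aeval ![1, coordX W] R₀ = 0) : R₀ = 0 ∧ R₁ = 0 := by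
  rw [aeval_one_coordX, aeval_one_coordX, add_comm, ← smul_basis_eq] at h
  obtain ⟨h1, h2⟩ := CoordinateRing.smul_basis_eq_zero h
  exact ⟨eq_zero_of_aeval_one_X hR₀ h1, eq_zero_of_aeval_one_X hR₁ h2⟩

end Curve

end GenusOne

/-! ### Explicit bases of Riemann-Roch spaces -/

namespace GenusOne

open Polynomial
open scoped Polynomial.Bivariate
open WeierstrassCurve WeierstrassCurve.Affine

section LinearSystems

variable {K : Type*} [Field K] {W : WeierstrassCurve K}

/-- Linear independence can be tested on coefficients, as `1, x, y, x², x y` are independent. -/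
theorem linearIndependent_lowDegree {n : ℕ} (a b c d e : Fin n → K)
    (h : ∀ g : Fin n → K, ∑ i, g i * a i = 0 → ∑ i, g i * b i = 0 → ∑ i, g i * c i = 0 →
      ∑ i, g i * d i = 0 → ∑ i, g i * e i = 0 → ∀ i, g i = 0) :
    LinearIndependent K (fun i => lowDegree W (a i) (b i) (c i) (d i) (e i)) := by
  rw [Fintype.linearIndependent_iff]
  intro g hg
  have h1 : lowDegree W (∑ i, g i * a i) (∑ i, g i * b i) (∑ i, g i * c i) (∑ i, g i * d i)
      (∑ i, g i * e i) = 0 := by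
    rw [← hg]
    simp only [lowDegree, Algebra.smul_def, map_sum, map_mul, Finset.sum_mul, mul_add,
      Finset.sum_add_distrib, mul_assoc]
  obtain ⟨h1, h2, h3, h4, h5⟩ := lowDegree_eq_zero h1
  exact h g h1 h2 h3 h4 h5

/-- The point `-P = (0, -a₃)` is on the curve. -/
theorem negPoint_equation (h₆ : W.a₆ = 0) : W.toAffine.Equation 0 (-W.a₃) := by
  rw [equation_iff]
  change (-W.a₃) ^ 2 + W.a₁ * 0 * -W.a₃ + W.a₃ * -W.a₃ = 0 ^ 3 + W.a₂ * 0 ^ 2 + W.a₄ * 0 + W.a₆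
  rw [h₆]
  ring

/-- The function `γ (y - q) - δ (x - p)` vanishes at `(p, q)` and at `(0, -a₃)`, counted with
multiplicity if the points coincide. -/
theorem line_mem {p q α β γ δ : K} (h₆ : W.a₆ = 0) (h : W.toAffine.Equation p q)
    (h11 : α * γ = p) (h12 : β * γ = q) (h21 : α * δ = q + W.a₃)
    (h22 : β * δ = p ^ 2 + W.a₂ * p + W.a₄ - W.a₁ * q) (hαβ : α = 1 ∨ β = 1) :
    lowDegree W (δ * p - γ * q) (-δ) γ 0 0 ∈ CoordinateRing.XYIdeal W.toAffine p (C q) *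
      CoordinateRing.XYIdeal W.toAffine 0 (C (-W.a₃)) := by
  have hz := lowDegree_mem_XYIdeal h (-p) 1 0 0 0
  have hw := lowDegree_mem_XYIdeal h (-q) 0 1 0 0
  have hx := lowDegree_mem_XYIdeal (negPoint_equation h₆) 0 1 0 0 0
  have hy := lowDegree_mem_XYIdeal (negPoint_equation h₆) W.a₃ 0 1 0 0
  replace hz := hz.mpr (by ring)
  replace hw := hw.mpr (by ring)
  replace hx := hx.mpr (by ring)
  replace hy := hy.mpr (by ring)
  have hE := coord_equation W
  have hE' := congrArg (algebraMap K W.toAffine.CoordinateRing) ((equation_iff ..).mp h)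
  have e11 := congrArg (algebraMap K W.toAffine.CoordinateRing) h11
  have e12 := congrArg (algebraMap K W.toAffine.CoordinateRing) h12
  have e21 := congrArg (algebraMap K W.toAffine.CoordinateRing) h21
  have e22 := congrArg (algebraMap K W.toAffine.CoordinateRing) h22
  rw [h₆, map_zero, add_zero] at hE
  simp only [lowDegree, map_neg, map_one, map_zero, map_add, map_mul, map_pow, map_sub, h₆] at *
  -- With `z = x - p` and `w = y - q`, the function `γ w - δ z` is `w x - z (y + a₃)` if `α = 1`,
  -- and `z x (x + p + a₂) - a₁ w x - w (y + a₃)` if `β = 1`.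
  rcases hαβ with rfl | rfl
  · convert sub_mem (Ideal.mul_mem_mul hw hx) (Ideal.mul_mem_mul hz hy) using 1
    simp only [map_one] at *
    linear_combination (coordY W - algebraMap K _ q) * e11 - (coordX W - algebraMap K _ p) * e21
  · have h1 := Ideal.mul_mem_mul hz hx
    have h2 := Ideal.mul_mem_mul hw hx
    have h3 := Ideal.mul_mem_mul hw hy
    convert sub_mem (sub_mem (Ideal.mul_mem_right (coordX W + algebraMap K _ p +
      algebraMap K _ W.a₂) _ h1) (Ideal.mul_mem_right (algebraMap K _ W.a₁) _ h2)) h3 using 1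
    simp only [map_one] at *
    linear_combination (coordY W - algebraMap K _ q) * e12 -
      (coordX W - algebraMap K _ p) * e22 + hE - hE'

variable [W.IsElliptic]

/-- The equality of classes means that `D ∼ (n + 1) ∞ - (p, q)`. Independent functions with a pole
of order at most `n + 1` at infinity which vanish at `(p, q)` give a basis of `L(D)`. -/
theorem exists_basis_of_point {D : Divisor W} {n : ℕ} (hn : degree W D = n) {p q : K}
    (h : W.toAffine.Equation p q) (hD : idealClass (XYIdeal_ne_bot (W := W) p q) = -divisorClass D)
    {a b c d e : Fin n → K} (hp : ∀ i, a i + b i * p + c i * q + d i * p ^ 2 + e i * (p * q) = 0)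
    (hli : LinearIndependent K (fun i => lowDegree W (a i) (b i) (c i) (d i) (e i)))
    (hb : ∀ i, b i = 0 ∨ 2 ≤ n + 1) (hc : ∀ i, c i = 0 ∨ 3 ≤ n + 1)
    (hd : ∀ i, d i = 0 ∨ 4 ≤ n + 1) (he : ∀ i, e i = 0 ∨ 5 ≤ n + 1) :
    ∃ w : W.toAffine.FunctionField, w ≠ 0 ∧ IsLinearSystemBasis W D
      (fun i => w * algebraMap _ _ (lowDegree W (a i) (b i) (c i) (d i) (e i))) :=
  exists_isLinearSystemBasis hn _ hD (finrank_quotient_XYIdeal h)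
    (finrank_boundedPole_XYIdeal h n) hli fun i =>
      lowDegree_mem_boundedPole ((lowDegree_mem_XYIdeal h _ _ _ _ _).mpr (hp i)) (hb i) (hc i)
        (hd i) (he i)

/-- The analogue of `exists_basis_of_point` for `D ∼ n ∞`. -/
theorem exists_basis_of_top {D : Divisor W} {n : ℕ} (hn : degree W D = n) (hn1 : 1 ≤ n)
    (hD : divisorClass D = 0) {a b c d e : Fin n → K}
    (hli : LinearIndependent K (fun i => lowDegree W (a i) (b i) (c i) (d i) (e i)))
    (hb : ∀ i, b i = 0 ∨ 2 ≤ n) (hc : ∀ i, c i = 0 ∨ 3 ≤ n)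
    (hd : ∀ i, d i = 0 ∨ 4 ≤ n) (he : ∀ i, e i = 0 ∨ 5 ≤ n) :
    ∃ w : W.toAffine.FunctionField, w ≠ 0 ∧ IsLinearSystemBasis W D
      (fun i => w * algebraMap _ _ (lowDegree W (a i) (b i) (c i) (d i) (e i))) :=
  exists_isLinearSystemBasis hn top_ne_bot (by rw [hD, neg_zero, idealClass_top])
    finrank_quotient_top (finrank_boundedPole_top hn1) hli fun i =>
      lowDegree_mem_boundedPole trivial (hb i) (hc i) (hd i) (he i)

/-- The analogue of `exists_basis_of_point` for `D ∼ (n + 2) ∞ - (p, q) - (p', q')`. -/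
theorem exists_basis_of_pair {D : Divisor W} {n : ℕ} (hn : degree W D = n) (hn1 : 1 ≤ n)
    {p q p' q' : K} (h : W.toAffine.Equation p q) (h' : W.toAffine.Equation p' q')
    (hD : idealClass (XYIdeal_ne_bot (W := W) p q) + idealClass (XYIdeal_ne_bot (W := W) p' q') =
      -divisorClass D) {a b c d e : Fin n → K}
    (hmem : ∀ i, lowDegree W (a i) (b i) (c i) (d i) (e i) ∈
      CoordinateRing.XYIdeal W.toAffine p (C q) * CoordinateRing.XYIdeal W.toAffine p' (C q'))
    (hli : LinearIndependent K (fun i => lowDegree W (a i) (b i) (c i) (d i) (e i)))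
    (hb : ∀ i, b i = 0 ∨ 2 ≤ n + 2) (hc : ∀ i, c i = 0 ∨ 3 ≤ n + 2)
    (hd : ∀ i, d i = 0 ∨ 4 ≤ n + 2) (he : ∀ i, e i = 0 ∨ 5 ≤ n + 2) :
    ∃ w : W.toAffine.FunctionField, w ≠ 0 ∧ IsLinearSystemBasis W D
      (fun i => w * algebraMap _ _ (lowDegree W (a i) (b i) (c i) (d i) (e i))) :=
  exists_isLinearSystemBasis hn (mul_ne_zero (XYIdeal_ne_bot p q) (XYIdeal_ne_bot p' q'))
    (by rw [idealClass_mul (XYIdeal_ne_bot p q) (XYIdeal_ne_bot p' q'), hD])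
    (by rw [finrank_quotient_mul_coordinateRing (XYIdeal_ne_bot p q) (XYIdeal_ne_bot p' q'),
      finrank_quotient_XYIdeal h, finrank_quotient_XYIdeal h'])
    (finrank_boundedPole_XYIdeal_mul h h' hn1) hli fun i =>
      lowDegree_mem_boundedPole (hmem i) (hb i) (hc i) (hd i) (he i)

end LinearSystems

end GenusOne

/-! ### The forms attached to an integral point -/

namespace GenusOne

open MvPolynomial
open WeierstrassCurve WeierstrassCurve.Affine

section Variables

variable {K : Type*} [Field K] {R : Type*} [CommRing R] [Algebra K R]

theorem Form22.aeval_toPoly (F : Form22 K) (v : Fin 2 ⊕ Fin 2 → R) : aeval v F.toPoly =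
    ∑ i, ∑ j, algebraMap K R (F i j) *
      (![v (Sum.inl 0) ^ 2, v (Sum.inl 0) * v (Sum.inl 1), v (Sum.inl 1) ^ 2] i *
      ![v (Sum.inr 0) ^ 2, v (Sum.inr 0) * v (Sum.inr 1), v (Sum.inr 1) ^ 2] j) := by
  simp [Form22.toPoly, Fin.sum_univ_three]

/-- The variables `x₀`, `y₀` and `y₁` do not divide the form if a suitable row or column of its
matrix is nonzero. -/
theorem Form22.not_X_dvd_toPoly {F : Form22 K} :
    ((∃ j, F 2 j ≠ 0) → ¬ X (Sum.inl 0) ∣ F.toPoly) ∧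
    ((∃ i, F i 2 ≠ 0) → ¬ X (Sum.inr 0) ∣ F.toPoly) ∧
    ((∃ i, F i 0 ≠ 0) → ¬ X (Sum.inr 1) ∣ F.toPoly) := by
  refine ⟨fun ⟨j, hj⟩ => F.not_X_dvd (Sum.elim ![0, 1] ![1, Polynomial.X]) _ rfl fun h => hj ?_,
    fun ⟨i, hi⟩ => F.not_X_dvd (Sum.elim ![1, Polynomial.X] ![0, 1]) _ rfl fun h => hi ?_,
    fun ⟨i, hi⟩ => F.not_X_dvd (Sum.elim ![1, Polynomial.X] ![1, 0]) _ rfl fun h => hi ?_⟩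
  · have h' := congrArg (Polynomial.coeff · j) h
    rw [F.aeval_toPoly] at h'
    simp [Fin.sum_univ_three] at h'
    fin_cases j <;> simpa [Polynomial.coeff_X, Polynomial.coeff_C] using h'
  · have h' := congrArg (Polynomial.coeff · i) h
    rw [F.aeval_toPoly] at h'
    simp [Fin.sum_univ_three] at h'
    fin_cases i <;> simpa [Polynomial.coeff_X, Polynomial.coeff_C] using h'
  · have h' := congrArg (Polynomial.coeff · i) h
    rw [F.aeval_toPoly] at h'
    simp [Fin.sum_univ_three] at h'
    fin_cases i <;> simpa [Polynomial.coeff_X, Polynomial.coeff_C] using h'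

theorem vec_comp_castSucc {A : Type*} (a b c : A) : ![a, b, c] ∘ Fin.castSucc = ![a, b] := by
  ext i
  fin_cases i <;> rfl

theorem mem_of_eq_of_mem {A : Type*} [CommRing A] {I : Ideal A} {a b : A} (h : a = b) (hb : b ∈ I) :
    a ∈ I := h ▸ hb

theorem Form22.col_mem (F : Form22 K) (j : Fin 3) :
    F.col j ∈ Ideal.span {F.col 0, F.col 1, F.col 2} := by
  apply Ideal.subset_span
  fin_cases j <;> simp

theorem Cube.minor_mem (S : Cube K) (k l j : Fin 3) : S.minor k l j ∈
    Ideal.span (Set.range fun p : Fin 3 × Fin 3 × Fin 3 => S.minor p.1 p.2.1 p.2.2) :=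
  Ideal.subset_span ⟨(k, l, j), rfl⟩

theorem Cube.aeval_toPoly (S : Cube K) (k : Fin 3) (v : Fin 3 ⊕ Fin 3 → R) :
    aeval v (S.toPoly k) = ∑ i, ∑ j, algebraMap K R (S k i j) *
      (v (Sum.inl i) * v (Sum.inr j)) := by
  simp [Cube.toPoly, Fin.sum_univ_three]

/-- The determinant vanishes on the projection to the first factor. -/
theorem Cube.aeval_detX [IsDomain R] {S : Cube K} {b b' : Fin 3 → R} (hb' : b' 0 ≠ 0)
    (hS : ∀ k, aeval (Sum.elim b b') (S.toPoly k) = 0) : aeval b S.detX = 0 := by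
  have hI : Ideal.span (Set.range S.toPoly) ≤ RingHom.ker (aeval (R := K) (Sum.elim b b')) := by
    rw [Ideal.span_le]
    rintro _ ⟨k, rfl⟩
    exact hS k
  have := hI (S.detX_mul_mem 0)
  rw [RingHom.mem_ker, map_mul, aeval_liftX, aeval_X] at this
  exact (mul_eq_zero.mp this).resolve_right hb'

/-- Membership of a nonzero constant multiple of a power is enough for membership in the
radical. -/
theorem mem_radical_of_C_mul_pow_mem {σ : Type*} {I : Ideal (MvPolynomial σ K)}
    {f : MvPolynomial σ K} {c : K} (hc : c ≠ 0) {k : ℕ} (h : C c * f ^ k ∈ I) : f ∈ I.radical := by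
  refine ⟨k, ?_⟩
  have := I.mul_mem_left (C c⁻¹) h
  rwa [← mul_assoc, ← C_mul, inv_mul_cancel₀ hc, C_1, one_mul] at this

end Variables

section IntegralPoint

variable {K : Type*} [Field K] (W : WeierstrassCurve K)

/-- A factorisation of the matrix `(p, q; q + a₃, p² + a₂ p + a₄ - a₁ q)` as a product of a column
`(γ, δ)` and a row `(α, β)` one of whose entries is `1`. If `a₆ = 0`, the determinant of the
matrix vanishes if and only if `(p, q)` lies on the curve. -/
structure IsFactorization (p q α β γ δ : K) : Prop where
  eq₁₁ : α * γ = p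
  eq₁₂ : β * γ = q
  eq₂₁ : α * δ = q + W.a₃
  eq₂₂ : β * δ = p ^ 2 + W.a₂ * p + W.a₄ - W.a₁ * q
  eq_one : α = 1 ∨ β = 1

/-- The `(2,2)`-form attached to a factorisation. With `z = x - p`, `w = y - q` and
`ℓ = γ w - δ z` it vanishes at `(z, w; ℓ, -x z)`. -/
def factorForm (p α β γ δ : K) : Form22 K :=
  !![-β, -(W.a₂ + p), -δ; α, W.a₁, γ; 0, 1, 0]

/-- The cube attached to a factorisation, with bilinear forms `x₂ y₀ - δ x₀ y₁ + γ x₀ y₂`,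
`x₁ y₁ - x₀ y₂` and `(α x₁ - β x₀) y₀ + (a₁ x₁ - (a₂ + p) x₀ - x₂) y₁ + x₁ y₂`. They vanish at
`(z, w, x z; ℓ, -x z, -x w)`, where `z = x - p`, `w = y - q` and `ℓ = γ w - δ z`. -/
def factorCube (p α β γ δ : K) : Cube K :=
  ![!![0, -δ, γ; 0, 0, 0; 1, 0, 0], !![0, 0, -1; 0, 1, 0; 0, 0, 0],
    !![-β, -(W.a₂ + p), 0; α, W.a₁, 1; 0, -1, 0]]

variable {W} {p q α β γ δ : K}

theorem factorForm_disc (hf : IsFactorization W p q α β γ δ) (h₆ : W.a₆ = 0) :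
    (factorForm W p α β γ δ).disc = W.Δ := by
  -- This is the Weierstrass equation of `W` after the change of sign of `y`.
  have h : (factorForm W p α β γ δ).weierstrass = ⟨-W.a₁, W.a₂, -W.a₃, W.a₄, 0⟩ := by
    ext
    · simp [Form22.weierstrass, factorForm]
    · simp [Form22.weierstrass, factorForm]
      linear_combination -hf.eq₁₁
    · simp [Form22.weierstrass, factorForm]
      linear_combination hf.eq₁₂ - hf.eq₂₁
    · simp [Form22.weierstrass, factorForm]
      linear_combination hf.eq₂₂ + W.a₁ * hf.eq₁₂ - (W.a₂ + p) * hf.eq₁₁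
    · simp [Form22.weierstrass, factorForm]
  rw [Form22.disc, h]
  simp only [WeierstrassCurve.Δ, WeierstrassCurve.b₂, WeierstrassCurve.b₄, WeierstrassCurve.b₆,
    WeierstrassCurve.b₈, h₆]
  ring

theorem factorCube_disc (hf : IsFactorization W p q α β γ δ) (h₆ : W.a₆ = 0) :
    (factorCube W p α β γ δ).disc = W.Δ := by
  have hc : (factorCube W p α β γ δ).cubic = ⟨0, 0, -β, -γ, -(δ + W.a₁ * γ), 1, 0,
      -(W.a₂ + p) - α * γ, α, W.a₁⟩ := by
    simp only [Cube.cubic, Matrix.det_fin_three, Matrix.adjugate_fin_three, Matrix.trace_fin_three,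
      Matrix.mul_apply, Fin.sum_univ_three, Matrix.add_apply, Matrix.of_apply, Matrix.cons_val,
      factorCube, TernaryCubic.mk.injEq]
    refine ⟨?_, ?_, ?_, ?_, ?_, ?_, ?_, ?_, ?_, ?_⟩ <;> ring
  -- This is the Weierstrass equation of `W` after the translation of `x` by `p`.
  have h : (factorCube W p α β γ δ).cubic.weierstrass = ⟨W.a₁, W.a₂ + 3 * p, W.a₃ + p * W.a₁,
      W.a₄ + 2 * p * W.a₂ + 3 * p ^ 2, p * W.a₄ + p ^ 2 * W.a₂ + p ^ 3⟩ := by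
    rw [hc]
    ext
    · simp [TernaryCubic.weierstrass]
    · simp [TernaryCubic.weierstrass]
      linear_combination 2 * hf.eq₁₁
    · simp [TernaryCubic.weierstrass]
      linear_combination hf.eq₂₁ - hf.eq₁₂ + W.a₁ * hf.eq₁₁
    · simp [TernaryCubic.weierstrass]
      linear_combination (α * γ + 2 * p + W.a₂) * hf.eq₁₁ + W.a₁ * hf.eq₁₂ + hf.eq₂₂
    · simp [TernaryCubic.weierstrass]
      linear_combination W.a₁ * (β * γ * hf.eq₁₁ + p * hf.eq₁₂) + β * δ * hf.eq₁₁ + p * hf.eq₂₂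
  rw [Cube.disc, h]
  simp only [WeierstrassCurve.Δ, WeierstrassCurve.b₂, WeierstrassCurve.b₄, WeierstrassCurve.b₆,
    WeierstrassCurve.b₈, h₆]
  ring

/-- The curve is nonsingular at the origin. -/
theorem a₃_ne_zero_or_a₄_ne_zero [W.IsElliptic] (h₆ : W.a₆ = 0) : W.a₃ ≠ 0 ∨ W.a₄ ≠ 0 := by
  by_contra! h
  refine W.isUnit_Δ.ne_zero ?_
  simp [WeierstrassCurve.Δ, WeierstrassCurve.b₂, WeierstrassCurve.b₄, WeierstrassCurve.b₆,
    WeierstrassCurve.b₈, h₆, h.1, h.2]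

/-- The base locus of both families for integral points: the three quadratic forms vanish
simultaneously only if `x₀ = 0`, since otherwise `a₃ = a₄ = 0`. -/
theorem mem_radical_of_isFactorization [W.IsElliptic] (h₆ : W.a₆ = 0)
    (hf : IsFactorization W p q α β γ δ) {σ : Type*} {x₀ x₁ : MvPolynomial σ K}
    {I : Ideal (MvPolynomial σ K)} (h0 : C α * (x₀ * x₁) - C β * x₀ ^ 2 ∈ I)
    (h1 : x₁ ^ 2 + C W.a₁ * (x₀ * x₁) - C (W.a₂ + p) * x₀ ^ 2 ∈ I)
    (h2 : C γ * (x₀ * x₁) - C δ * x₀ ^ 2 ∈ I) : x₀ ∈ I.radical := by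
  have e11 := congrArg (C (σ := σ)) hf.eq₁₁
  have e12 := congrArg (C (σ := σ)) hf.eq₁₂
  have e21 := congrArg (C (σ := σ)) hf.eq₂₁
  have e22 := congrArg (C (σ := σ)) hf.eq₂₂
  simp only [C_mul, C_add, C_sub, C_pow] at e11 e12 e21 e22 h1
  rcases a₃_ne_zero_or_a₄_ne_zero h₆ with h | h
  · refine mem_radical_of_C_mul_pow_mem h (k := 2) ?_
    convert sub_mem (I.mul_mem_left (C γ) h0) (I.mul_mem_left (C α) h2) using 1
    linear_combination x₀ ^ 2 * (e12 - e21)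
  · refine mem_radical_of_C_mul_pow_mem h (k := 3) ?_
    convert sub_mem (I.mul_mem_left (C α * C γ * x₀) h1) (add_mem (I.mul_mem_left
      (C γ * x₁ + C W.a₁ * C γ * x₀) h0) (I.mul_mem_left (C β * x₀) h2)) using 1
    linear_combination x₀ ^ 3 * ((C W.a₂ + C p) * e11 - C W.a₁ * e12 - e22)

theorem IsFactorization.ne_zero [W.IsElliptic] (h₆ : W.a₆ = 0)
    (hf : IsFactorization W p q α β γ δ) : γ ≠ 0 ∨ δ ≠ 0 := by
  by_contra! h
  obtain ⟨rfl, rfl⟩ := h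
  obtain ⟨h1, h2, h3, h4, -⟩ := hf
  rw [mul_zero] at h1 h2 h3 h4
  subst h1 h2
  rcases a₃_ne_zero_or_a₄_ne_zero h₆ with h | h
  · exact h (by linear_combination -h3)
  · exact h (by linear_combination -h4)

/-- The equation of the curve, expanded at the point `(p, q)`. -/
theorem expansion_at_point (h₆ : W.a₆ = 0) (h : W.toAffine.Equation p q) :
    (coordY W - algebraMap K _ q) ^ 2 + (2 * algebraMap K _ q + algebraMap K _ W.a₃ +
      algebraMap K _ W.a₁ * coordX W) * (coordY W - algebraMap K _ q) =
    (coordX W - algebraMap K _ p) * (algebraMap K _ p ^ 2 + algebraMap K _ W.a₂ * algebraMap K _ p +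
      algebraMap K _ W.a₄ - algebraMap K _ W.a₁ * algebraMap K _ q +
      (algebraMap K _ W.a₂ + algebraMap K _ p) * coordX W + coordX W ^ 2) := by
  have hE := coord_equation W
  have hE' := congrArg (algebraMap K W.toAffine.CoordinateRing) ((equation_iff ..).mp h)
  rw [h₆, map_zero, add_zero] at hE
  simp only [map_add, map_mul, map_pow, h₆, add_zero] at hE'
  linear_combination hE - hE'

theorem aeval_factorForm (h₆ : W.a₆ = 0) (h : W.toAffine.Equation p q)
    (hf : IsFactorization W p q α β γ δ) :
    aeval (Sum.elim ![lowDegree W (-p) 1 0 0 0, lowDegree W (-q) 0 1 0 0]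
      ![lowDegree W (δ * p - γ * q) (-δ) γ 0 0, lowDegree W 0 p 0 (-1) 0])
      (factorForm W p α β γ δ).toPoly = 0 := by
  have hE := expansion_at_point h₆ h
  have e11 := congrArg (algebraMap K W.toAffine.CoordinateRing) hf.eq₁₁
  have e12 := congrArg (algebraMap K W.toAffine.CoordinateRing) hf.eq₁₂
  have e21 := congrArg (algebraMap K W.toAffine.CoordinateRing) hf.eq₂₁
  have e22 := congrArg (algebraMap K W.toAffine.CoordinateRing) hf.eq₂₂
  simp only [map_add, map_mul, map_pow, map_sub] at e11 e12 e21 e22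
  rw [Form22.aeval_toPoly]
  simp only [factorForm, lowDegree, Fin.sum_univ_three, Sum.elim_inl, Sum.elim_inr,
    Matrix.of_apply, Matrix.cons_val, map_neg, map_add, map_mul, map_sub, map_one, map_zero]
  set x := coordX W
  set y := coordY W
  set z := x - algebraMap K _ p with hz
  set w := y - algebraMap K _ q with hw
  set ℓ := algebraMap K W.toAffine.CoordinateRing γ * w - algebraMap K _ δ * z with hℓ
  linear_combination (-(z ^ 2 * ℓ)) * hE + z * ℓ * (w ^ 2 * e11 - z * w * (e12 + e21) + z ^ 2 * e22)

theorem aeval_factorCube (h₆ : W.a₆ = 0) (h : W.toAffine.Equation p q)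
    (hf : IsFactorization W p q α β γ δ) (k : Fin 3) :
    aeval (Sum.elim ![lowDegree W (-p) 1 0 0 0, lowDegree W (-q) 0 1 0 0,
        lowDegree W 0 (-p) 0 1 0]
      ![lowDegree W (δ * p - γ * q) (-δ) γ 0 0, lowDegree W 0 p 0 (-1) 0,
        lowDegree W 0 q 0 0 (-1)])
      ((factorCube W p α β γ δ).toPoly k) = 0 := by
  have hE := expansion_at_point h₆ h
  have e11 := congrArg (algebraMap K W.toAffine.CoordinateRing) hf.eq₁₁
  have e12 := congrArg (algebraMap K W.toAffine.CoordinateRing) hf.eq₁₂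
  have e21 := congrArg (algebraMap K W.toAffine.CoordinateRing) hf.eq₂₁
  have e22 := congrArg (algebraMap K W.toAffine.CoordinateRing) hf.eq₂₂
  simp only [map_add, map_mul, map_pow, map_sub] at e11 e12 e21 e22
  rw [Cube.aeval_toPoly]
  fin_cases k
  · simp only [factorCube, lowDegree, Fin.sum_univ_three, Sum.elim_inl, Sum.elim_inr, Fin.zero_eta,
      Matrix.of_apply, Matrix.cons_val, map_neg, map_mul, map_sub, map_one, map_zero]
    ring
  · simp only [factorCube, lowDegree, Fin.sum_univ_three, Sum.elim_inl, Sum.elim_inr, Fin.mk_one,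
      Matrix.of_apply, Matrix.cons_val, map_neg, map_mul, map_sub, map_one, map_zero]
    ring
  · simp only [factorCube, lowDegree, Fin.sum_univ_three, Sum.elim_inl, Sum.elim_inr,
      Fin.reduceFinMk,
      Matrix.of_apply, Matrix.cons_val, map_neg, map_add, map_mul, map_sub, map_one, map_zero]
    set x := coordX W
    set y := coordY W
    set z := x - algebraMap K _ p with hz
    set w := y - algebraMap K _ q with hw
    linear_combination (-z) * hE + (w ^ 2 * e11 - z * w * (e12 + e21) + z ^ 2 * e22)

theorem lowDegree_ne_zero {a b c d e : K} (h : a ≠ 0 ∨ b ≠ 0 ∨ c ≠ 0 ∨ d ≠ 0 ∨ e ≠ 0) :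
    lowDegree W a b c d e ≠ 0 := fun h0 => by
  obtain ⟨h1, h2, h3, h4, h5⟩ := lowDegree_eq_zero h0
  simp [h1, h2, h3, h4, h5] at h

theorem noShortRelation_lowDegree {p q : K} (h : W.toAffine.Nonsingular p q) :
    NoShortRelation (K := K) ![lowDegree W (-p) 1 0 0 0, lowDegree W (-q) 0 1 0 0] := by
  rw [← XClass_eq_lowDegree, ← YClass_eq_lowDegree]
  exact noShortRelation_class h

theorem vanishingIdealEq_factorForm [W.IsElliptic] (h₆ : W.a₆ = 0) (h : W.toAffine.Nonsingular p q)
    (hf : IsFactorization W p q α β γ δ) :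
    VanishingIdealEq (K := K) ![lowDegree W (-p) 1 0 0 0, lowDegree W (-q) 0 1 0 0]
      ![lowDegree W (δ * p - γ * q) (-δ) γ 0 0, lowDegree W 0 p 0 (-1) 0]
      (Ideal.span {(factorForm W p α β γ δ).toPoly}) := by
  have hγδ := hf.ne_zero h₆
  refine Form22.vanishingIdealEq (lowDegree_ne_zero (by simp)) ?_ (aeval_factorForm h₆ h.1 hf) ?_ ?_
    (Form22.not_X_dvd_toPoly.1 ⟨1, by simp [factorForm]⟩) (Form22.not_X_dvd_toPoly.2.1 ?_)
    (Form22.not_X_dvd_toPoly.2.2 ?_)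
  · intro j
    fin_cases j
    · refine lowDegree_ne_zero ?_
      rcases hγδ with h | h <;> simp [h]
    · exact lowDegree_ne_zero (by simp)
  · intro e R₀ R₁ hR₀ hR₁ hR
    refine (noShortRelation_lowDegree h).eq_zero_of_bilinear
      (l := ![C γ * X 1 - C δ * X 0, C (-p) * X 0]) (q := ![0, C (-1) * X 0 ^ 2]) ?_ ?_ ?_ ?_
      hR₀ hR₁ hR
    · intro i
      fin_cases i
      · exact (isHomogeneous_C_mul_X _ _).sub (isHomogeneous_C_mul_X _ _)
      · exact isHomogeneous_C_mul_X _ _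
    · intro i
      fin_cases i
      · exact isHomogeneous_zero _ _ _
      · exact isHomogeneous_C_mul_X_pow _ _ _
    · intro h0
      have h1 := congrArg (eval ![1, 0]) h0
      have h2 := congrArg (eval ![1, 1]) h0
      simp at h1 h2
      rw [h1] at h2
      simp [h1] at hγδ
      exact hγδ (by linear_combination -h2)
    · intro i
      fin_cases i
      · simp [lowDegree]
        ring
      · simp [lowDegree]
        ring
  · refine mem_radical_of_isFactorization h₆ hf (x₁ := X 1) ?_ ?_ ?_
    · refine mem_of_eq_of_mem ?_ ((factorForm W p α β γ δ).col_mem 0)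
      simp [Form22.col, factorForm]
      ring
    · refine mem_of_eq_of_mem ?_ ((factorForm W p α β γ δ).col_mem 1)
      simp [Form22.col, factorForm]
      ring
    · refine mem_of_eq_of_mem ?_ ((factorForm W p α β γ δ).col_mem 2)
      simp [Form22.col, factorForm]
      ring
  · rcases hγδ with h | h
    · exact ⟨1, by simpa [factorForm] using h⟩
    · exact ⟨0, by simpa [factorForm] using h⟩
  · rcases hf.eq_one with h | h
    · exact ⟨1, by simp [factorForm, h]⟩
    · exact ⟨0, by simp [factorForm, h]⟩

theorem factorCube_detX : (factorCube W p α β γ δ).detX =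
    C (-1) * X 0 * X 2 ^ 2 +
      liftTwo (X 1 ^ 2 + C W.a₁ * (X 0 * X 1) - C (W.a₂ + p) * X 0 ^ 2) * X 2 +
      liftTwo ((C δ * X 0 ^ 2 - C γ * (X 0 * X 1)) * (C α * X 1 - C β * X 0)) := by
  simp [Cube.detX, Matrix.det_fin_three, Cube.row, factorCube, Fin.sum_univ_three, liftTwo]
  ring

theorem mem_radical_factorCube [W.IsElliptic] (h₆ : W.a₆ = 0)
    (hf : IsFactorization W p q α β γ δ) (i : Fin 3) :
    (X i : MvPolynomial (Fin 3) K) ∈ (Ideal.span (Set.range fun k : Fin 3 × Fin 3 × Fin 3 =>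
      (factorCube W p α β γ δ).minor k.1 k.2.1 k.2.2)).radical := by
  set S := factorCube W p α β γ δ with hS
  set I := Ideal.span (Set.range fun k : Fin 3 × Fin 3 × Fin 3 => S.minor k.1 k.2.1 k.2.2)
  have h02 : (X 0 * X 2 : MvPolynomial (Fin 3) K) ∈ I := by
    refine mem_of_eq_of_mem ?_ (S.minor_mem 0 1 1)
    simp [Cube.minor, Cube.row, Fin.sum_univ_three, hS, factorCube,
      show (1 : Fin 3) + 1 = 2 from rfl,
      show (1 : Fin 3) + 2 = 0 from rfl, mul_comm]
  have h12 : (X 1 * X 2 : MvPolynomial (Fin 3) K) ∈ I := by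
    refine mem_of_eq_of_mem ?_ (S.minor_mem 0 1 2)
    simp [Cube.minor, Cube.row, Fin.sum_univ_three, hS, factorCube,
      show (2 : Fin 3) + 1 = 0 from rfl,
      show (2 : Fin 3) + 2 = 1 from rfl]
    ring
  have hu0 : C α * (X 0 * X 1) - C β * X 0 ^ 2 ∈ I := by
    refine mem_of_eq_of_mem ?_ (I.neg_mem (S.minor_mem 1 2 1))
    simp [Cube.minor, Cube.row, Fin.sum_univ_three, hS, factorCube,
      show (1 : Fin 3) + 1 = 2 from rfl,
      show (1 : Fin 3) + 2 = 0 from rfl]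
    ring
  have hu1 : X 1 ^ 2 + C W.a₁ * (X 0 * X 1) - C (W.a₂ + p) * X 0 ^ 2 ∈ I := by
    refine mem_of_eq_of_mem ?_ (I.add_mem (S.minor_mem 1 2 0) h02)
    simp [Cube.minor, Cube.row, Fin.sum_univ_three, hS, factorCube]
    ring
  have hu2 : C γ * (X 0 * X 1) - C δ * X 0 ^ 2 ∈ I := by
    refine mem_of_eq_of_mem ?_ (I.neg_mem (S.minor_mem 0 1 0))
    simp [Cube.minor, Cube.row, Fin.sum_univ_three, hS, factorCube]
    ring
  have h0 : (X 0 : MvPolynomial (Fin 3) K) ∈ I.radical :=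
    mem_radical_of_isFactorization h₆ hf hu0 hu1 hu2
  have h1 : (X 1 : MvPolynomial (Fin 3) K) ∈ I.radical := by
    rw [← Ideal.radical_idem]
    refine ⟨2, mem_of_eq_of_mem ?_ (sub_mem (Ideal.le_radical hu1) (I.radical.mul_mem_left
      (C W.a₁ * X 1 - C (W.a₂ + p) * X 0) h0))⟩
    ring
  have h2 : (X 2 : MvPolynomial (Fin 3) K) ∈ I.radical := by
    refine ⟨2, mem_of_eq_of_mem ?_ (add_mem (sub_mem (I.mul_mem_left (C W.a₁) h12)
      (I.mul_mem_left (C (W.a₂ + p)) h02)) (sub_mem (I.mul_mem_left (C δ) hu0)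
      (S.minor_mem 0 2 2)))⟩
    simp [Cube.minor, Cube.row, Fin.sum_univ_three, hS, factorCube,
      show (2 : Fin 3) + 1 = 0 from rfl,
      show (2 : Fin 3) + 2 = 1 from rfl]
    ring
  fin_cases i
  exacts [h0, h1, h2]

theorem vanishingIdealEq_factorCube [W.IsElliptic] (h₆ : W.a₆ = 0) (h : W.toAffine.Nonsingular p q)
    (hf : IsFactorization W p q α β γ δ) :
    VanishingIdealEq (K := K) ![lowDegree W (-p) 1 0 0 0, lowDegree W (-q) 0 1 0 0,
        lowDegree W 0 (-p) 0 1 0]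
      ![lowDegree W (δ * p - γ * q) (-δ) γ 0 0, lowDegree W 0 p 0 (-1) 0,
        lowDegree W 0 q 0 0 (-1)]
      (Ideal.span (Set.range (factorCube W p α β γ δ).toPoly)) := by
  have hB := aeval_factorCube h₆ h.1 hf
  have hb' : lowDegree W (δ * p - γ * q) (-δ) γ 0 0 ≠ 0 := by
    refine lowDegree_ne_zero ?_
    rcases hf.ne_zero h₆ with h | h <;> simp [h]
  refine Cube.vanishingIdealEq (lowDegree_ne_zero (by simp)) hb' hB (fun e H hH hH0 => ?_)
    (mem_radical_factorCube h₆ hf)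
  refine cubic_dvd_of_aeval_eq_zero (neg_ne_zero.mpr one_ne_zero) ?_ ?_ factorCube_detX
    (Cube.aeval_detX hb' hB) ?_ ?_ e H hH hH0
  · exact ((isHomogeneous_X_pow 1 2).add (((isHomogeneous_X K 0).mul
      (isHomogeneous_X K 1)).C_mul _)).sub (isHomogeneous_C_mul_X_pow _ _ _)
  · exact ((isHomogeneous_C_mul_X_pow _ _ _).sub (((isHomogeneous_X K 0).mul
      (isHomogeneous_X K 1)).C_mul _)).mul
        ((isHomogeneous_C_mul_X _ _).sub (isHomogeneous_C_mul_X _ _))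
  · rintro ⟨Q, hQ⟩
    have := congrArg (eval ![0, 1, 1]) hQ
    rw [factorCube_detX] at this
    simp [liftTwo] at this
  · intro e R₀ R₁ hR₀ hR₁ hR
    refine (noShortRelation_lowDegree h).eq_zero_of_linear (l := C p * X 0) (q := X 0 ^ 2)
      (isHomogeneous_C_mul_X _ _) (isHomogeneous_X_pow _ _) (pow_ne_zero _ (X_ne_zero 0)) ?_ hR₀ hR₁
      (t := lowDegree W 0 (-p) 0 1 0) ?_
    · simp [lowDegree]
      ring
    · rw [vec_comp_castSucc] at hR
      exact hR

end IntegralPoint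

end GenusOne

/-! ### The forms attached to a point near infinity -/

namespace GenusOne

open MvPolynomial
open WeierstrassCurve WeierstrassCurve.Affine

section Slope

variable {K : Type*} [Field K] (W : WeierstrassCurve K)

/-- The coefficient `b = a₂ - σ τ a₃ + σ τ² a₄` in the forms attached to a point near infinity. -/
def slopeB (τ σ : K) : K := W.a₂ - σ * τ * W.a₃ + σ * τ ^ 2 * W.a₄

/-- The coefficient `μ = -a₁ + τ b` in the forms attached to a point near infinity. -/
def slopeM (τ σ : K) : K := -W.a₁ + τ * slopeB W τ σ

/-- The equation satisfied by the coordinates `τ = p / q` and `σ = q ^ 2 / p ^ 3` of a point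
`(p, q)` near infinity. The point at infinity corresponds to `τ = 0` and `σ = 1`. -/
def IsSlope (τ σ : K) : Prop := (1 - τ * slopeM W τ σ) * σ = 1

/-- The `(2,2)`-form attached to a point near infinity. With `m = 1 - σ τ² x`, `n = x - τ y` and
`s = y - σ τ x²` it vanishes at `(m, n; x m, s + a₃ m)`. -/
def slopeForm (τ σ : K) : Form22 K :=
  !![W.a₃ * slopeM W τ σ - W.a₄, -W.a₃ + τ * W.a₄, 0;
    -slopeB W τ σ, -slopeM W τ σ + τ * slopeB W τ σ, 1; -σ, τ * σ, 0]

/-- The cube attached to a point near infinity, with bilinear forms `x₀ y₂ - x₁ y₀`,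
`x₂ (y₀ - τ y₁) - x₁ y₁ + a₃ x₀ y₀` and `x₂ (y₁ - μ y₀) - a₄ x₀ y₀ - b x₁ y₀ - σ x₁ y₂`. They
vanish at `(m, n, s; x m, s + a₃ m, x n)`, where `m = 1 - σ τ² x`, `n = x - τ y` and
`s = y - σ τ x²`. -/
def slopeCube (τ σ : K) : Cube K :=
  ![!![0, 0, 1; -1, 0, 0; 0, 0, 0], !![W.a₃, 0, 0; 0, -1, 0; 1, -τ, 0],
    !![-W.a₄, 0, 0; -slopeB W τ σ, 0, -σ; -slopeM W τ σ, 1, 0]]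

variable {W} {τ σ : K}

theorem IsSlope.ne_zero (hs : IsSlope W τ σ) : σ ≠ 0 := right_ne_zero_of_mul_eq_one hs

theorem IsSlope.left_ne_zero (hs : IsSlope W τ σ) : 1 - τ * slopeM W τ σ ≠ 0 :=
  left_ne_zero_of_mul_eq_one hs

theorem slopeForm_disc (hs : IsSlope W τ σ) (h₆ : W.a₆ = 0) : (slopeForm W τ σ).disc = W.Δ := by
  have hs' := hs
  simp only [IsSlope, slopeM, slopeB] at hs'
  -- This is the Weierstrass equation of `W` after the substitution of `-y - a₃` for `y`.
  have h : (slopeForm W τ σ).weierstrass = ⟨-W.a₁, W.a₂, W.a₃, W.a₄ + W.a₁ * W.a₃, 0⟩ := by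
    ext
    · simp [Form22.weierstrass, slopeForm, slopeM]
    · simp [Form22.weierstrass, slopeForm, slopeM, slopeB]
      ring
    · simp [Form22.weierstrass, slopeForm, slopeM, slopeB]
      linear_combination W.a₃ * hs'
    · simp [Form22.weierstrass, slopeForm, slopeM, slopeB]
      linear_combination (W.a₁ * W.a₃ + W.a₄) * hs'
    · simp [Form22.weierstrass, slopeForm]
  rw [Form22.disc, h]
  simp only [WeierstrassCurve.Δ, WeierstrassCurve.b₂, WeierstrassCurve.b₄, WeierstrassCurve.b₆,
    WeierstrassCurve.b₈, h₆]
  ring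

theorem slopeCube_disc (hs : IsSlope W τ σ) (h₆ : W.a₆ = 0) : (slopeCube W τ σ).disc = W.Δ := by
  have hs' := hs
  simp only [IsSlope, slopeM, slopeB] at hs'
  have hc : (slopeCube W τ σ).cubic = ⟨0, 0, -(σ * W.a₄), τ, -1, 1, -(σ * τ * W.a₃),
      -slopeB W τ σ, σ * W.a₃ + σ * τ * W.a₄, W.a₁⟩ := by
    simp only [Cube.cubic, Matrix.det_fin_three, Matrix.adjugate_fin_three, Matrix.trace_fin_three,
      Matrix.mul_apply, Fin.sum_univ_three, Matrix.add_apply, Matrix.of_apply, Matrix.cons_val,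
      slopeCube, TernaryCubic.mk.injEq, slopeM]
    refine ⟨?_, ?_, ?_, ?_, ?_, ?_, ?_, ?_, ?_, ?_⟩ <;> ring
  -- This is the Weierstrass equation of `W` after the translation of `x` by `-σ τ a₃` and of `y` by
  -- `σ τ a₄`.
  have h : (slopeCube W τ σ).cubic.weierstrass = ⟨W.a₁, W.a₂ - 3 * (σ * τ * W.a₃),
      W.a₃ - σ * τ * W.a₃ * W.a₁ + 2 * (σ * τ * W.a₄),
      W.a₄ - 2 * (σ * τ * W.a₃) * W.a₂ - σ * τ * W.a₄ * W.a₁ + 3 * (σ * τ * W.a₃) ^ 2,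
      -(σ * τ * W.a₃) * W.a₄ + (σ * τ * W.a₃) ^ 2 * W.a₂ - (σ * τ * W.a₃) ^ 3 -
        σ * τ * W.a₄ * W.a₃ - (σ * τ * W.a₄) ^ 2 +
        (σ * τ * W.a₃) * (σ * τ * W.a₄) * W.a₁⟩ := by
    rw [hc]
    ext
    · simp [TernaryCubic.weierstrass]
    · simp [TernaryCubic.weierstrass, slopeB]
      ring
    · simp [TernaryCubic.weierstrass, slopeB]
      linear_combination W.a₃ * hs'
    · simp [TernaryCubic.weierstrass, slopeB]
      linear_combination W.a₄ * hs'
    · simp [TernaryCubic.weierstrass, slopeB]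
      linear_combination -2 * τ * σ * W.a₃ * W.a₄ * hs'
  rw [Cube.disc, h]
  simp only [WeierstrassCurve.Δ, WeierstrassCurve.b₂, WeierstrassCurve.b₄, WeierstrassCurve.b₆,
    WeierstrassCurve.b₈, h₆]
  ring

/-- The curve equation in terms of the functions `1 - σ τ² x`, `x - τ y` and `y - σ τ x²`, which
vanish at `(p, q)` if `τ = p / q` and `σ = q² / p³`. -/
theorem slope_relation (hs : IsSlope W τ σ) (h₆ : W.a₆ = 0) :
    let A := algebraMap K W.toAffine.CoordinateRing
    (coordY W - A (σ * τ) * coordX W ^ 2) * (coordY W - A (σ * τ) * coordX W ^ 2 +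
      A W.a₃ * (1 - A (σ * τ ^ 2) * coordX W) - A (slopeM W τ σ) * (coordX W *
        (1 - A (σ * τ ^ 2) * coordX W))) =
    coordX W * (1 - A (σ * τ ^ 2) * coordX W) * (A W.a₄ * (1 - A (σ * τ ^ 2) * coordX W) +
      A (slopeB W τ σ) * (coordX W - A τ * coordY W)) +
      A σ * (coordX W * (coordX W - A τ * coordY W) ^ 2) := by
  intro A
  have hE := coord_equation W
  have hs' := congrArg A hs
  rw [h₆, map_zero, add_zero] at hE
  simp only [slopeM, slopeB, map_add, map_sub, map_neg, map_mul, map_pow, map_one, A]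
    at hE hs' ⊢
  linear_combination (1 - A σ * A τ ^ 2 * coordX W) * (hE - coordX W ^ 3 * hs')

theorem aeval_slopeForm (hs : IsSlope W τ σ) (h₆ : W.a₆ = 0) :
    aeval (Sum.elim ![lowDegree W 1 (-(σ * τ ^ 2)) 0 0 0, lowDegree W 0 1 (-τ) 0 0]
      ![lowDegree W 0 1 0 (-(σ * τ ^ 2)) 0,
        lowDegree W W.a₃ (-(W.a₃ * (σ * τ ^ 2))) 1 (-(σ * τ)) 0])
      (slopeForm W τ σ).toPoly = 0 := by
  have hR := slope_relation hs h₆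
  rw [Form22.aeval_toPoly]
  simp only [slopeForm, lowDegree, Fin.sum_univ_three, Sum.elim_inl, Sum.elim_inr,
    Matrix.of_apply, Matrix.cons_val, map_neg, map_add, map_mul, map_sub, map_one, map_zero,
    map_pow] at hR ⊢
  set x := coordX W
  set y := coordY W
  set n := 1 - algebraMap K W.toAffine.CoordinateRing σ * algebraMap K _ τ ^ 2 * x with hn
  set s := y - algebraMap K W.toAffine.CoordinateRing σ * algebraMap K _ τ * x ^ 2 with hs
  linear_combination (x * n - algebraMap K _ τ * (s + algebraMap K _ W.a₃ * n)) * n * hR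

theorem aeval_slopeCube (hs : IsSlope W τ σ) (h₆ : W.a₆ = 0) (k : Fin 3) :
    aeval (Sum.elim ![lowDegree W 1 (-(σ * τ ^ 2)) 0 0 0, lowDegree W 0 1 (-τ) 0 0,
        lowDegree W 0 0 1 (-(σ * τ)) 0]
      ![lowDegree W 0 1 0 (-(σ * τ ^ 2)) 0,
        lowDegree W W.a₃ (-(W.a₃ * (σ * τ ^ 2))) 1 (-(σ * τ)) 0, lowDegree W 0 0 0 1 (-τ)])
      ((slopeCube W τ σ).toPoly k) = 0 := by
  have hR := slope_relation hs h₆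
  rw [Cube.aeval_toPoly]
  fin_cases k
  · simp only [slopeCube, lowDegree, Fin.sum_univ_three, Sum.elim_inl, Sum.elim_inr, Fin.zero_eta,
      Matrix.of_apply, Matrix.cons_val, map_neg, map_mul, map_one, map_zero]
    ring
  · simp only [slopeCube, lowDegree, Fin.sum_univ_three, Sum.elim_inl, Sum.elim_inr, Fin.mk_one,
      Matrix.of_apply, Matrix.cons_val, map_neg, map_mul, map_one, map_zero, map_pow]
    ring
  · simp only [slopeCube, lowDegree, Fin.sum_univ_three, Sum.elim_inl, Sum.elim_inr,
      Fin.reduceFinMk, Matrix.of_apply, Matrix.cons_val, map_neg, map_mul, map_one, map_zero,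
      map_pow] at hR ⊢
    linear_combination hR

/-- The two vanishing conditions cannot hold simultaneously, since the curve is nonsingular at the
origin. -/
theorem IsSlope.mem_of_mem (hs : IsSlope W τ σ) {ι : Type*} {I : Ideal (MvPolynomial ι K)}
    {f : MvPolynomial ι K} (h0 : C (W.a₃ * slopeM W τ σ - W.a₄) * f ∈ I)
    (h1 : C (-W.a₃ + τ * W.a₄) * f ∈ I) : C W.a₃ * f ∈ I ∧ C W.a₄ * f ∈ I := by
  have h4 : C W.a₄ * f ∈ I := by
    refine mem_of_eq_of_mem ?_ (I.neg_mem (I.mul_mem_left (C σ)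
      (I.add_mem h0 (I.mul_mem_left (C (slopeM W τ σ)) h1))))
    have := congrArg (C (σ := ι)) hs
    simp only [C_mul, C_sub, C_add, C_neg, C_1] at this ⊢
    linear_combination (-(C W.a₄ * f)) * this
  refine ⟨mem_of_eq_of_mem ?_ (I.sub_mem (I.mul_mem_left (C τ) h4) h1), h4⟩
  simp only [C_mul, C_add, C_neg]
  ring

theorem vanishingIdealEq_slopeForm [W.IsElliptic] (hs : IsSlope W τ σ) (h₆ : W.a₆ = 0)
    (hkey : ∀ (e : ℕ) (R₀ R₁ : MvPolynomial (Fin 2) K), R₀.IsHomogeneous e → R₁.IsHomogeneous e →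
      aeval ![lowDegree W 1 (-(σ * τ ^ 2)) 0 0 0, lowDegree W 0 1 (-τ) 0 0] R₁ *
        lowDegree W W.a₃ (-(W.a₃ * (σ * τ ^ 2))) 1 (-(σ * τ)) 0 +
      aeval ![lowDegree W 1 (-(σ * τ ^ 2)) 0 0 0, lowDegree W 0 1 (-τ) 0 0] R₀ *
        lowDegree W 0 1 0 (-(σ * τ ^ 2)) 0 = 0 → R₀ = 0 ∧ R₁ = 0) :
    VanishingIdealEq (K := K) ![lowDegree W 1 (-(σ * τ ^ 2)) 0 0 0, lowDegree W 0 1 (-τ) 0 0]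
      ![lowDegree W 0 1 0 (-(σ * τ ^ 2)) 0,
        lowDegree W W.a₃ (-(W.a₃ * (σ * τ ^ 2))) 1 (-(σ * τ)) 0]
      (Ideal.span {(slopeForm W τ σ).toPoly}) := by
  refine Form22.vanishingIdealEq (lowDegree_ne_zero (by simp)) ?_ (aeval_slopeForm hs h₆) hkey ?_
    (Form22.not_X_dvd_toPoly.1 ⟨0, by simpa [slopeForm] using hs.ne_zero⟩)
    (Form22.not_X_dvd_toPoly.2.1 ⟨1, by simp [slopeForm]⟩)
    (Form22.not_X_dvd_toPoly.2.2 ⟨2, by simpa [slopeForm] using hs.ne_zero⟩)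
  · intro j
    fin_cases j
    · exact lowDegree_ne_zero (by simp)
    · exact lowDegree_ne_zero (by simp)
  · set I := Ideal.span {(slopeForm W τ σ).col 0, (slopeForm W τ σ).col 1, (slopeForm W τ σ).col 2}
    have h01 : (X 0 * X 1 : MvPolynomial (Fin 2) K) ∈ I := by
      refine mem_of_eq_of_mem ?_ ((slopeForm W τ σ).col_mem 2)
      simp [Form22.col, slopeForm]
    have h := hs.mem_of_mem (f := X 0 ^ 3) (I := I) ?_ ?_
    · rcases a₃_ne_zero_or_a₄_ne_zero h₆ with h3 | h4
      · exact mem_radical_of_C_mul_pow_mem h3 h.1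
      · exact mem_radical_of_C_mul_pow_mem h4 h.2
    · refine mem_of_eq_of_mem ?_ (I.add_mem (I.mul_mem_left (X 0) ((slopeForm W τ σ).col_mem 0))
        (I.mul_mem_left (C (slopeB W τ σ) * X 0 + C σ * X 1) h01))
      simp [Form22.col, slopeForm]
      ring
    · refine mem_of_eq_of_mem ?_ (I.sub_mem (I.mul_mem_left (X 0) ((slopeForm W τ σ).col_mem 1))
        (I.mul_mem_left (C (-slopeM W τ σ + τ * slopeB W τ σ) * X 0 + C (τ * σ) * X 1) h01))
      simp [Form22.col, slopeForm]
      ring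

theorem slopeCube_detX : (slopeCube W τ σ).detX =
    C (1 - τ * slopeM W τ σ) * X 0 * X 2 ^ 2 +
      liftTwo (C (-(σ * τ)) * X 1 ^ 2 + C (W.a₃ - τ * W.a₄) * X 0 ^ 2 -
        C (τ * slopeB W τ σ + slopeM W τ σ) * (X 0 * X 1)) * X 2 +
      liftTwo (C (-σ) * X 1 ^ 3 - C W.a₄ * (X 0 ^ 2 * X 1) - C (slopeB W τ σ) *
        (X 0 * X 1 ^ 2)) := by
  simp [Cube.detX, Matrix.det_fin_three, Cube.row, slopeCube, Fin.sum_univ_three, liftTwo]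
  ring

theorem mem_radical_slopeCube [W.IsElliptic] (hs : IsSlope W τ σ) (h₆ : W.a₆ = 0) (i : Fin 3) :
    (X i : MvPolynomial (Fin 3) K) ∈ (Ideal.span (Set.range fun k : Fin 3 × Fin 3 × Fin 3 =>
      (slopeCube W τ σ).minor k.1 k.2.1 k.2.2)).radical := by
  set S := slopeCube W τ σ with hS
  set I := Ideal.span (Set.range fun k : Fin 3 × Fin 3 × Fin 3 => S.minor k.1 k.2.1 k.2.2)
  have h02 : (X 0 * X 2 : MvPolynomial (Fin 3) K) ∈ I := by
    refine mem_of_eq_of_mem ?_ (I.neg_mem (S.minor_mem 0 2 0))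
    simp [Cube.minor, Cube.row, Fin.sum_univ_three, hS, slopeCube]
  have h12 : (X 1 * X 2 : MvPolynomial (Fin 3) K) ∈ I := by
    refine mem_of_eq_of_mem ?_ (I.neg_mem (S.minor_mem 0 2 2))
    simp [Cube.minor, Cube.row, Fin.sum_univ_three, hS, slopeCube,
      show (2 : Fin 3) + 1 = 0 from rfl,
      show (2 : Fin 3) + 2 = 1 from rfl]
  have h01 : (X 0 * X 1 : MvPolynomial (Fin 3) K) ∈ I := by
    refine mem_of_eq_of_mem ?_ (I.sub_mem (S.minor_mem 0 1 0) (I.mul_mem_left (C τ) h02))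
    simp [Cube.minor, Cube.row, Fin.sum_univ_three, hS, slopeCube]
    ring
  have h11 : (X 1 ^ 2 : MvPolynomial (Fin 3) K) ∈ I := by
    refine mem_of_eq_of_mem ?_ (I.sub_mem (S.minor_mem 0 1 2) (I.mul_mem_left (C τ) h12))
    simp [Cube.minor, Cube.row, Fin.sum_univ_three, hS, slopeCube,
      show (2 : Fin 3) + 1 = 0 from rfl,
      show (2 : Fin 3) + 2 = 1 from rfl]
    ring
  have h3 : C W.a₃ * X 0 ^ 2 ∈ I := by
    refine mem_of_eq_of_mem ?_ (I.sub_mem (S.minor_mem 0 1 1) h02)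
    simp [Cube.minor, Cube.row, Fin.sum_univ_three, hS, slopeCube,
      show (1 : Fin 3) + 1 = 2 from rfl,
      show (1 : Fin 3) + 2 = 0 from rfl]
    ring
  have h4 : C W.a₄ * X 0 ^ 2 ∈ I := by
    refine mem_of_eq_of_mem ?_ (I.neg_mem (I.add_mem (S.minor_mem 0 2 1) (I.add_mem
      (I.mul_mem_left (C (slopeM W τ σ)) h02) (I.add_mem (I.mul_mem_left (C (slopeB W τ σ)) h01)
        (I.mul_mem_left (C σ) h11)))))
    simp [Cube.minor, Cube.row, Fin.sum_univ_three, hS, slopeCube,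
      show (1 : Fin 3) + 1 = 2 from rfl,
      show (1 : Fin 3) + 2 = 0 from rfl]
    ring
  have h22 : C (1 - τ * slopeM W τ σ) * X 2 ^ 2 ∈ I := by
    refine mem_of_eq_of_mem ?_ (I.add_mem (S.minor_mem 1 2 2) (I.add_mem
      (I.mul_mem_left (C (τ * W.a₄ - W.a₃)) h02) (I.add_mem
      (I.mul_mem_left (C (τ * slopeB W τ σ + slopeM W τ σ)) h12) (I.add_mem
        (I.mul_mem_left (C W.a₄) h01) (I.mul_mem_left (C (slopeB W τ σ)) h11)))))
    simp [Cube.minor, Cube.row, Fin.sum_univ_three, hS, slopeCube,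
      show (2 : Fin 3) + 1 = 0 from rfl,
      show (2 : Fin 3) + 2 = 1 from rfl]
    ring
  fin_cases i
  · rcases a₃_ne_zero_or_a₄_ne_zero h₆ with h | h
    · exact mem_radical_of_C_mul_pow_mem h h3
    · exact mem_radical_of_C_mul_pow_mem h h4
  · exact ⟨2, h11⟩
  · exact mem_radical_of_C_mul_pow_mem hs.left_ne_zero h22

theorem vanishingIdealEq_slopeCube [W.IsElliptic] (hs : IsSlope W τ σ) (h₆ : W.a₆ = 0)
    (hkey : ∀ (e : ℕ) (R₀ R₁ : MvPolynomial (Fin 2) K), R₀.IsHomogeneous (e + 1) →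
      R₁.IsHomogeneous e →
      aeval ![lowDegree W 1 (-(σ * τ ^ 2)) 0 0 0, lowDegree W 0 1 (-τ) 0 0] R₁ *
        lowDegree W 0 0 1 (-(σ * τ)) 0 +
      aeval ![lowDegree W 1 (-(σ * τ ^ 2)) 0 0 0, lowDegree W 0 1 (-τ) 0 0] R₀ = 0 →
        R₀ = 0 ∧ R₁ = 0) :
    VanishingIdealEq (K := K) ![lowDegree W 1 (-(σ * τ ^ 2)) 0 0 0, lowDegree W 0 1 (-τ) 0 0,
        lowDegree W 0 0 1 (-(σ * τ)) 0]
      ![lowDegree W 0 1 0 (-(σ * τ ^ 2)) 0,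
        lowDegree W W.a₃ (-(W.a₃ * (σ * τ ^ 2))) 1 (-(σ * τ)) 0, lowDegree W 0 0 0 1 (-τ)]
      (Ideal.span (Set.range (slopeCube W τ σ).toPoly)) := by
  have hB := aeval_slopeCube hs h₆
  have hb' : lowDegree W 0 1 0 (-(σ * τ ^ 2)) 0 ≠ 0 := lowDegree_ne_zero (by simp)
  refine Cube.vanishingIdealEq (lowDegree_ne_zero (by simp)) hb' hB (fun e H hH hH0 => ?_)
    (mem_radical_slopeCube hs h₆)
  refine cubic_dvd_of_aeval_eq_zero hs.left_ne_zero ?_ ?_ slopeCube_detX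
    (Cube.aeval_detX hb' hB) ?_ ?_ e H hH hH0
  · exact ((isHomogeneous_C_mul_X_pow _ _ _).add (isHomogeneous_C_mul_X_pow _ _ _)).sub
      (((isHomogeneous_X K 0).mul (isHomogeneous_X K 1)).C_mul _)
  · exact ((isHomogeneous_C_mul_X_pow _ _ _).sub (((isHomogeneous_X_pow 0 2).mul
      (isHomogeneous_X K 1)).C_mul _)).sub
        (((isHomogeneous_X K 0).mul (isHomogeneous_X_pow 1 2)).C_mul _)
  · rintro ⟨Q, hQ⟩
    have := congrArg (eval ![0, 1, 0]) hQ
    rw [slopeCube_detX] at this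
    simp [liftTwo, hs.ne_zero] at this
  · intro e R₀ R₁ hR₀ hR₁ hR
    rw [vec_comp_castSucc] at hR
    exact hkey e R₀ R₁ hR₀ hR₁ hR

section Key

variable {e e' : ℕ} {R₀ R₁ : MvPolynomial (Fin 2) K}

theorem lowDegree_one : lowDegree W 1 0 0 0 0 = 1 := by simp [lowDegree]

theorem lowDegree_coordX : lowDegree W 0 1 0 0 0 = coordX W := by simp [lowDegree]

theorem slopeForm_key_infinity (hR₀ : R₀.IsHomogeneous e) (hR₁ : R₁.IsHomogeneous e)
    (h : aeval ![lowDegree W 1 (-(σ * 0 ^ 2)) 0 0 0, lowDegree W 0 1 (-0) 0 0] R₁ *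
        lowDegree W W.a₃ (-(W.a₃ * (σ * 0 ^ 2))) 1 (-(σ * 0)) 0 +
      aeval ![lowDegree W 1 (-(σ * 0 ^ 2)) 0 0 0, lowDegree W 0 1 (-0) 0 0] R₀ *
        lowDegree W 0 1 0 (-(σ * 0 ^ 2)) 0 = 0) : R₀ = 0 ∧ R₁ = 0 := by
  simp only [ne_eq, OfNat.ofNat_ne_zero, not_false_eq_true, zero_pow, mul_zero, neg_zero,
    lowDegree_one, lowDegree_coordX] at h
  have h2 := eq_zero_of_aeval_one_coordX (W := W)
    (((isHomogeneous_C_mul_X W.a₃ 0).mul hR₁).add ((isHomogeneous_X K 1).mul hR₀)) hR₁ (by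
      rw [← h]
      simp [lowDegree]
      ring)
  obtain ⟨h3, rfl⟩ := h2
  rw [mul_zero, zero_add] at h3
  exact ⟨(mul_eq_zero.mp h3).resolve_left (X_ne_zero 1), rfl⟩

theorem slopeCube_key_infinity (hR₀ : R₀.IsHomogeneous e) (hR₁ : R₁.IsHomogeneous e')
    (h : aeval ![lowDegree W 1 (-(σ * 0 ^ 2)) 0 0 0, lowDegree W 0 1 (-0) 0 0] R₁ *
        lowDegree W 0 0 1 (-(σ * 0)) 0 +
      aeval ![lowDegree W 1 (-(σ * 0 ^ 2)) 0 0 0, lowDegree W 0 1 (-0) 0 0] R₀ = 0) :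
    R₀ = 0 ∧ R₁ = 0 := by
  simp only [ne_eq, OfNat.ofNat_ne_zero, not_false_eq_true, zero_pow, mul_zero, neg_zero,
    lowDegree_one, lowDegree_coordX] at h
  refine eq_zero_of_aeval_one_coordX (W := W) hR₀ hR₁ ?_
  rw [← h]
  simp [lowDegree]

variable {p q : K}

theorem noShortRelation_slope (hτ : τ ≠ 0) (hστ : σ * τ ^ 2 * p = 1) (hp : p = τ * q)
    (h : W.toAffine.Nonsingular p q) : NoShortRelation (K := K)
      ![lowDegree W 1 (-(σ * τ ^ 2)) 0 0 0, lowDegree W 0 1 (-τ) 0 0] := by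
  have h1 := (noShortRelation_lowDegree h).linear_change (a := -(σ * τ ^ 2)) (b := 0) (c := 1)
    (d := -τ) (by
      have := left_ne_zero_of_mul_eq_one hστ
      simpa using ⟨left_ne_zero_of_mul this, hτ⟩)
  have e1 := congrArg (algebraMap K W.toAffine.CoordinateRing) hστ
  have e2 := congrArg (algebraMap K W.toAffine.CoordinateRing) hp
  simp only [map_mul, map_pow, map_one] at e1 e2
  convert h1 using 2
  · simp [lowDegree]
    linear_combination -e1
  · congr 1
    simp [lowDegree]
    linear_combination e2

/-- At an affine point, `y - σ τ x²` is the sum of a linear and a quadratic form in `1 - σ τ² x`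
and `x - τ y`. -/
theorem slope_expansion (hτ : τ ≠ 0) (hστ : σ * τ ^ 2 * p = 1) (hp : p = τ * q) :
    lowDegree W 0 0 1 (-(σ * τ)) 0 =
      aeval ![lowDegree W 1 (-(σ * τ ^ 2)) 0 0 0, lowDegree W 0 1 (-τ) 0 0]
        (C q * X 0 - C τ⁻¹ * X 1 : MvPolynomial (Fin 2) K) +
      aeval ![lowDegree W 1 (-(σ * τ ^ 2)) 0 0 0, lowDegree W 0 1 (-τ) 0 0]
        (C (-q) * X 0 ^ 2 : MvPolynomial (Fin 2) K) := by
  have e1 := congrArg (algebraMap K W.toAffine.CoordinateRing) hστ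
  have e2 := congrArg (algebraMap K W.toAffine.CoordinateRing) hp
  have e3 := congrArg (algebraMap K W.toAffine.CoordinateRing) (inv_mul_cancel₀ hτ)
  simp only [map_mul, map_pow, map_one] at e1 e2 e3
  simp [lowDegree, -map_inv₀]
  set i := algebraMap K W.toAffine.CoordinateRing τ⁻¹
  set s := algebraMap K W.toAffine.CoordinateRing σ
  set t := algebraMap K W.toAffine.CoordinateRing τ
  set x := coordX W
  linear_combination x * (1 - s * t ^ 2 * x) * (s * t * e2 - i * e1 +
    s * t * algebraMap K _ p * e3) + (s * t * x ^ 2 - coordY W) * e3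

theorem slopeForm_key (hτ : τ ≠ 0) (hστ : σ * τ ^ 2 * p = 1) (hp : p = τ * q)
    (h : W.toAffine.Nonsingular p q) (hR₀ : R₀.IsHomogeneous e) (hR₁ : R₁.IsHomogeneous e)
    (hR : aeval ![lowDegree W 1 (-(σ * τ ^ 2)) 0 0 0, lowDegree W 0 1 (-τ) 0 0] R₁ *
        lowDegree W W.a₃ (-(W.a₃ * (σ * τ ^ 2))) 1 (-(σ * τ)) 0 +
      aeval ![lowDegree W 1 (-(σ * τ ^ 2)) 0 0 0, lowDegree W 0 1 (-τ) 0 0] R₀ *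
        lowDegree W 0 1 0 (-(σ * τ ^ 2)) 0 = 0) : R₀ = 0 ∧ R₁ = 0 := by
  have hp0 : p ≠ 0 := right_ne_zero_of_mul_eq_one hστ
  refine (noShortRelation_slope hτ hστ hp h).eq_zero_of_bilinear
    (b' := ![lowDegree W 0 1 0 (-(σ * τ ^ 2)) 0,
      lowDegree W W.a₃ (-(W.a₃ * (σ * τ ^ 2))) 1 (-(σ * τ)) 0])
    (l := ![C p * X 0, C W.a₃ * X 0 + (C q * X 0 - C τ⁻¹ * X 1)])
    (q := ![C (-p) * X 0 ^ 2, C (-q) * X 0 ^ 2]) ?_ ?_ ?_ ?_ hR₀ hR₁ hR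
  · intro i
    fin_cases i
    · exact isHomogeneous_C_mul_X _ _
    · exact (isHomogeneous_C_mul_X _ _).add
        ((isHomogeneous_C_mul_X _ _).sub (isHomogeneous_C_mul_X _ _))
  · intro i
    fin_cases i
    · exact isHomogeneous_C_mul_X_pow _ _ _
    · exact isHomogeneous_C_mul_X_pow _ _ _
  · intro h0
    have h1 := congrArg (eval ![1, 0]) h0
    have h2 := congrArg (eval ![1, 1]) h0
    simp at h1 h2
    have h3 : p * τ⁻¹ = 0 := by linear_combination h1 - h2
    exact mul_ne_zero hp0 (inv_ne_zero hτ) h3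
  · intro i
    fin_cases i
    · have e1 := congrArg (algebraMap K W.toAffine.CoordinateRing) hστ
      simp only [map_mul, map_pow, map_one] at e1
      simp [lowDegree]
      linear_combination (-coordX W * (1 - algebraMap K _ σ * algebraMap K _ τ ^ 2 * coordX W)) * e1
    · have h1 := slope_expansion (W := W) hτ hστ hp
      change lowDegree W W.a₃ (-(W.a₃ * (σ * τ ^ 2))) 1 (-(σ * τ)) 0 =
        aeval ![lowDegree W 1 (-(σ * τ ^ 2)) 0 0 0, lowDegree W 0 1 (-τ) 0 0]
          (C W.a₃ * X 0 + (C q * X 0 - C τ⁻¹ * X 1)) +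
        aeval ![lowDegree W 1 (-(σ * τ ^ 2)) 0 0 0, lowDegree W 0 1 (-τ) 0 0] (C (-q) * X 0 ^ 2)
      rw [map_add, add_assoc, ← h1]
      simp [lowDegree]
      ring

theorem slopeCube_key (hτ : τ ≠ 0) (hστ : σ * τ ^ 2 * p = 1) (hp : p = τ * q)
    (h : W.toAffine.Nonsingular p q) (hR₀ : R₀.IsHomogeneous (e + 1)) (hR₁ : R₁.IsHomogeneous e)
    (hR : aeval ![lowDegree W 1 (-(σ * τ ^ 2)) 0 0 0, lowDegree W 0 1 (-τ) 0 0] R₁ *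
        lowDegree W 0 0 1 (-(σ * τ)) 0 +
      aeval ![lowDegree W 1 (-(σ * τ ^ 2)) 0 0 0, lowDegree W 0 1 (-τ) 0 0] R₀ = 0) :
    R₀ = 0 ∧ R₁ = 0 := by
  have hq0 : q ≠ 0 := by
    rintro rfl
    rw [hp, mul_zero, mul_zero] at hστ
    exact zero_ne_one hστ
  refine (noShortRelation_slope hτ hστ hp h).eq_zero_of_linear
    ((isHomogeneous_C_mul_X q 0).sub (isHomogeneous_C_mul_X τ⁻¹ 1))
    (isHomogeneous_C_mul_X_pow (-q) 0 2) ?_ (slope_expansion hτ hστ hp) hR₀ hR₁ hR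
  exact mul_ne_zero (by simpa using hq0) (pow_ne_zero _ (X_ne_zero 0))

end Key

end Slope

end GenusOne

/-! ### Representability -/

namespace GenusOne

open Polynomial
open scoped Polynomial.Bivariate
open WeierstrassCurve WeierstrassCurve.Affine

section Representation

variable {K : Type*} [Field K] {W : WeierstrassCurve K} {D D' : Divisor W}

theorem VanishingIdealEq.representedByForm22 {b b' : Fin 2 → W.toAffine.CoordinateRing}
    {F : Form22 K} (h : VanishingIdealEq (K := K) b b' (Ideal.span {F.toPoly}))
    (hb : ∃ w : W.toAffine.FunctionField, w ≠ 0 ∧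
      IsLinearSystemBasis W D (fun i => w * algebraMap _ _ (b i)))
    (hb' : ∃ w : W.toAffine.FunctionField, w ≠ 0 ∧
      IsLinearSystemBasis W D' (fun i => w * algebraMap _ _ (b' i))) :
    RepresentedByForm22 W D D' F := by
  obtain ⟨w, hw, hs⟩ := hb
  obtain ⟨w', hw', ht⟩ := hb'
  exact ⟨_, _, hs, ht, h.definesImage (IsFractionRing.injective _ _) hw hw'⟩

theorem VanishingIdealEq.representedByCube {b b' : Fin 3 → W.toAffine.CoordinateRing}
    {S : Cube K} (h : VanishingIdealEq (K := K) b b' (Ideal.span (Set.range S.toPoly)))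
    (hb : ∃ w : W.toAffine.FunctionField, w ≠ 0 ∧
      IsLinearSystemBasis W D (fun i => w * algebraMap _ _ (b i)))
    (hb' : ∃ w : W.toAffine.FunctionField, w ≠ 0 ∧
      IsLinearSystemBasis W D' (fun i => w * algebraMap _ _ (b' i))) :
    RepresentedByCube W D D' S := by
  obtain ⟨w, hw, hs⟩ := hb
  obtain ⟨w', hw', ht⟩ := hb'
  exact ⟨_, _, hs, ht, h.definesImage (IsFractionRing.injective _ _) hw hw'⟩

/-- A basis of a linear system given by coefficient vectors, rewritten as an explicit list. -/
theorem exists_basis_congr {n : ℕ} {b b' : Fin n → W.toAffine.CoordinateRing}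
    (hb : ∀ i, b i = b' i)
    (h : ∃ w : W.toAffine.FunctionField, w ≠ 0 ∧
      IsLinearSystemBasis W D (fun i => w * algebraMap _ _ (b i))) :
    ∃ w : W.toAffine.FunctionField, w ≠ 0 ∧
      IsLinearSystemBasis W D (fun i => w * algebraMap _ _ (b' i)) :=
  funext hb ▸ h

variable {p q α β γ δ τ σ : K}

theorem IsFactorization.mem_mul (hf : IsFactorization W p q α β γ δ) (h₆ : W.a₆ = 0)
    (h : W.toAffine.Equation p q) :
    lowDegree W (δ * p - γ * q) (-δ) γ 0 0 ∈ CoordinateRing.XYIdeal W.toAffine p (C q) *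
      CoordinateRing.XYIdeal W.toAffine 0 (C (-W.a₃)) :=
  line_mem h₆ h hf.eq₁₁ hf.eq₁₂ hf.eq₂₁ hf.eq₂₂ hf.eq_one

/-- The function `x` vanishes at `-P`. -/
theorem lowDegree_x_mul_mem (h₆ : W.a₆ = 0) (h : W.toAffine.Equation p q) {a b c : K}
    (h0 : a + b * p + c * q = 0) :
    lowDegree W 0 a 0 b c ∈ CoordinateRing.XYIdeal W.toAffine p (C q) *
      CoordinateRing.XYIdeal W.toAffine 0 (C (-W.a₃)) := by
  have h1 := (lowDegree_mem_XYIdeal h a b c 0 0).mpr (by linear_combination h0)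
  have h2 := (lowDegree_mem_XYIdeal (negPoint_equation h₆) 0 1 0 0 0).mpr (by ring)
  convert Ideal.mul_mem_mul h1 h2 using 1
  simp [lowDegree]
  ring

/-- A function `f` vanishing at `A` and at `-P` is in the product of their ideals, as
`p f = x f - (x - p) f`. The hypothesis `p ≠ 0` excludes `A = -P`, where a double zero is
needed. -/
theorem lowDegree_mem_mul (h₆ : W.a₆ = 0) (h : W.toAffine.Equation p q) (hp : p ≠ 0)
    {a b c d e : K} (h1 : a + b * p + c * q + d * p ^ 2 + e * (p * q) = 0)
    (h2 : a + c * -W.a₃ = 0) :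
    lowDegree W a b c d e ∈ CoordinateRing.XYIdeal W.toAffine p (C q) *
      CoordinateRing.XYIdeal W.toAffine 0 (C (-W.a₃)) := by
  have h1 := (lowDegree_mem_XYIdeal h a b c d e).mpr h1
  have h2 := (lowDegree_mem_XYIdeal (negPoint_equation h₆) a b c d e).mpr
    (by linear_combination h2)
  have h3 := (lowDegree_mem_XYIdeal h (-p) 1 0 0 0).mpr (by ring)
  have h4 := (lowDegree_mem_XYIdeal (negPoint_equation h₆) 0 1 0 0 0).mpr (by ring)
  convert Ideal.mul_mem_left _ (algebraMap K W.toAffine.CoordinateRing p⁻¹)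
    (sub_mem (Ideal.mul_mem_mul h1 h4) (Ideal.mul_mem_mul h3 h2)) using 1
  have hi := congrArg (algebraMap K W.toAffine.CoordinateRing) (inv_mul_cancel₀ hp)
  simp only [map_mul, map_one] at hi
  generalize lowDegree W a b c d e = f
  simp only [lowDegree, map_neg, map_one, map_zero]
  linear_combination -f * hi

variable [W.IsElliptic]

theorem representedByForm22_factorForm (h₆ : W.a₆ = 0) (h : W.toAffine.Nonsingular p q)
    (hf : IsFactorization W p q α β γ δ) (hn : degree W D = 2) (hn' : degree W D' = 2)
    (hD : idealClass (XYIdeal_ne_bot (W := W) p q) = -divisorClass D)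
    (hD' : idealClass (XYIdeal_ne_bot (W := W) p q) +
      idealClass (XYIdeal_ne_bot (W := W) 0 (-W.a₃)) = -divisorClass D') :
    RepresentedByForm22 W D D' (factorForm W p α β γ δ) := by
  refine (vanishingIdealEq_factorForm h₆ h hf).representedByForm22
    (exists_basis_congr (fun i => by fin_cases i <;> rfl) (exists_basis_of_point (n := 2) hn h.1 hD
      (a := ![-p, -q]) (b := ![1, 0]) (c := ![0, 1]) (d := ![0, 0]) (e := ![0, 0])
      (by simp [Fin.forall_fin_two]) (linearIndependent_lowDegree _ _ _ _ _ ?_)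
      (by simp) (by simp) (by simp [Fin.forall_fin_two]) (by simp [Fin.forall_fin_two])))
    (exists_basis_congr (fun i => by fin_cases i <;> rfl) (exists_basis_of_pair (n := 2) hn'
      one_le_two h.1 (negPoint_equation h₆) hD' (a := ![δ * p - γ * q, 0]) (b := ![-δ, p])
      (c := ![γ, 0]) (d := ![0, -1]) (e := ![0, 0]) ?_ (linearIndependent_lowDegree _ _ _ _ _ ?_)
      (by simp) (by simp) (by simp) (by simp [Fin.forall_fin_two])))
  · intro g h1 h2 h3 h4 h5
    simp_all [Fin.sum_univ_two, Fin.forall_fin_two]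
  · rw [Fin.forall_fin_two]
    exact ⟨hf.mem_mul h₆ h.1, lowDegree_x_mul_mem h₆ h.1 (by simp)⟩
  · intro g h1 h2 h3 h4 h5
    have := hf.ne_zero h₆
    simp_all [Fin.sum_univ_two, Fin.forall_fin_two]
    tauto

theorem representedByCube_factorCube (h₆ : W.a₆ = 0) (h : W.toAffine.Nonsingular p q)
    (hf : IsFactorization W p q α β γ δ) (hn : degree W D = 3) (hn' : degree W D' = 3)
    (hD : idealClass (XYIdeal_ne_bot (W := W) p q) = -divisorClass D)
    (hD' : idealClass (XYIdeal_ne_bot (W := W) p q) +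
      idealClass (XYIdeal_ne_bot (W := W) 0 (-W.a₃)) = -divisorClass D') :
    RepresentedByCube W D D' (factorCube W p α β γ δ) := by
  refine (vanishingIdealEq_factorCube h₆ h hf).representedByCube
    (exists_basis_congr (fun i => by fin_cases i <;> rfl) (exists_basis_of_point (n := 3) hn h.1 hD
      (a := ![-p, -q, 0]) (b := ![1, 0, -p]) (c := ![0, 1, 0]) (d := ![0, 0, 1]) (e := ![0, 0, 0])
      ?_ (linearIndependent_lowDegree _ _ _ _ _ ?_)
      (by simp) (by simp) (by simp) (by simp [Fin.forall_fin_succ])))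
    (exists_basis_congr (fun i => by fin_cases i <;> rfl) (exists_basis_of_pair (n := 3) hn'
      (by simp) h.1 (negPoint_equation h₆) hD' (a := ![δ * p - γ * q, 0, 0]) (b := ![-δ, p, q])
      (c := ![γ, 0, 0]) (d := ![0, -1, 0]) (e := ![0, 0, -1]) ?_
      (linearIndependent_lowDegree _ _ _ _ _ ?_) (by simp) (by simp) (by simp) (by simp)))
  · simp [Fin.forall_fin_succ]
    ring
  · intro g h1 h2 h3 h4 h5
    simp_all [Fin.sum_univ_three, Fin.forall_fin_succ]
  · simp only [Fin.forall_fin_succ, IsEmpty.forall_iff, and_true]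
    exact ⟨hf.mem_mul h₆ h.1, lowDegree_x_mul_mem h₆ h.1 (by simp),
      lowDegree_x_mul_mem h₆ h.1 (by simp)⟩
  · intro g h1 h2 h3 h4 h5
    have := hf.ne_zero h₆
    simp_all [Fin.sum_univ_three, Fin.forall_fin_succ]
    tauto

theorem representedByForm22_slopeForm (h₆ : W.a₆ = 0) (h : W.toAffine.Nonsingular p q)
    (hs : IsSlope W τ σ) (hτ : τ ≠ 0) (hστ : σ * τ ^ 2 * p = 1) (hp : p = τ * q)
    (hn : degree W D = 2) (hn' : degree W D' = 2)
    (hD : idealClass (XYIdeal_ne_bot (W := W) p q) = -divisorClass D)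
    (hD' : idealClass (XYIdeal_ne_bot (W := W) p q) +
      idealClass (XYIdeal_ne_bot (W := W) 0 (-W.a₃)) = -divisorClass D') :
    RepresentedByForm22 W D D' (slopeForm W τ σ) := by
  have hp0 : p ≠ 0 := right_ne_zero_of_mul_eq_one hστ
  refine (vanishingIdealEq_slopeForm hs h₆ fun _ _ _ h₀ h₁ hR =>
    slopeForm_key hτ hστ hp h h₀ h₁ hR).representedByForm22
    (exists_basis_congr (fun i => by fin_cases i <;> rfl) (exists_basis_of_point (n := 2) hn h.1 hD
      (a := ![1, 0]) (b := ![-(σ * τ ^ 2), 1]) (c := ![0, -τ]) (d := ![0, 0]) (e := ![0, 0])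
      ?_ ?_
      (by simp) (by simp) (by simp [Fin.forall_fin_succ]) (by simp [Fin.forall_fin_succ])))
    (exists_basis_congr (fun i => by fin_cases i <;> rfl) (exists_basis_of_pair (n := 2) hn'
      one_le_two h.1 (negPoint_equation h₆) hD'
      (a := ![0, W.a₃]) (b := ![1, -(W.a₃ * (σ * τ ^ 2))]) (c := ![0, 1])
      (d := ![-(σ * τ ^ 2), -(σ * τ)]) (e := ![0, 0]) ?_ ?_
      (by simp) (by simp) (by simp) (by simp [Fin.forall_fin_succ])))
  · simp only [Fin.forall_fin_succ, IsEmpty.forall_iff, and_true]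
    simp
    exact ⟨by linear_combination -hστ, by linear_combination hp⟩
  · refine linearIndependent_lowDegree _ _ _ _ _ fun g h1 h2 h3 h4 h5 => ?_
    simp_all [Fin.sum_univ_two, Fin.forall_fin_succ]
  · simp only [Fin.forall_fin_succ, IsEmpty.forall_iff, and_true]
    refine ⟨lowDegree_x_mul_mem h₆ h.1 ?_, lowDegree_mem_mul h₆ h.1 hp0 ?_ ?_⟩
    · simp
      linear_combination -hστ
    · simp
      linear_combination (-W.a₃ - q) * hστ - σ * τ * p * hp
    · simp
  · refine linearIndependent_lowDegree _ _ _ _ _ fun g h1 h2 h3 h4 h5 => ?_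
    simp_all [Fin.sum_univ_two, Fin.forall_fin_succ]

theorem representedByCube_slopeCube (h₆ : W.a₆ = 0) (h : W.toAffine.Nonsingular p q)
    (hs : IsSlope W τ σ) (hτ : τ ≠ 0) (hστ : σ * τ ^ 2 * p = 1) (hp : p = τ * q)
    (hn : degree W D = 3) (hn' : degree W D' = 3)
    (hD : idealClass (XYIdeal_ne_bot (W := W) p q) = -divisorClass D)
    (hD' : idealClass (XYIdeal_ne_bot (W := W) p q) +
      idealClass (XYIdeal_ne_bot (W := W) 0 (-W.a₃)) = -divisorClass D') :
    RepresentedByCube W D D' (slopeCube W τ σ) := by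
  have hp0 : p ≠ 0 := right_ne_zero_of_mul_eq_one hστ
  refine (vanishingIdealEq_slopeCube hs h₆ fun _ _ _ h₀ h₁ hR =>
    slopeCube_key hτ hστ hp h h₀ h₁ hR).representedByCube
    (exists_basis_congr (fun i => by fin_cases i <;> rfl) (exists_basis_of_point (n := 3) hn h.1 hD
      (a := ![1, 0, 0]) (b := ![-(σ * τ ^ 2), 1, 0]) (c := ![0, -τ, 1]) (d := ![0, 0, -(σ * τ)])
      (e := ![0, 0, 0]) ?_ ?_
      (by simp) (by simp) (by simp) (by simp [Fin.forall_fin_succ])))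
    (exists_basis_congr (fun i => by fin_cases i <;> rfl) (exists_basis_of_pair (n := 3) hn'
      (by simp) h.1 (negPoint_equation h₆) hD'
      (a := ![0, W.a₃, 0]) (b := ![1, -(W.a₃ * (σ * τ ^ 2)), 0]) (c := ![0, 1, 0])
      (d := ![-(σ * τ ^ 2), -(σ * τ), 1]) (e := ![0, 0, -τ]) ?_ ?_
      (by simp) (by simp) (by simp) (by simp)))
  · simp only [Fin.forall_fin_succ, IsEmpty.forall_iff, and_true]
    simp
    exact ⟨by linear_combination -hστ, by linear_combination hp,
      by linear_combination -q * hστ - σ * τ * p * hp⟩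
  · refine linearIndependent_lowDegree _ _ _ _ _ fun g h1 h2 h3 h4 h5 => ?_
    simp_all [Fin.sum_univ_three, Fin.forall_fin_succ]
  · simp only [Fin.forall_fin_succ, IsEmpty.forall_iff, and_true]
    refine ⟨lowDegree_x_mul_mem h₆ h.1 ?_, lowDegree_mem_mul h₆ h.1 hp0 ?_ ?_,
      lowDegree_x_mul_mem h₆ h.1 ?_⟩
    · simp
      linear_combination -hστ
    · simp
      linear_combination (-W.a₃ - q) * hστ - σ * τ * p * hp
    · simp
    · simp
      linear_combination hp
  · refine linearIndependent_lowDegree _ _ _ _ _ fun g h1 h2 h3 h4 h5 => ?_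
    simp_all [Fin.sum_univ_three, Fin.forall_fin_succ]

theorem representedByForm22_slopeForm_infinity (h₆ : W.a₆ = 0)
    (hn : degree W D = 2) (hn' : degree W D' = 2) (hD : divisorClass D = 0)
    (hD' : idealClass (XYIdeal_ne_bot (W := W) 0 (-W.a₃)) = -divisorClass D') :
    RepresentedByForm22 W D D' (slopeForm W 0 1) := by
  refine (vanishingIdealEq_slopeForm (by simp [IsSlope]) h₆ fun _ _ _ h₀ h₁ hR =>
    slopeForm_key_infinity h₀ h₁ hR).representedByForm22
    (exists_basis_congr (fun i => by fin_cases i <;> rfl) (exists_basis_of_top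
      (n := 2) hn one_le_two hD
      (a := ![1, 0]) (b := ![-(1 * 0 ^ 2), 1]) (c := ![0, -0]) (d := ![0, 0]) (e := ![0, 0])
      ?_ (by simp) (by simp) (by simp [Fin.forall_fin_succ]) (by simp [Fin.forall_fin_succ])))
    (exists_basis_congr (fun i => by fin_cases i <;> rfl) (exists_basis_of_point (n := 2) hn'
      (negPoint_equation h₆) hD'
      (a := ![0, W.a₃]) (b := ![1, -(W.a₃ * (1 * 0 ^ 2))]) (c := ![0, 1])
      (d := ![-(1 * 0 ^ 2), -(1 * 0)]) (e := ![0, 0]) ?_ ?_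
      (by simp) (by simp) (by simp [Fin.forall_fin_succ]) (by simp [Fin.forall_fin_succ])))
  · refine linearIndependent_lowDegree _ _ _ _ _ fun g h1 h2 h3 h4 h5 => ?_
    simp_all [Fin.sum_univ_two, Fin.forall_fin_succ]
  · simp [Fin.forall_fin_succ]
  · refine linearIndependent_lowDegree _ _ _ _ _ fun g h1 h2 h3 h4 h5 => ?_
    simp_all [Fin.sum_univ_two, Fin.forall_fin_succ]

theorem representedByCube_slopeCube_infinity (h₆ : W.a₆ = 0)
    (hn : degree W D = 3) (hn' : degree W D' = 3) (hD : divisorClass D = 0)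
    (hD' : idealClass (XYIdeal_ne_bot (W := W) 0 (-W.a₃)) = -divisorClass D') :
    RepresentedByCube W D D' (slopeCube W 0 1) := by
  refine (vanishingIdealEq_slopeCube (by simp [IsSlope]) h₆ fun _ _ _ h₀ h₁ hR =>
    slopeCube_key_infinity h₀ h₁ hR).representedByCube
    (exists_basis_congr (fun i => by fin_cases i <;> rfl) (exists_basis_of_top
      (n := 3) hn (by simp) hD
      (a := ![1, 0, 0]) (b := ![-(1 * 0 ^ 2), 1, 0]) (c := ![0, -0, 1]) (d := ![0, 0, -(1 * 0)])
      (e := ![0, 0, 0]) ?_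
      (by simp) (by simp) (by simp [Fin.forall_fin_succ]) (by simp [Fin.forall_fin_succ])))
    (exists_basis_congr (fun i => by fin_cases i <;> rfl) (exists_basis_of_point (n := 3) hn'
      (negPoint_equation h₆) hD'
      (a := ![0, W.a₃, 0]) (b := ![1, -(W.a₃ * (1 * 0 ^ 2)), 0]) (c := ![0, 1, 0])
      (d := ![-(1 * 0 ^ 2), -(1 * 0), 1]) (e := ![0, 0, -0]) ?_ ?_ (by simp) (by simp) (by simp)
      (by simp [Fin.forall_fin_succ])))
  · refine linearIndependent_lowDegree _ _ _ _ _ fun g h1 h2 h3 h4 h5 => ?_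
    simp_all [Fin.sum_univ_three, Fin.forall_fin_succ]
  · simp [Fin.forall_fin_succ]
  · refine linearIndependent_lowDegree _ _ _ _ _ fun g h1 h2 h3 h4 h5 => ?_
    simp_all [Fin.sum_univ_three, Fin.forall_fin_succ]

end Representation

end GenusOne

/-! ### Integrality -/

namespace GenusOne

open Polynomial
open scoped Polynomial.Bivariate
open WeierstrassCurve WeierstrassCurve.Affine

section Integrality

variable {K : Type*} [Field K] {Γ₀ : Type*} [LinearOrderedCommGroupWithZero Γ₀] (v : Valuation K Γ₀)
  {W : WeierstrassCurve K}

/-- A singular matrix with integral entries is the product of an integral column and an integral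
row one of whose entries is `1`. -/
theorem exists_rank_one_factorization {a b c d : K} (ha : v a ≤ 1) (hb : v b ≤ 1) (hc : v c ≤ 1)
    (hd : v d ≤ 1) (hdet : a * d = b * c) : ∃ α β γ δ : K, v α ≤ 1 ∧ v β ≤ 1 ∧ v γ ≤ 1 ∧ v δ ≤ 1 ∧
      α * γ = a ∧ β * γ = b ∧ α * δ = c ∧ β * δ = d ∧ (α = 1 ∨ β = 1) := by
  -- It suffices to find a primitive row proportional to both rows of the matrix.
  obtain ⟨α, β, hα, hβ, h1, h2, h3⟩ : ∃ α β : K, v α ≤ 1 ∧ v β ≤ 1 ∧ α * b = β * a ∧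
      α * d = β * c ∧ (α = 1 ∨ β = 1) := by
    have key : ∀ r s t u : K, r * u = s * t → (r ≠ 0 ∨ s ≠ 0) → ∃ α β : K, v α ≤ 1 ∧ v β ≤ 1 ∧
        α * s = β * r ∧ α * u = β * t ∧ (α = 1 ∨ β = 1) := by
      intro r s t u h hrs
      rcases le_total (v s) (v r) with hv | hv
      · have hr : r ≠ 0 := by
          rintro rfl
          simp_all
        refine ⟨1, s / r, by simp, ?_, by field_simp, by field_simp; linear_combination h, .inl rfl⟩
        rw [map_div₀]
        exact div_le_one_of_le₀ hv zero_le
      · have hs : s ≠ 0 := by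
          rintro rfl
          simp_all
        refine ⟨r / s, 1, ?_, by simp, by field_simp, by field_simp; linear_combination h, .inr rfl⟩
        rw [map_div₀]
        exact div_le_one_of_le₀ hv zero_le
    by_cases h0 : a ≠ 0 ∨ b ≠ 0
    · exact key a b c d hdet h0
    · push Not at h0
      by_cases h0' : c ≠ 0 ∨ d ≠ 0
      · obtain ⟨α, β, h1, h2, h3, h4, h5⟩ := key c d a b (by linear_combination -hdet) h0'
        exact ⟨α, β, h1, h2, h4, h3, h5⟩
      · push Not at h0'
        exact ⟨1, 0, by simp, by simp, by simp [h0], by simp [h0'], .inl rfl⟩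
  rcases h3 with rfl | rfl
  · exact ⟨1, β, a, c, hα, hβ, ha, hc, by ring, by linear_combination -h1, by ring,
      by linear_combination -h2, .inl rfl⟩
  · exact ⟨α, 1, b, d, hα, hβ, hb, hd, by linear_combination h1, by ring, by linear_combination h2,
      by ring, .inr rfl⟩

variable {v} {p q : K}

theorem equation_factored (h₆ : W.a₆ = 0) (h : W.toAffine.Equation p q) :
    q * (q + (W.a₁ * p + W.a₃)) = p * (p ^ 2 + W.a₂ * p + W.a₄) := by
  have h' := (equation_iff ..).mp h
  simp only [h₆] at h'
  linear_combination h'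

/-- A point whose `x`-coordinate is integral has an integral factorisation. Its `y`-coordinate is
integral by the curve equation. -/
theorem exists_isFactorization (h₁ : v W.a₁ ≤ 1) (h₂ : v W.a₂ ≤ 1) (h₃ : v W.a₃ ≤ 1)
    (h₄ : v W.a₄ ≤ 1) (h₆ : W.a₆ = 0) (h : W.toAffine.Equation p q) (hp : v p ≤ 1) :
    ∃ α β γ δ : K, v α ≤ 1 ∧ v β ≤ 1 ∧ v γ ≤ 1 ∧ v δ ≤ 1 ∧ IsFactorization W p q α β γ δ := by
  have hE := equation_factored h₆ h
  rw [← v.mem_integer_iff] at h₁ h₂ h₃ h₄ hp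
  have hR : p ^ 2 + W.a₂ * p + W.a₄ ∈ v.integer :=
    add_mem (add_mem (pow_mem hp 2) (mul_mem h₂ hp)) h₄
  have hq : v q ≤ 1 := by
    by_contra! hq
    have h5 : v (q + (W.a₁ * p + W.a₃)) = v q :=
      v.map_add_eq_of_lt_left (((add_mem (mul_mem h₁ hp) h₃ : _ ∈ v.integer)).trans_lt hq)
    have h6 : v (q * (q + (W.a₁ * p + W.a₃))) ≤ 1 := hE ▸ mul_mem hp hR
    rw [map_mul, h5] at h6
    exact h6.not_gt (one_lt_mul'' hq hq)
  rw [← v.mem_integer_iff] at hq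
  obtain ⟨α, β, γ, δ, hα, hβ, hγ, hδ, e1, e2, e3, e4, e5⟩ := exists_rank_one_factorization v
    (a := p) (b := q) (c := q + W.a₃) (d := p ^ 2 + W.a₂ * p + W.a₄ - W.a₁ * q) hp hq
    (add_mem hq h₃) (sub_mem hR (mul_mem h₁ hq)) (by linear_combination -hE)
  exact ⟨α, β, γ, δ, hα, hβ, hγ, hδ, ⟨e1, e2, e3, e4, e5⟩⟩

/-- If `x` is not integral, then `y ^ 2` and `x ^ 3` have the same valuation, as the remaining
terms of the equation are smaller. -/
theorem exists_isSlope (h₁ : v W.a₁ ≤ 1) (h₂ : v W.a₂ ≤ 1) (h₃ : v W.a₃ ≤ 1)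
    (h₄ : v W.a₄ ≤ 1) (h₆ : W.a₆ = 0) (h : W.toAffine.Equation p q) (hp : 1 < v p) :
    ∃ τ σ : K, v τ ≤ 1 ∧ v σ ≤ 1 ∧ τ ≠ 0 ∧ σ * τ ^ 2 * p = 1 ∧ p = τ * q ∧ IsSlope W τ σ := by
  have hE := equation_factored h₆ h
  have hp0 : p ≠ 0 := by
    rintro rfl
    simp at hp
  have hpp : v p < v p ^ 2 := by
    rw [sq]
    exact lt_mul_of_one_lt_left (zero_lt_one.trans hp) hp
  have hR : v (p ^ 2 + W.a₂ * p + W.a₄) = v p ^ 2 := by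
    rw [add_assoc, v.map_add_eq_of_lt_left, map_pow]
    rw [map_pow]
    refine (v.map_add_le (x := W.a₂ * p) (y := W.a₄) (g := v p) ?_ (h₄.trans hp.le)).trans_lt hpp
    rw [map_mul]
    exact mul_le_of_le_one_left' h₂
  have hL : v (W.a₁ * p + W.a₃) ≤ v p := by
    refine v.map_add_le ?_ (h₃.trans hp.le)
    rw [map_mul]
    exact mul_le_of_le_one_left' h₁
  have hE' := congrArg v hE
  rw [map_mul, map_mul, hR] at hE'
  have hpq : v p < v q := by
    by_contra! hle
    have h5 : v q * v (q + (W.a₁ * p + W.a₃)) ≤ v p * v p :=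
      mul_le_mul' hle (v.map_add_le hle hL)
    rw [hE'] at h5
    exact h5.not_gt (mul_lt_mul_of_pos_left hpp (zero_lt_one.trans hp))
  have hq0 : q ≠ 0 := by
    rintro rfl
    simp at hpq
  rw [v.map_add_eq_of_lt_left (hL.trans_lt hpq)] at hE'
  refine ⟨p / q, q ^ 2 / p ^ 3, ?_, ?_, div_ne_zero hp0 hq0, by field_simp, by field_simp, ?_⟩
  · rw [map_div₀]
    exact div_le_one_of_le₀ hpq.le zero_le
  · rw [map_div₀, map_pow, map_pow, sq, hE', ← pow_succ']
    exact div_self_le_one _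
  · simp only [IsSlope, slopeM, slopeB]
    field_simp
    linear_combination hE

theorem factorForm_integral (h₁ : v W.a₁ ≤ 1) (h₂ : v W.a₂ ≤ 1) (hp : v p ≤ 1) {α β γ δ : K}
    (hα : v α ≤ 1) (hβ : v β ≤ 1) (hγ : v γ ≤ 1) (hδ : v δ ≤ 1) (i j : Fin 3) :
    v (factorForm W p α β γ δ i j) ≤ 1 := by
  rw [← v.mem_integer_iff] at *
  have h := add_mem h₂ hp
  fin_cases i <;> fin_cases j <;>
    first | assumption | exact zero_mem _ | exact one_mem _ | exact neg_mem ‹_›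

theorem factorCube_integral (h₁ : v W.a₁ ≤ 1) (h₂ : v W.a₂ ≤ 1) (hp : v p ≤ 1) {α β γ δ : K}
    (hα : v α ≤ 1) (hβ : v β ≤ 1) (hγ : v γ ≤ 1) (hδ : v δ ≤ 1) (i j k : Fin 3) :
    v (factorCube W p α β γ δ i j k) ≤ 1 := by
  rw [← v.mem_integer_iff] at *
  have h := add_mem h₂ hp
  fin_cases i <;> fin_cases j <;> fin_cases k <;>
    first | assumption | exact zero_mem _ | exact one_mem _ | exact neg_mem ‹_› |
      exact neg_mem (one_mem _)

variable {τ σ : K}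

theorem slopeB_mem_integer (h₂ : v W.a₂ ≤ 1) (h₃ : v W.a₃ ≤ 1) (h₄ : v W.a₄ ≤ 1)
    (hτ : v τ ≤ 1) (hσ : v σ ≤ 1) : slopeB W τ σ ∈ v.integer := by
  rw [← v.mem_integer_iff] at *
  exact add_mem (sub_mem h₂ (mul_mem (mul_mem hσ hτ) h₃)) (mul_mem (mul_mem hσ (pow_mem hτ 2)) h₄)

theorem slopeM_mem_integer (h₁ : v W.a₁ ≤ 1) (h₂ : v W.a₂ ≤ 1) (h₃ : v W.a₃ ≤ 1)
    (h₄ : v W.a₄ ≤ 1) (hτ : v τ ≤ 1) (hσ : v σ ≤ 1) : slopeM W τ σ ∈ v.integer :=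
  add_mem (neg_mem h₁) (mul_mem hτ (slopeB_mem_integer h₂ h₃ h₄ hτ hσ))

theorem slopeForm_integral (h₁ : v W.a₁ ≤ 1) (h₂ : v W.a₂ ≤ 1) (h₃ : v W.a₃ ≤ 1)
    (h₄ : v W.a₄ ≤ 1) (hτ : v τ ≤ 1) (hσ : v σ ≤ 1) (i j : Fin 3) :
    v (slopeForm W τ σ i j) ≤ 1 := by
  have hB := slopeB_mem_integer h₂ h₃ h₄ hτ hσ
  have hM := slopeM_mem_integer h₁ h₂ h₃ h₄ hτ hσ
  rw [← v.mem_integer_iff] at *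
  have e1 := sub_mem (mul_mem h₃ hM) h₄
  have e2 := add_mem (neg_mem h₃) (mul_mem hτ h₄)
  have e3 := add_mem (neg_mem hM) (mul_mem hτ hB)
  have e4 := mul_mem hτ hσ
  fin_cases i <;> fin_cases j <;>
    first | assumption | exact zero_mem _ | exact one_mem _ | exact neg_mem ‹_›

theorem slopeCube_integral (h₁ : v W.a₁ ≤ 1) (h₂ : v W.a₂ ≤ 1) (h₃ : v W.a₃ ≤ 1)
    (h₄ : v W.a₄ ≤ 1) (hτ : v τ ≤ 1) (hσ : v σ ≤ 1) (i j k : Fin 3) :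
    v (slopeCube W τ σ i j k) ≤ 1 := by
  have hB := slopeB_mem_integer h₂ h₃ h₄ hτ hσ
  have hM := slopeM_mem_integer h₁ h₂ h₃ h₄ hτ hσ
  rw [← v.mem_integer_iff] at *
  fin_cases i <;> fin_cases j <;> fin_cases k <;>
    first | assumption | exact zero_mem _ | exact one_mem _ | exact neg_mem ‹_› |
      exact neg_mem (one_mem _)

end Integrality

section Classes

variable {K : Type*} [Field K] {W : WeierstrassCurve K} [W.IsElliptic] {D D' : Divisor W}

theorem divisorClass_add (D D' : Divisor W) :
    divisorClass (D + D') = divisorClass D + divisorClass D' :=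
  Finsupp.sum_add_index' (fun _ => zero_zsmul _) (fun _ _ _ => add_zsmul _ _ _)

open Classical in
/-- If `D' - D` sums to `P`, then the class of `-P` is that of `D - D'`. -/
theorem divisorClass_of_sum_eq_originPoint (h₆ : W.a₆ = 0)
    (h : divisorSum W (D' - D) = originPoint W h₆) :
    idealClass (XYIdeal_ne_bot (W := W) 0 (-W.a₃)) = divisorClass D - divisorClass D' := by
  have hns : W.toAffine.Nonsingular 0 0 := by
    rw [← equation_iff_nonsingular]
    simp [equation_iff, h₆]
  have h1 : divisorClass (D' - D) = Point.toClass (Point.some 0 0 hns) := by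
    refine divisorClass_eq_toClass (h.trans ?_)
    simp [originPoint, geomPoint]
  have h2 : divisorClass D' = divisorClass (D' - D) + divisorClass D := by
    rw [← divisorClass_add, sub_add_cancel]
  have h3 : Point.toClass (-Point.some 0 0 hns) =
      idealClass (XYIdeal_ne_bot (W := W) 0 (-W.a₃)) := by
    rw [Point.neg_some, toClass_some_eq_mk0, idealClass]
    simp [negY]
  rw [h2, h1, ← h3, map_neg]
  abel

open Classical in
/-- The class group consists of the trivial class and the classes of the ideals of affine
points. -/
theorem eq_zero_or_exists_idealClass_eq
    (c : Additive (ClassGroup W.toAffine.CoordinateRing)) :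
    c = 0 ∨ ∃ p q, W.toAffine.Nonsingular p q ∧ idealClass (XYIdeal_ne_bot (W := W) p q) = c := by
  obtain ⟨A, rfl⟩ := toClass_surjective c
  cases A with
  | zero => exact .inl Point.toClass_zero
  | some p q h => exact .inr ⟨p, q, h, (toClass_some_eq_mk0 h).symm⟩

end Classes

end GenusOne

theorem mainTheorem6 {K : Type*} [Field K]
    (v : Valuation K (WithZero (Multiplicative ℤ))) (hv : Function.Surjective v)
    (W : WeierstrassCurve K) [W.IsElliptic]
    (h₁ : v W.a₁ ≤ 1) (h₂ : v W.a₂ ≤ 1) (h₃ : v W.a₃ ≤ 1) (h₄ : v W.a₄ ≤ 1) (h₆ : W.a₆ = 0)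
    (D D' : GenusOne.Divisor W)
    (hsum : GenusOne.divisorSum W (D' - D) = GenusOne.originPoint W h₆) :
    (GenusOne.degree W D = 2 → GenusOne.degree W D' = 2 →
      ∃ F : GenusOne.Form22 K, (∀ i j, v (F i j) ≤ 1) ∧
        GenusOne.RepresentedByForm22 W D D' F ∧ F.disc = W.Δ) ∧
    (GenusOne.degree W D = 3 → GenusOne.degree W D' = 3 →
      ∃ S : GenusOne.Cube K, (∀ i j k, v (S i j k) ≤ 1) ∧
        GenusOne.RepresentedByCube W D D' S ∧ S.disc = W.Δ) := by
  have hP := GenusOne.divisorClass_of_sum_eq_originPoint h₆ hsum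
  -- The point `A` with `D` linearly equivalent to `(n + 1) ∞ - A`.
  rcases GenusOne.eq_zero_or_exists_idealClass_eq (-GenusOne.divisorClass D) with
    hA | ⟨p, q, hA, hD⟩
  · have hD : GenusOne.divisorClass D = 0 := neg_eq_zero.mp hA
    have hs : GenusOne.IsSlope W (0 : K) 1 := by simp [GenusOne.IsSlope]
    rw [hD, zero_sub] at hP
    exact ⟨fun hn hn' => ⟨_, GenusOne.slopeForm_integral h₁ h₂ h₃ h₄ (by simp) (by simp),
      GenusOne.representedByForm22_slopeForm_infinity h₆ hn hn' hD hP,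
      GenusOne.slopeForm_disc hs h₆⟩,
      fun hn hn' => ⟨_, GenusOne.slopeCube_integral h₁ h₂ h₃ h₄ (by simp) (by simp),
        GenusOne.representedByCube_slopeCube_infinity h₆ hn hn' hD hP,
        GenusOne.slopeCube_disc hs h₆⟩⟩
  have hD' := congrArg₂ (· + ·) hD hP
  replace hD' := hD'.trans (neg_add_eq_sub _ _ |>.trans (sub_sub_cancel_left _ _))
  rcases le_or_gt (v p) 1 with hp | hp
  · obtain ⟨α, β, γ, δ, hα, hβ, hγ, hδ, hf⟩ :=
      GenusOne.exists_isFactorization h₁ h₂ h₃ h₄ h₆ hA.1 hp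
    exact ⟨fun hn hn' => ⟨_, GenusOne.factorForm_integral h₁ h₂ hp hα hβ hγ hδ,
      GenusOne.representedByForm22_factorForm h₆ hA hf hn hn' hD hD',
      GenusOne.factorForm_disc hf h₆⟩,
      fun hn hn' => ⟨_, GenusOne.factorCube_integral h₁ h₂ hp hα hβ hγ hδ,
        GenusOne.representedByCube_factorCube h₆ hA hf hn hn' hD hD',
        GenusOne.factorCube_disc hf h₆⟩⟩
  · obtain ⟨τ, σ, hτ, hσ, hτ0, hστ, hpq, hs⟩ :=
      GenusOne.exists_isSlope h₁ h₂ h₃ h₄ h₆ hA.1 hp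
    exact ⟨fun hn hn' => ⟨_, GenusOne.slopeForm_integral h₁ h₂ h₃ h₄ hτ hσ,
      GenusOne.representedByForm22_slopeForm h₆ hA hs hτ0 hστ hpq hn hn' hD hD',
      GenusOne.slopeForm_disc hs h₆⟩,
      fun hn hn' => ⟨_, GenusOne.slopeCube_integral h₁ h₂ h₃ h₄ hτ hσ,
        GenusOne.representedByCube_slopeCube h₆ hA hs hτ0 hστ hpq hn hn' hD hD',
        GenusOne.slopeCube_disc hs h₆⟩⟩
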